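/- Let $d\in\{2,3\}$, let $\Omega\subset\mathbb R^d$ be a bounded domain, $\mathcal B^\epsilon\subset\Omega$ a compact set (the perforations), $\Omega^\epsilon=\Omega\setminus\mathcal B^\epsilon$, and $$V=\{v\in H^1(\Omega^\epsilon): v=0\text{ on }\partial\Omega^\epsilon\cap\partial\Omega\}.$$ Here and below, functions in $H^1(D)$ vanishing on $\Gamma\subset\partial D$ are the $H^1(D)$-limits of functions in $H^1(D)$ that vanish near $\Gamma$. *Coarse grid.* Let $\Omega^\epsilon$ be covered by a conforming grid of $N_c$ closed cells. Each cell is the convex hull of its (at most $2^d$) vertices, distinct cells have disjoint interiors, and two cells meet in the convex hull of their common vertices. The coarse elements $K_1,\dots,K_{N_c}$ are the intersections of the interiors of the cells with $\Omega^\epsilon$. Each $K_i$ is nonempty and, up to a null set, a finite union of open sets that are star-shaped with respect to a ball (for example a union of fine-grid triangles or tetrahedra). Put $K_{i,0}=K_i$; for $m\ge 1$, $K_{i,m}$ is $K_i$ enlarged by $m$ coarse grid layers, one layer consisting of all elements whose cell shares a vertex with a cell already present (elements are joined across their common faces inside $\Omega^\epsilon$). Let $$V_0(K_{i,m})=\{v\in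 H^1(K_{i,m}): v=0\text{ on }\partial K_{i,m}\setminus(\partial K_{i,m}\cap\partial\mathcal B^\epsilon)\},$$ its elements being extended by zero to $\Omega^\epsilon$. *Weight and forms.* Let $\{\chi_v\}$, $v$ running over the $N_v$ vertices of the grid, be a partition of unity on $\Omega^\epsilon$ by Lipschitz functions with $0\le\chi_v\le1$, such that $\chi_v=0$ on every cell that does not have $v$ as a vertex. Let $\tilde\kappa=\sum_v|\nabla\chi_v|^2$ and $$a(u,v)=\int_{\Omega^\epsilon}\nabla u\cdot\nabla v,\quad a_i(u,v)=\int_{K_i}\nabla u\cdot\nabla v,\quad s_i(u,v)=\int_{K_i}\tilde\kappa uv,\quad s=\sum_i s_i,$$ $$\|u\|_a^2=\int_{\Omega^\epsilon}|\nabla u|^2,\qquad \|u\|_s^2=\int_{\Omega^\epsilon}\tilde\kappa u^2 .$$ *Auxiliary space.* For each $i$ let $\lambda_1^i\le\lambda_2^i\le\cdots$ be all the eigenvalues, repeated according to multiplicity, of the problem $a_i(\phi,v)=\lambda s_i(\phi,v)$ for all $v\in H^1(K_i)$, and let $\phi_1^i,\phi_2^i,\dots\in H^1(K_i)$ be corresponding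 $s_i$-orthonormal eigenfunctions, extended by zero outside $K_i$. Let $l_i$ be integers such that $\lambda^i_{l_i+1}>0$ for all $i$. Define $$\pi(u)=\sum_{i=1}^{N_c}\sum_{j=1}^{l_i}\frac{s_i(u,\phi_j^i)}{s_i(\phi_j^i,\phi_j^i)}\phi_j^i,\qquad \Lambda_\omega=\min_{K_i\cap\omega\ne\emptyset}\lambda^i_{l_i+1}\quad(\omega\subset\Omega^\epsilon),$$ with $\Lambda_\emptyset=+\infty$ (so that its negative powers are $0$); the same convention is used if $\omega$ meets no $K_i$. *Claim (exponential decay, relaxed version).* Fix $i$, $1\le j\le l_i$ and an integer $k_i\ge2$. Let $\psi_j^i$ be a minimizer of $$\psi\mapsto a(\psi,\psi)+s(\pi(\psi)-\phi_j^i,\pi(\psi)-\phi_j^i)$$ over $V$, and let $\psi_{j,\mathrm{ms}}^i$ be a minimizer of the same functional over $V_0(K_{i,k_i})$. Then $$\|\psi_j^i-\psi_{j,\mathrm{ms}}^i\|_a^2+\|\pi(\psi_j^i-\psi_{j,\mathrm{ms}}^i)\|_s^2\le E_i\left(\|\psi_j^i\|_a^2+\|\pi(\psi_j^i)\|_s^2\right),$$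 $$E_i=3\left(1+\Lambda_{\Omega^\epsilon\setminus K_{i,k_i-1}}^{-1}\right)\left(1+\Big(2\big(1+\Lambda_{K_{i,k_i-1}}^{-1/2}\big)\Big)^{-1}\right)^{1-k_i}.$$ -/

import Mathlib

open MeasureTheory Set
open scoped ContDiff

noncomputable section

namespace CEM

/-! ### First order Sobolev spaces through weak gradients -/

/-- `g` is a weak gradient of `u` in the open set `D`:
`∫_D u ∇η = - ∫_D η g` for all test functions `η ∈ C_c^∞(D)`. -/
def HasWeakGrad {d : ℕ} (D : Set (EuclideanSpace ℝ (Fin d)))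
    (u : EuclideanSpace ℝ (Fin d) → ℝ)
    (g : EuclideanSpace ℝ (Fin d) → EuclideanSpace ℝ (Fin d)) : Prop :=
  ∀ η : EuclideanSpace ℝ (Fin d) → ℝ, ContDiff ℝ ∞ η → HasCompactSupport η → tsupport η ⊆ D →
    ∫ x in D, u x • gradient η x = -∫ x in D, η x • g x

/-- `u` has a square integrable weak gradient in `D`. -/
def HasL2WeakGrad {d : ℕ} (D : Set (EuclideanSpace ℝ (Fin d)))
    (u : EuclideanSpace ℝ (Fin d) → ℝ) : Prop :=
  ∃ g : EuclideanSpace ℝ (Fin d) → EuclideanSpace ℝ (Fin d),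
    MemLp g 2 (volume.restrict D) ∧ HasWeakGrad D u g

/-- The Sobolev space `H¹(D)`. Elements are functions on the whole space of which only the
restriction to `D`, up to null sets, matters. -/
def H1 {d : ℕ} (D : Set (EuclideanSpace ℝ (Fin d))) : Set (EuclideanSpace ℝ (Fin d) → ℝ) :=
  {u | MemLp u 2 (volume.restrict D) ∧ HasL2WeakGrad D u}

open Classical in
/-- The weak gradient of `u` in `D` (unique up to a null set of `D`). -/
def weakGrad {d : ℕ} (D : Set (EuclideanSpace ℝ (Fin d))) (u : EuclideanSpace ℝ (Fin d) → ℝ) :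
    EuclideanSpace ℝ (Fin d) → EuclideanSpace ℝ (Fin d) :=
  if h : HasL2WeakGrad D u then h.choose else 0

/-- The square of the norm of `H¹(D)`. -/
def h1NormSq {d : ℕ} (D : Set (EuclideanSpace ℝ (Fin d)))
    (u : EuclideanSpace ℝ (Fin d) → ℝ) : ℝ :=
  (∫ x in D, u x ^ 2) + ∫ x in D, ‖weakGrad D u x‖ ^ 2

/-- The functions in `H¹(D)` that vanish on the part `Γ` of the boundary of `D`: the closure
in `H¹(D)` of the functions in `H¹(D)` that vanish in a neighbourhood of `Γ`. -/
def H1Zero {d : ℕ} (D Γ : Set (EuclideanSpace ℝ (Fin d))) :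
    Set (EuclideanSpace ℝ (Fin d) → ℝ) :=
  {u | u ∈ H1 D ∧ ∀ ε : ℝ, 0 < ε → ∃ w ∈ H1 D,
    (∃ U : Set (EuclideanSpace ℝ (Fin d)), IsOpen U ∧ Γ ⊆ U ∧
      ∀ᵐ x ∂(volume.restrict (D ∩ U)), w x = 0) ∧
    h1NormSq D (u - w) < ε}

/-- The energy form `∫_D ∇u · ∇v`. -/
def aForm {d : ℕ} (D : Set (EuclideanSpace ℝ (Fin d)))
    (u v : EuclideanSpace ℝ (Fin d) → ℝ) : ℝ :=
  ∫ x in D, inner ℝ (weakGrad D u x) (weakGrad D v x)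

/-- The weighted form `∫_D κ u v`. -/
def sForm {d : ℕ} (κ : EuclideanSpace ℝ (Fin d) → ℝ) (D : Set (EuclideanSpace ℝ (Fin d)))
    (u v : EuclideanSpace ℝ (Fin d) → ℝ) : ℝ :=
  ∫ x in D, κ x * u x * v x

/-! ### Perforated domain, coarse grid, partition of unity -/

/-- A bounded domain `Ω` with a compact set `B ⊆ Ω` of perforations. -/
structure PerforatedDomain (d : ℕ) where
  Omega : Set (EuclideanSpace ℝ (Fin d))
  B : Set (EuclideanSpace ℝ (Fin d))
  isOpen_Omega : IsOpen Omega
  isConnected_Omega : IsConnected Omega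
  isBounded_Omega : Bornology.IsBounded Omega
  isCompact_B : IsCompact B
  B_subset : B ⊆ Omega

/-- The perforated domain `Ω^ε = Ω \ B`. -/
def PerforatedDomain.dom {d : ℕ} (P : PerforatedDomain d) : Set (EuclideanSpace ℝ (Fin d)) :=
  P.Omega \ P.B

/-- `D` is star-shaped with respect to every point of some ball contained in it. -/
def StarShapedBall {d : ℕ} (D : Set (EuclideanSpace ℝ (Fin d))) : Prop :=
  ∃ (c : EuclideanSpace ℝ (Fin d)) (r : ℝ), 0 < r ∧ Metric.ball c r ⊆ D ∧
    ∀ y ∈ Metric.ball c r, StarConvex ℝ y D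

/-- `K` is, up to a null set, a finite union of open sets that are star-shaped with respect to
a ball. This holds when `K` is a finite union of triangles (tetrahedra), straight or
moderately curved, and for all bounded Lipschitz domains. -/
def IsFiniteUnionOfStarShaped {d : ℕ} (K : Set (EuclideanSpace ℝ (Fin d))) : Prop :=
  ∃ (n : ℕ) (D : Fin n → Set (EuclideanSpace ℝ (Fin d))),
    (∀ m, IsOpen (D m) ∧ D m ⊆ K ∧ StarShapedBall (D m)) ∧ volume (K \ ⋃ m, D m) = 0

/-- A conforming coarse grid with `Nc` coarse elements and `Nv` vertices.
The `i`-th cell is the convex hull of its vertices; two cells meet in the convex hull of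
their common vertices (a common face, or nothing). The coarse element `K_i` is the
part of the `i`-th (open) cell outside the perforations. -/
structure CoarseGrid {d : ℕ} (P : PerforatedDomain d) (Nc Nv : ℕ) where
  vertex : Fin Nv → EuclideanSpace ℝ (Fin d)
  vertex_injective : Function.Injective vertex
  /-- the vertices of the `i`-th cell -/
  vert : Fin Nc → Finset (Fin Nv)
  /-- as for triangles and quadrilaterals if `d = 2`, and for tetrahedra, pyramids, prisms and
  hexahedra if `d = 3` -/
  card_vert_le : ∀ i, (vert i).card ≤ 2 ^ d
  conforming : ∀ i j, convexHull ℝ (vertex '' (vert i)) ∩ convexHull ℝ (vertex '' (vert j)) =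
    convexHull ℝ (vertex '' ((vert i : Set (Fin Nv)) ∩ (vert j : Set (Fin Nv))))
  disjoint : ∀ i j, i ≠ j → Disjoint (interior (convexHull ℝ (vertex '' (vert i))))
    (interior (convexHull ℝ (vertex '' (vert j))))
  covers : P.dom ⊆ ⋃ i, convexHull ℝ (vertex '' (vert i))
  nonempty : ∀ i, (interior (convexHull ℝ (vertex '' (vert i))) ∩ P.dom).Nonempty
  regular : ∀ i,
    IsFiniteUnionOfStarShaped (interior (convexHull ℝ (vertex '' (vert i))) ∩ P.dom)

/-- The `i`-th closed cell of the coarse grid (perforations not removed). -/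
def CoarseGrid.cell {d Nc Nv : ℕ} {P : PerforatedDomain d} (G : CoarseGrid P Nc Nv)
    (i : Fin Nc) : Set (EuclideanSpace ℝ (Fin d)) :=
  convexHull ℝ (G.vertex '' (G.vert i))

/-- The (open) coarse element `K_i`. -/
def CoarseGrid.K {d Nc Nv : ℕ} {P : PerforatedDomain d} (G : CoarseGrid P Nc Nv)
    (i : Fin Nc) : Set (EuclideanSpace ℝ (Fin d)) :=
  interior (G.cell i) ∩ P.dom

/-- The indices of the coarse elements in `K_i` enlarged by `m` coarse grid layers: one layer
adds all elements that share a vertex with an element already present. -/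
def CoarseGrid.layer {d Nc Nv : ℕ} {P : PerforatedDomain d} (G : CoarseGrid P Nc Nv)
    (i : Fin Nc) : ℕ → Set (Fin Nc)
  | 0 => {i}
  | m + 1 => {j | ∃ p ∈ G.layer i m, ∃ v, v ∈ G.vert p ∧ v ∈ G.vert j}

/-- The oversampling domain `K_{i,m}`. -/
def CoarseGrid.over {d Nc Nv : ℕ} {P : PerforatedDomain d} (G : CoarseGrid P Nc Nv)
    (i : Fin Nc) (m : ℕ) : Set (EuclideanSpace ℝ (Fin d)) :=
  interior (⋃ j ∈ G.layer i m, G.cell j) ∩ P.dom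

/-- A (Lipschitz) partition of unity on the perforated domain, indexed by the vertices of
the coarse grid: the function of a vertex vanishes on the cells that do not have this vertex. -/
structure IsPartitionOfUnity {d Nc Nv : ℕ} {P : PerforatedDomain d} (G : CoarseGrid P Nc Nv)
    (χ : Fin Nv → EuclideanSpace ℝ (Fin d) → ℝ) : Prop where
  lipschitz : ∀ v, ∃ C, LipschitzOnWith C (χ v) P.dom
  mem_Icc : ∀ v, ∀ x ∈ P.dom, χ v x ∈ Icc (0 : ℝ) 1
  sum_eq_one : ∀ x ∈ P.dom, ∑ v, χ v x = 1
  eq_zero : ∀ i v, v ∉ G.vert i → ∀ x ∈ G.cell i ∩ P.dom, χ v x = 0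

/-- The weight `κ̃ = ∑_v |∇χ_v|²`. -/
def kappa {d Nv : ℕ} (χ : Fin Nv → EuclideanSpace ℝ (Fin d) → ℝ) :
    EuclideanSpace ℝ (Fin d) → ℝ :=
  fun x => ∑ v, ‖gradient (χ v) x‖ ^ 2

/-! ### Auxiliary space -/

/-- `w` solves `∫_K ∇w · ∇v = μ ∫_K κ w v` for all `v ∈ H¹(K)`. -/
def IsEigen {d : ℕ} (K : Set (EuclideanSpace ℝ (Fin d))) (κ : EuclideanSpace ℝ (Fin d) → ℝ)
    (μ : ℝ) (w : EuclideanSpace ℝ (Fin d) → ℝ) : Prop :=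
  w ∈ H1 K ∧ ∀ v ∈ H1 K, aForm K w v = μ * sForm κ K w v

/-- `lam 0 ≤ lam 1 ≤ …` are all the eigenvalues of the local spectral problem on `K`, in
ascending order and repeated according to multiplicity, and `φ 0, φ 1, …` are
corresponding `s`-orthonormal eigenfunctions. (The usual numbering starts from `1`.) -/
structure IsEigenSystem {d : ℕ} (K : Set (EuclideanSpace ℝ (Fin d)))
    (κ : EuclideanSpace ℝ (Fin d) → ℝ) (lam : ℕ → ℝ)
    (φ : ℕ → EuclideanSpace ℝ (Fin d) → ℝ) : Prop where
  isEigen : ∀ n, IsEigen K κ (lam n) (φ n)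
  orthonormal : ∀ m n, sForm κ K (φ m) (φ n) = if m = n then 1 else 0
  mono : Monotone lam
  /-- every eigenfunction with eigenvalue `μ` is a combination of the listed eigenfunctions with
  eigenvalue `μ` -/
  all : ∀ (μ : ℝ) (w : EuclideanSpace ℝ (Fin d) → ℝ), IsEigen K κ μ w →
    ∃ c : ℕ →₀ ℝ, (∀ n ∈ c.support, lam n = μ) ∧
      ∀ᵐ x ∂(volume.restrict K), w x = ∑ n ∈ c.support, c n * φ n x

section Spaces

variable {d Nc Nv : ℕ} {P : PerforatedDomain d}

/-- `s(u, v) = ∑_i s_i(u, v)`. -/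
def sGlob (G : CoarseGrid P Nc Nv) (χ : Fin Nv → EuclideanSpace ℝ (Fin d) → ℝ)
    (u v : EuclideanSpace ℝ (Fin d) → ℝ) : ℝ :=
  ∑ i, sForm (kappa χ) (G.K i) u v

/-- `φ_j^i`, extended by zero from `K_i`. -/
def auxFun (G : CoarseGrid P Nc Nv) (φ : Fin Nc → ℕ → EuclideanSpace ℝ (Fin d) → ℝ)
    (i : Fin Nc) (j : ℕ) : EuclideanSpace ℝ (Fin d) → ℝ :=
  (G.K i).indicator (φ i j)

/-- The projection `π` onto the auxiliary space spanned by the first `l i` eigenfunctions of each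
coarse element `K_i`. -/
def proj (G : CoarseGrid P Nc Nv) (χ : Fin Nv → EuclideanSpace ℝ (Fin d) → ℝ)
    (φ : Fin Nc → ℕ → EuclideanSpace ℝ (Fin d) → ℝ) (l : Fin Nc → ℕ)
    (u : EuclideanSpace ℝ (Fin d) → ℝ) : EuclideanSpace ℝ (Fin d) → ℝ :=
  fun x => ∑ i, ∑ j ∈ Finset.range (l i),
    sForm (kappa χ) (G.K i) u (φ i j) / sForm (kappa χ) (G.K i) (φ i j) (φ i j) *
      auxFun G φ i j x

/-- `‖u‖_a²`. -/
def normASq (P : PerforatedDomain d) (u : EuclideanSpace ℝ (Fin d) → ℝ) : ℝ :=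
  ∫ x in P.dom, ‖weakGrad P.dom u x‖ ^ 2

/-- `‖u‖_s²`. -/
def normSSq (P : PerforatedDomain d) (χ : Fin Nv → EuclideanSpace ℝ (Fin d) → ℝ)
    (u : EuclideanSpace ℝ (Fin d) → ℝ) : ℝ :=
  ∫ x in P.dom, kappa χ x * u x ^ 2

/-- `V = {v ∈ H¹(Ω^ε) : v = 0 on ∂Ω^ε ∩ ∂Ω}`. -/
def V (P : PerforatedDomain d) : Set (EuclideanSpace ℝ (Fin d) → ℝ) :=
  H1Zero P.dom (frontier P.dom ∩ frontier P.Omega)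

/-- `V₀(K_{i,m}) = {v ∈ H¹(K_{i,m}) : v = 0 on ∂K_{i,m} \ (∂K_{i,m} ∩ ∂B)}`; its elements are
extended by zero. -/
def V0 (G : CoarseGrid P Nc Nv) (i : Fin Nc) (m : ℕ) :
    Set (EuclideanSpace ℝ (Fin d) → ℝ) :=
  {v | v ∈ H1Zero (G.over i m)
      (frontier (G.over i m) \ (frontier (G.over i m) ∩ frontier P.B)) ∧
    ∀ x, x ∉ G.over i m → v x = 0}

/-- The functional `a(ψ, ψ) + s(π ψ - φ_j^i, π ψ - φ_j^i)`. -/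
def relaxedEnergy (G : CoarseGrid P Nc Nv) (χ : Fin Nv → EuclideanSpace ℝ (Fin d) → ℝ)
    (φ : Fin Nc → ℕ → EuclideanSpace ℝ (Fin d) → ℝ) (l : Fin Nc → ℕ) (i : Fin Nc) (j : ℕ)
    (ψ : EuclideanSpace ℝ (Fin d) → ℝ) : ℝ :=
  aForm P.dom ψ ψ +
    sGlob G χ (proj G χ φ l ψ - auxFun G φ i j) (proj G χ φ l ψ - auxFun G φ i j)

/-- `ψ` is a minimizer over `V` : the relaxed global basis function `ψ_j^i`. -/
def IsGlobalBasis (G : CoarseGrid P Nc Nv) (χ : Fin Nv → EuclideanSpace ℝ (Fin d) → ℝ)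
    (φ : Fin Nc → ℕ → EuclideanSpace ℝ (Fin d) → ℝ) (l : Fin Nc → ℕ) (i : Fin Nc) (j : ℕ)
    (ψ : EuclideanSpace ℝ (Fin d) → ℝ) : Prop :=
  ψ ∈ V P ∧ IsMinOn (relaxedEnergy G χ φ l i j) (V P) ψ

/-- `ψ` is a minimizer over `V₀(K_{i,m})` : the relaxed multiscale basis function. -/
def IsMultiscaleBasis (G : CoarseGrid P Nc Nv) (χ : Fin Nv → EuclideanSpace ℝ (Fin d) → ℝ)
    (φ : Fin Nc → ℕ → EuclideanSpace ℝ (Fin d) → ℝ) (l : Fin Nc → ℕ) (i : Fin Nc) (j : ℕ)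
    (m : ℕ) (ψ : EuclideanSpace ℝ (Fin d) → ℝ) : Prop :=
  ψ ∈ V0 G i m ∧ IsMinOn (relaxedEnergy G χ φ l i j) (V0 G i m) ψ

/-- `Λ_S`, the minimum of the first unused eigenvalues (`lam i (l i)`, as numbering starts
from `0`) over all coarse elements `K_i` that meet `S`. If there are none, this is `0`, and the
powers `Λ_S⁻¹`, `Λ_S ^ (-1/2)` below are `0`, in accordance with `Λ_∅ = +∞`. -/
def Lambda (G : CoarseGrid P Nc Nv) (lam : Fin Nc → ℕ → ℝ) (l : Fin Nc → ℕ)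
    (S : Set (EuclideanSpace ℝ (Fin d))) : ℝ :=
  sInf {t | ∃ i, (G.K i ∩ S).Nonempty ∧ t = lam i (l i)}

/-- The decay factor `E_i` for the oversampling domain `K_{i,k}`. -/
def decayFactor (G : CoarseGrid P Nc Nv) (lam : Fin Nc → ℕ → ℝ) (l : Fin Nc → ℕ)
    (i : Fin Nc) (k : ℕ) : ℝ :=
  3 * (1 + (Lambda G lam l (P.dom \ G.over i (k - 1)))⁻¹) *
    (1 + (2 * (1 + Lambda G lam l (G.over i (k - 1)) ^ (-(1 / 2 : ℝ))))⁻¹) ^ (1 - (k : ℤ))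

end Spaces

end CEM

end

/-! Put `b(u, v) = a(u, v) + s(πu, πv)`. Since the `φ_n` are orthonormal, the functional equals
`b(ψ, ψ) - 2 s_i(ψ, φ_j^i) + 1`, so each minimizer satisfies `b(ψ, w) = s_i(w, φ_j^i)` for all `w`
in its own space (`partForm_eq_of_isMinOn`). The left side of the claim is `b(e, e)` with `e = ψ -
ψ_ms`. Everything is a sum over coarse elements and rests on two local facts.

The first is the spectral inequality `s(u, u) ≤ s(πu, πu) + λ⁻¹ a(u, u)` on each element, with `λ`
the first unused eigenvalue. The hypothesis only says that every eigenfunction is listed, not that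
the list is complete in `H1`. If the inequality failed, minimizing the Rayleigh quotient on the
`s`-complement of the first eigenfunctions would give an unlisted eigenfunction
(`IsCompactPair.spectral_le`). The minimizer exists by Rellich compactness, proved for sets
star-shaped with respect to a ball by averaging contractions towards the points of the ball
(`totallyBounded_of_starShaped`).

The second is `|∇χ|² ≤ 2 κ̃` for the cutoff `χ` that sums the partition functions of all vertices of
layer `m` (`norm_gradient_cutoff_sq_le`). It is `1` on layer `m` and `0` beyond layer `m + 1`.

Decay: `(1 - χ) u` vanishes on `K_i`, so testing the equation with it gives `b(u, (1 - χ) u) = 0`.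
The integrand vanishes inside layer `m` and is that of `b(u, u)` outside layer `m + 1`. Hence the
energy outside layer `m + 1` is at most `c = 2 (1 + Λ^(-1/2))` times the energy in the ring between,
and it shrinks by the factor `(1 + c⁻¹)⁻¹` per layer (`partForm_outside_le`). Both minimizers decay
in this way.

Localization (`partForm_sub_self_le`): for `m = k - 1`, `χ ψ` is admissible in the local space, so
Galerkin orthogonality gives `b(e, e) = -b(ψ_ms, (1 - χ) ψ)`, which only involves elements outside
layer `m`. Cauchy-Schwarz and the decay of both factors give a full power of the decay rate, and the
product estimate for `(1 - χ) ψ` gives the factor `3 (1 + Λ⁻¹)`. -/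

open MeasureTheory Set
open scoped ContDiff
noncomputable section
namespace CEM

/-! ### Square integrable functions -/

section NormSq

variable {α F F' : Type*} [MeasurableSpace α] {μ : Measure α} [NormedAddCommGroup F]
  [NormedAddCommGroup F']

/-- The square of the `L²` norm. -/
def nsq (μ : Measure α) (f : α → F) : ℝ := ∫ x, ‖f x‖ ^ 2 ∂μ

theorem nsq_nonneg (f : α → F) : 0 ≤ nsq μ f := integral_nonneg fun _ => by positivity

theorem nsq_congr {f g : α → F} (h : f =ᵐ[μ] g) : nsq μ f = nsq μ g :=
  integral_congr_ae (by filter_upwards [h] with x hx; simp [hx])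

theorem integrable_norm_sq {f : α → F} (hf : MemLp f 2 μ) :
    Integrable (fun x => ‖f x‖ ^ 2) μ := hf.integrable_norm_pow (by norm_num)

theorem integrable_norm_mul_norm {f : α → F} {g : α → F'} (hf : MemLp f 2 μ) (hg : MemLp g 2 μ) :
    Integrable (fun x => ‖f x‖ * ‖g x‖) μ := hf.norm.integrable_mul hg.norm

theorem integral_norm_mul_norm_le {f : α → F} {g : α → F'} (hf : MemLp f 2 μ)
    (hg : MemLp g 2 μ) : ∫ x, ‖f x‖ * ‖g x‖ ∂μ ≤ √(nsq μ f) * √(nsq μ g) := by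
  have h := integral_mul_le_Lp_mul_Lq_of_nonneg (μ := μ) (f := fun x => ‖f x‖)
    (g := fun x => ‖g x‖) Real.HolderConjugate.two_two
    (.of_forall fun x => norm_nonneg _) (.of_forall fun x => norm_nonneg _)
    (by simpa using hf.norm) (by simpa using hg.norm)
  simpa [nsq, Real.sqrt_eq_rpow] using h

theorem integral_le_of_norm_mul_norm {f : α → F} {g : α → F'} {q : α → ℝ} (hf : MemLp f 2 μ)
    (hg : MemLp g 2 μ) (hq : ∀ᵐ x ∂μ, q x ≤ ‖f x‖ * ‖g x‖) :
    ∫ x, q x ∂μ ≤ √(nsq μ f) * √(nsq μ g) := by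
  by_cases hqi : Integrable q μ
  · exact (integral_mono_ae hqi (integrable_norm_mul_norm hf hg) hq).trans
      (integral_norm_mul_norm_le hf hg)
  -- A non-integrable `q` has integral `0` by convention, so no measurability of `q` has to be
  -- assumed.
  · rw [integral_undef hqi]; positivity

theorem norm_integral_le_of_norm_mul_norm {G : Type*} [NormedAddCommGroup G] [NormedSpace ℝ G]
    {f : α → F} {g : α → F'} {q : α → G} (hf : MemLp f 2 μ)
    (hg : MemLp g 2 μ) (hq : ∀ᵐ x ∂μ, ‖q x‖ ≤ ‖f x‖ * ‖g x‖) :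
    ‖∫ x, q x ∂μ‖ ≤ √(nsq μ f) * √(nsq μ g) :=
  (norm_integral_le_integral_norm _).trans (integral_le_of_norm_mul_norm hf hg hq)

theorem nsq_add_le {f g : α → F} (hf : MemLp f 2 μ) (hg : MemLp g 2 μ) :
    nsq μ (f + g) ≤ 2 * nsq μ f + 2 * nsq μ g := by
  unfold nsq
  rw [← integral_const_mul, ← integral_const_mul, ← integral_add
    ((integrable_norm_sq hf).const_mul _) ((integrable_norm_sq hg).const_mul _)]
  refine integral_mono (integrable_norm_sq (hf.add hg)) (((integrable_norm_sq hf).const_mul _).add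
    ((integrable_norm_sq hg).const_mul _)) fun x => ?_
  have := norm_add_le (f x) (g x)
  simp only [Pi.add_apply]
  nlinarith [norm_nonneg (f x + g x), sq_nonneg (‖f x‖ - ‖g x‖)]

theorem nsq_neg (f : α → F) : nsq μ (-f) = nsq μ f := by simp [nsq]

theorem nsq_sub_comm (f g : α → F) : nsq μ (f - g) = nsq μ (g - f) := by
  rw [← nsq_neg, neg_sub]

theorem nsq_smul [NormedSpace ℝ F] (c : ℝ) (f : α → F) : nsq μ (c • f) = c ^ 2 * nsq μ f := by
  simp [nsq, norm_smul, mul_pow, integral_const_mul]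

theorem nsq_le_of_norm_le {f : α → F} {g : α → F'} (hg : MemLp g 2 μ)
    (h : ∀ᵐ x ∂μ, ‖f x‖ ≤ ‖g x‖) : nsq μ f ≤ nsq μ g := by
  by_cases hf : Integrable (fun x => ‖f x‖ ^ 2) μ
  · exact integral_mono_ae hf (integrable_norm_sq hg) (by
      filter_upwards [h] with x hx; gcongr)
  · rw [nsq, integral_undef hf]; exact nsq_nonneg g

theorem nsq_eq_norm_toLp_sq [NormedSpace ℝ F] {f : α → F} (hf : MemLp f 2 μ) :
    nsq μ f = ‖hf.toLp f‖ ^ 2 := by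
  rw [Lp.norm_toLp, hf.eLpNorm_eq_integral_rpow_norm (by norm_num) (by norm_num)]
  have h0 : 0 ≤ ∫ x, ‖f x‖ ^ 2 ∂μ := nsq_nonneg f
  rw [ENNReal.toReal_ofReal (by positivity)]
  simp only [ENNReal.toReal_ofNat, Real.rpow_ofNat]
  rw [← Real.rpow_natCast, ← Real.rpow_mul h0]
  norm_num [nsq]

end NormSq

variable {d : ℕ}

/-! ### Weak gradients -/

/-- `u` and `g` are square integrable in `D`, and `g` is a weak gradient of `u`. -/
structure IsGrad (D : Set (EuclideanSpace ℝ (Fin d))) (u : EuclideanSpace ℝ (Fin d) → ℝ)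
    (g : EuclideanSpace ℝ (Fin d) → EuclideanSpace ℝ (Fin d)) : Prop where
  memLp : MemLp u 2 (volume.restrict D)
  memLp_grad : MemLp g 2 (volume.restrict D)
  weak : HasWeakGrad D u g

theorem continuous_gradient {η : EuclideanSpace ℝ (Fin d) → ℝ} (h : ContDiff ℝ ∞ η) :
    Continuous (gradient η) := by
  unfold gradient
  exact (LinearIsometryEquiv.continuous _).comp (h.continuous_fderiv (by simp))

theorem tsupport_gradient_subset (η : EuclideanSpace ℝ (Fin d) → ℝ) :
    tsupport (gradient η) ⊆ tsupport η := by
  refine closure_minimal (fun x hx => ?_) (isClosed_tsupport η)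
  refine support_fderiv_subset ℝ (f := η) ?_
  simp only [Function.mem_support, gradient] at hx ⊢
  intro h; simp [h] at hx

theorem hasCompactSupport_gradient {η : EuclideanSpace ℝ (Fin d) → ℝ} (h : HasCompactSupport η) :
    HasCompactSupport (gradient η) :=
  h.mono' ((subset_tsupport _).trans (tsupport_gradient_subset η))

theorem memLp_test {η : EuclideanSpace ℝ (Fin d) → ℝ} (h : ContDiff ℝ ∞ η)
    (hc : HasCompactSupport η) (D : Set (EuclideanSpace ℝ (Fin d))) :
    MemLp η 2 (volume.restrict D) :=
  h.continuous.memLp_of_hasCompactSupport hc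

theorem memLp_gradient_test {η : EuclideanSpace ℝ (Fin d) → ℝ} (h : ContDiff ℝ ∞ η)
    (hc : HasCompactSupport η) (D : Set (EuclideanSpace ℝ (Fin d))) :
    MemLp (gradient η) 2 (volume.restrict D) :=
  (continuous_gradient h).memLp_of_hasCompactSupport (hasCompactSupport_gradient hc)

theorem integrable_smul_of_memLp {α F : Type*} [MeasurableSpace α] {μ : Measure α}
    [NormedAddCommGroup F] [NormedSpace ℝ F] {f : α → ℝ} {g : α → F} (hf : MemLp f 2 μ)
    (hg : MemLp g 2 μ) : Integrable (fun x => f x • g x) μ :=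
  memLp_one_iff_integrable.1 (hg.smul hf)

theorem integrable_mul_of_memLp {α : Type*} [MeasurableSpace α] {μ : Measure α}
    {f g : α → ℝ} (hf : MemLp f 2 μ) (hg : MemLp g 2 μ) : Integrable (fun x => f x * g x) μ :=
  integrable_smul_of_memLp hf hg

variable {D D' : Set (EuclideanSpace ℝ (Fin d))} {u v : EuclideanSpace ℝ (Fin d) → ℝ}
  {g h : EuclideanSpace ℝ (Fin d) → EuclideanSpace ℝ (Fin d)}

theorem IsGrad.congr (hu : IsGrad D u g) (h1 : u =ᵐ[volume.restrict D] v)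
    (h2 : g =ᵐ[volume.restrict D] h) : IsGrad D v h := by
  refine ⟨(memLp_congr_ae h1).1 hu.memLp, (memLp_congr_ae h2).1 hu.memLp_grad, ?_⟩
  intro η a b c
  rw [← integral_congr_ae (f := fun x => u x • gradient η x) (g := fun x => v x • gradient η x)
    (by filter_upwards [h1] with x hx; simp [hx]), ← integral_congr_ae (f := fun x => η x • g x)
    (g := fun x => η x • h x) (by filter_upwards [h2] with x hx; simp [hx])]
  exact hu.weak η a b c

/-- `g - h` annihilates all test functions, so the fundamental lemma of the calculus of variations
applies. This makes the choice hidden in `weakGrad` harmless. -/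
theorem IsGrad.unique (hD : IsOpen D) (hu : IsGrad D u g) (hv : IsGrad D u h) :
    g =ᵐ[volume.restrict D] h := by
  rw [Filter.EventuallyEq, ae_restrict_iff' hD.measurableSet]
  have := IsOpen.ae_eq_zero_of_integral_contDiff_smul_eq_zero (μ := volume)
    (f := fun x => g x - h x) hD ?_ ?_
  · filter_upwards [this] with x hx hxD
    exact sub_eq_zero.1 (hx hxD)
  · have := (hu.memLp_grad.sub hv.memLp_grad).locallyIntegrable (by norm_num)
    exact locallyIntegrableOn_of_locallyIntegrable_restrict this
  · intro η a b c
    have e := (hu.weak η a b c).symm.trans (hv.weak η a b c)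
    have hη := memLp_test a b D
    rw [neg_inj] at e
    rw [← setIntegral_eq_integral_of_forall_compl_eq_zero (s := D)]
    · simp only [smul_sub]
      rw [integral_sub (integrable_smul_of_memLp hη hu.memLp_grad)
        (integrable_smul_of_memLp hη hv.memLp_grad), e, sub_self]
    · intro x hx
      rw [image_eq_zero_of_notMem_tsupport (fun h' => hx (c h')), zero_smul]

theorem IsGrad.add (hu : IsGrad D u g) (hv : IsGrad D v h) : IsGrad D (u + v) (g + h) := by
  refine ⟨hu.memLp.add hv.memLp, hu.memLp_grad.add hv.memLp_grad, fun η a b c => ?_⟩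
  simp only [Pi.add_apply, add_smul, smul_add]
  rw [integral_add (integrable_smul_of_memLp hu.memLp (memLp_gradient_test a b D))
    (integrable_smul_of_memLp hv.memLp (memLp_gradient_test a b D)),
    integral_add (integrable_smul_of_memLp (memLp_test a b D) hu.memLp_grad)
    (integrable_smul_of_memLp (memLp_test a b D) hv.memLp_grad), hu.weak η a b c,
    hv.weak η a b c]
  abel

theorem IsGrad.smul (c : ℝ) (hu : IsGrad D u g) : IsGrad D (c • u) (c • g) := by
  refine ⟨hu.memLp.const_smul c, hu.memLp_grad.const_smul c, fun η a b e => ?_⟩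
  simp only [Pi.smul_apply, smul_assoc, smul_comm _ c]
  rw [integral_smul, integral_smul, hu.weak η a b e, smul_neg]

theorem IsGrad.neg (hu : IsGrad D u g) : IsGrad D (-u) (-g) := by
  simpa using hu.smul (-1)

theorem IsGrad.sub (hu : IsGrad D u g) (hv : IsGrad D v h) : IsGrad D (u - v) (g - h) := by
  simpa [sub_eq_add_neg] using hu.add hv.neg

theorem isGrad_zero : IsGrad D 0 0 :=
  ⟨MemLp.zero, MemLp.zero, fun η _ _ _ => by simp⟩

theorem IsGrad.mono (hu : IsGrad D u g) (hD : D' ⊆ D) :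
    IsGrad D' u g := by
  refine ⟨hu.memLp.mono_measure (Measure.restrict_mono_set _ hD),
    hu.memLp_grad.mono_measure (Measure.restrict_mono_set _ hD), fun η a b c => ?_⟩
  have h1 : ∀ {F : Type} [NormedAddCommGroup F] [NormedSpace ℝ F]
      (q : EuclideanSpace ℝ (Fin d) → F), (∀ x, x ∉ tsupport η → q x = 0) →
      ∫ x in D', q x = ∫ x in D, q x := fun q hq => by
    rw [setIntegral_eq_integral_of_forall_compl_eq_zero (s := D') fun x hx => hq x fun h' =>
      hx (c h'), setIntegral_eq_integral_of_forall_compl_eq_zero (s := D) fun x hx => hq x fun h' =>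
      hx (hD (c h'))]
  rw [h1, h1]
  · exact hu.weak η a b (c.trans hD)
  · intro x hx; rw [image_eq_zero_of_notMem_tsupport hx, zero_smul]
  · intro x hx
    rw [image_eq_zero_of_notMem_tsupport fun h' => hx (tsupport_gradient_subset η h'), smul_zero]

/-- The weak gradient is a closed operator in `L²`, because both sides of its defining identity are
continuous in the pair. Completeness of `H1` and extension by zero rest on this. -/
theorem isGrad_of_approx (hu : MemLp u 2 (volume.restrict D)) (hg : MemLp g 2 (volume.restrict D))
    (H : ∀ ε > 0, ∃ w k, IsGrad D w k ∧ nsq (volume.restrict D) (u - w) < ε ∧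
      nsq (volume.restrict D) (g - k) < ε) : IsGrad D u g := by
  refine ⟨hu, hg, fun η a b c => ?_⟩
  have hη := memLp_test a b D
  have hη' := memLp_gradient_test a b D
  set A := √(nsq (volume.restrict D) (gradient η))
  set B := √(nsq (volume.restrict D) η)
  rw [← add_eq_zero_iff_eq_neg, ← norm_le_zero_iff]
  refine le_of_forall_pos_le_add fun ε hε => ?_
  -- Squared because `nsq` is a squared norm; the `+ 1` keeps the denominator positive even for `η =
  -- 0`.
  obtain ⟨w, k, hw, h1, h2⟩ := H ((ε / (A + B + 1)) ^ 2) (by positivity)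
  have e := hw.weak η a b c
  have e2 : (∫ x in D, u x • gradient η x) + ∫ x in D, η x • g x =
      (∫ x in D, (u - w) x • gradient η x) + ∫ x in D, η x • (g - k) x := by
    simp only [Pi.sub_apply, sub_smul, smul_sub]
    rw [integral_sub (integrable_smul_of_memLp hu hη') (integrable_smul_of_memLp hw.memLp hη'),
      integral_sub (integrable_smul_of_memLp hη hg) (integrable_smul_of_memLp hη hw.memLp_grad),
      e]
    abel
  have e3 := norm_integral_le_of_norm_mul_norm (q := fun x => (u - w) x • gradient η x)
    (hu.sub hw.memLp) hη' (.of_forall fun x => (norm_smul _ _).le)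
  have e4 := norm_integral_le_of_norm_mul_norm (q := fun x => η x • (g - k) x)
    hη (hg.sub hw.memLp_grad) (.of_forall fun x => (norm_smul _ _).le)
  have f1 := (Real.sqrt_lt_sqrt (nsq_nonneg _) h1).le
  have f2 := (Real.sqrt_lt_sqrt (nsq_nonneg _) h2).le
  rw [Real.sqrt_sq (by positivity)] at f1 f2
  rw [e2, zero_add]
  calc _ ≤ _ := norm_add_le _ _
    _ ≤ ε / (A + B + 1) * A + B * (ε / (A + B + 1)) := add_le_add
        (e3.trans (by gcongr)) (e4.trans (by gcongr))
    _ = ε * ((A + B) / (A + B + 1)) := by ring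
    _ ≤ ε * 1 := by
        gcongr
        rw [div_le_one (by positivity)]; linarith
    _ = ε := mul_one _

/-! ### The space `H1` -/

theorem isGrad_weakGrad (hu : u ∈ H1 D) : IsGrad D u (weakGrad D u) := by
  have h := hu.2
  unfold weakGrad
  rw [dif_pos h]
  exact ⟨hu.1, h.choose_spec.1, h.choose_spec.2⟩

theorem IsGrad.mem_H1 (hu : IsGrad D u g) : u ∈ H1 D := ⟨hu.memLp, g, hu.memLp_grad, hu.weak⟩

theorem IsGrad.weakGrad_ae_eq (hD : IsOpen D) (hu : IsGrad D u g) :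
    weakGrad D u =ᵐ[volume.restrict D] g :=
  (isGrad_weakGrad hu.mem_H1).unique hD hu

theorem IsGrad.unique' (hD : IsOpen D) (hu : IsGrad D u g) (hv : IsGrad D v h)
    (huv : u =ᵐ[volume.restrict D] v) : g =ᵐ[volume.restrict D] h :=
  (hu.congr huv .rfl).unique hD hv

theorem IsGrad.h1NormSq_eq (hD : IsOpen D) (hu : IsGrad D u g) :
    h1NormSq D u = nsq (volume.restrict D) u + nsq (volume.restrict D) g := by
  unfold h1NormSq
  rw [← nsq_congr (hu.weakGrad_ae_eq hD)]
  simp [nsq]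

theorem IsGrad.aForm_eq (hD : IsOpen D) (hu : IsGrad D u g) (hv : IsGrad D v h) :
    aForm D u v = ∫ x in D, inner ℝ (g x) (h x) := by
  refine integral_congr_ae ?_
  filter_upwards [hu.weakGrad_ae_eq hD, hv.weakGrad_ae_eq hD] with x h1 h2
  rw [h1, h2]

theorem aForm_self (D : Set (EuclideanSpace ℝ (Fin d))) (u : EuclideanSpace ℝ (Fin d) → ℝ) :
    aForm D u u = nsq (volume.restrict D) (weakGrad D u) := by
  simp [aForm, nsq]

theorem aForm_comm (D : Set (EuclideanSpace ℝ (Fin d))) (u v : EuclideanSpace ℝ (Fin d) → ℝ) :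
    aForm D u v = aForm D v u := by
  simp only [aForm, real_inner_comm]

theorem integrable_inner {μ : Measure (EuclideanSpace ℝ (Fin d))} (hg : MemLp g 2 μ)
    (hh : MemLp h 2 μ) : Integrable (fun x => inner ℝ (g x) (h x)) μ :=
  (integrable_norm_mul_norm hg hh).mono' (hg.1.inner hh.1)
    (.of_forall fun _ => norm_inner_le_norm _ _)

theorem add_mem_H1 (hu : u ∈ H1 D) (hv : v ∈ H1 D) : u + v ∈ H1 D :=
  ((isGrad_weakGrad hu).add (isGrad_weakGrad hv)).mem_H1

theorem sub_mem_H1 (hu : u ∈ H1 D) (hv : v ∈ H1 D) : u - v ∈ H1 D :=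
  ((isGrad_weakGrad hu).sub (isGrad_weakGrad hv)).mem_H1

theorem smul_mem_H1 (c : ℝ) (hu : u ∈ H1 D) : c • u ∈ H1 D :=
  ((isGrad_weakGrad hu).smul c).mem_H1

theorem mem_H1_mono (hu : u ∈ H1 D) (hD : D' ⊆ D) : u ∈ H1 D' :=
  ((isGrad_weakGrad hu).mono hD).mem_H1

theorem aForm_add_left (hD : IsOpen D) {w : EuclideanSpace ℝ (Fin d) → ℝ} (hu : u ∈ H1 D)
    (hv : v ∈ H1 D) (hw : w ∈ H1 D) : aForm D (u + v) w = aForm D u w + aForm D v w := by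
  have a := isGrad_weakGrad hu
  have b := isGrad_weakGrad hv
  have c := isGrad_weakGrad hw
  rw [(a.add b).aForm_eq hD c, aForm, aForm, ← integral_add (integrable_inner a.memLp_grad
    c.memLp_grad) (integrable_inner b.memLp_grad c.memLp_grad)]
  simp [inner_add_left]

theorem aForm_smul_left (hD : IsOpen D) (c : ℝ) (hu : u ∈ H1 D)
    (hv : v ∈ H1 D) : aForm D (c • u) v = c * aForm D u v := by
  have a := isGrad_weakGrad hu
  have b := isGrad_weakGrad hv
  rw [(a.smul c).aForm_eq hD b, aForm, ← integral_const_mul]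
  simp [inner_smul_left]

theorem aForm_add_right (hD : IsOpen D) {w : EuclideanSpace ℝ (Fin d) → ℝ} (hu : u ∈ H1 D)
    (hv : v ∈ H1 D) (hw : w ∈ H1 D) : aForm D w (u + v) = aForm D w u + aForm D w v := by
  rw [aForm_comm, aForm_add_left hD hu hv hw, aForm_comm, aForm_comm D v]

theorem aForm_smul_right (hD : IsOpen D) (c : ℝ) (hu : u ∈ H1 D)
    (hv : v ∈ H1 D) : aForm D v (c • u) = c * aForm D v u := by
  rw [aForm_comm, aForm_smul_left hD c hu hv, aForm_comm]

theorem aForm_self_nonneg : 0 ≤ aForm D u u := by rw [aForm_self]; exact nsq_nonneg _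

end CEM
end

/-! ### Lipschitz functions as test functions and as multipliers on `H1` -/

open MeasureTheory Set
open scoped ContDiff
noncomputable section
namespace CEM

variable {d : ℕ}

/-! ### Lipschitz multipliers -/

theorem inner_gradient (f : EuclideanSpace ℝ (Fin d) → ℝ) (x v : EuclideanSpace ℝ (Fin d)) :
    inner ℝ (gradient f x) v = fderiv ℝ f x v := by
  simp [gradient]

theorem norm_gradient (f : EuclideanSpace ℝ (Fin d) → ℝ) (x : EuclideanSpace ℝ (Fin d)) :
    ‖gradient f x‖ = ‖fderiv ℝ f x‖ := by
  simp [gradient]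

theorem measurable_gradient (f : EuclideanSpace ℝ (Fin d) → ℝ) : Measurable (gradient f) := by
  unfold gradient
  exact (LinearIsometryEquiv.continuous _).measurable.comp (measurable_fderiv ℝ f)

theorem ae_differentiableAt_of_lipschitzOnWith {f : EuclideanSpace ℝ (Fin d) → ℝ}
    {C : NNReal} {D : Set (EuclideanSpace ℝ (Fin d))} (hD : IsOpen D)
    (hf : LipschitzOnWith C f D) : ∀ᵐ x ∂(volume.restrict D), DifferentiableAt ℝ f x := by
  filter_upwards [hf.ae_differentiableWithinAt (μ := volume) hD.measurableSet,
    ae_restrict_mem hD.measurableSet] with x hx hxD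
  exact hx.differentiableAt (hD.mem_nhds hxD)

theorem norm_gradient_le {f : EuclideanSpace ℝ (Fin d) → ℝ}
    {C : NNReal} {D : Set (EuclideanSpace ℝ (Fin d))} (hD : IsOpen D)
    (hf : LipschitzOnWith C f D) {x : EuclideanSpace ℝ (Fin d)} (hx : x ∈ D) :
    ‖gradient f x‖ ≤ C := by
  rw [norm_gradient]
  exact norm_fderiv_le_of_lipschitzOn ℝ (hD.mem_nhds hx) hf

theorem gradient_congr {f k : EuclideanSpace ℝ (Fin d) → ℝ} {x : EuclideanSpace ℝ (Fin d)}
    (h : f =ᶠ[nhds x] k) : gradient f x = gradient k x := by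
  unfold gradient; rw [h.fderiv_eq]

-- The derivative first falls on the smooth kernel; integration by parts, valid for a Lipschitz
-- factor, moves it onto `f`, whose gradient exists almost everywhere.
open scoped Convolution in
theorem gradient_convolution {f : EuclideanSpace ℝ (Fin d) → ℝ} {C : NNReal}
    (hf : LipschitzWith C f) (φ : ContDiffBump (0 : EuclideanSpace ℝ (Fin d)))
    (x : EuclideanSpace ℝ (Fin d)) :
    gradient (φ.normed volume ⋆[ContinuousLinearMap.lsmul ℝ ℝ, volume] f) x =
      (φ.normed volume ⋆[ContinuousLinearMap.lsmul ℝ ℝ, volume] gradient f) x := by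
  have hφc := φ.hasCompactSupport_normed (μ := volume)
  have hφd : ContDiff ℝ 1 (φ.normed volume) := φ.contDiff_normed
  have hfl : LocallyIntegrable f volume := hf.continuous.locallyIntegrable
  have hgl : LocallyIntegrable (gradient f) volume := by
    refine MemLp.locallyIntegrable (p := ⊤) ?_ le_top
    exact memLp_top_of_bound (measurable_gradient f).aestronglyMeasurable C
      (.of_forall fun y => norm_gradient_le isOpen_univ hf.lipschitzOnWith (mem_univ y))
  refine ext_inner_right ℝ fun v => ?_
  rw [inner_gradient]
  have e1 := (hφc.hasFDerivAt_convolution_left (ContinuousLinearMap.lsmul ℝ ℝ) hφd hfl x).fderiv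
  rw [e1, convolution_eq_swap, convolution_eq_swap]
  have i1 : Integrable (fun t => ((ContinuousLinearMap.lsmul ℝ ℝ : ℝ →L[ℝ] ℝ →L[ℝ] ℝ).precompL
      (EuclideanSpace ℝ (Fin d))) (fderiv ℝ (φ.normed volume) (x - t)) (f t)) volume :=
    ((hφc.fderiv ℝ).convolutionExists_left ((ContinuousLinearMap.lsmul ℝ ℝ :
      ℝ →L[ℝ] ℝ →L[ℝ] ℝ).precompL (EuclideanSpace ℝ (Fin d)))
      (hφd.continuous_fderiv (by simp)) hfl x).integrable_swap
  have i2 : Integrable (fun t => (ContinuousLinearMap.lsmul ℝ ℝ) (φ.normed volume (x - t))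
      (gradient f t)) volume :=
    (hφc.convolutionExists_left (ContinuousLinearMap.lsmul ℝ ℝ)
      hφd.continuous hgl x).integrable_swap
  rw [ContinuousLinearMap.integral_apply i1, real_inner_comm, ← integral_inner i2]
  obtain ⟨B, hB⟩ := hφd.lipschitzWith_of_hasCompactSupport hφc (by simp)
  have hg : LipschitzWith B (fun t => φ.normed volume (x - t)) := by
    refine LipschitzWith.of_dist_le_mul fun s t => ?_
    have := hB.dist_le_mul (x - s) (x - t)
    rwa [dist_sub_left] at this
  have hgc : HasCompactSupport (fun t => φ.normed volume (x - t)) :=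
    hφc.comp_homeomorph (Homeomorph.subLeft x)
  -- The kernel is differentiated in the direction `-v`, which cancels the sign produced by `x - t`.
  have key := hf.integral_lineDeriv_mul_eq (μ := volume) hg hgc v
  have e2 : ∀ t, lineDeriv ℝ (fun t => φ.normed volume (x - t)) t (-v) =
      fderiv ℝ (φ.normed volume) (x - t) v := by
    intro t
    have h1 : HasFDerivAt (φ.normed volume) (fderiv ℝ (φ.normed volume) (x - t)) (x - t) :=
      (hφd.differentiable (by simp) _).hasFDerivAt
    have h2 := h1.comp t ((hasFDerivAt_id t).const_sub x)
    rw [show (fun t => φ.normed volume (x - t)) = (φ.normed volume) ∘ (HSub.hSub x) from rfl,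
      (h2.hasLineDerivAt (-v)).lineDeriv]
    simp
  simp only [e2] at key
  calc _ = ∫ t, fderiv ℝ (φ.normed volume) (x - t) v * f t := by
        refine integral_congr_ae (.of_forall fun t => ?_)
        simp [ContinuousLinearMap.precompL_apply]
    _ = ∫ t, lineDeriv ℝ f t v * φ.normed volume (x - t) := key.symm
    _ = _ := by
        refine integral_congr_ae ?_
        filter_upwards [hf.ae_differentiableAt (μ := volume)] with t ht
        rw [ht.lineDeriv_eq_fderiv, ← inner_gradient, real_inner_comm]
        simp [inner_smul_right, mul_comm]

/-- Lipschitz functions with compact support in `D` may be used as test functions. -/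
theorem IsGrad.integral_lipschitz {D : Set (EuclideanSpace ℝ (Fin d))} (hD : IsOpen D)
    {u : EuclideanSpace ℝ (Fin d) → ℝ} {g : EuclideanSpace ℝ (Fin d) → EuclideanSpace ℝ (Fin d)}
    (hu : IsGrad D u g) {f : EuclideanSpace ℝ (Fin d) → ℝ} {C : NNReal} (hf : LipschitzWith C f)
    (hc : HasCompactSupport f) (hs : tsupport f ⊆ D) :
    ∫ x in D, u x • gradient f x = -∫ x in D, f x • g x := by
  obtain ⟨r, hr, hrD⟩ := hc.isCompact.exists_cthickening_subset_open hD hs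
  have hK : IsCompact (Metric.cthickening r (tsupport f)) := hc.isCompact.cthickening
  set K := Metric.cthickening r (tsupport f)
  -- The outer radii tend to `0` and stay below `r`, so every mollification is supported in `K ⊆ D`.
  -- The bounded ratio `2` of the radii is needed for the almost everywhere convergence of mollified
  -- gradients.
  let φ : ℕ → ContDiffBump (0 : EuclideanSpace ℝ (Fin d)) := fun n =>
    ⟨r / (n + 2) / 2, r / (n + 2), by positivity, half_lt_self (by positivity)⟩
  have hφr : ∀ n, (φ n).rOut ≤ r := fun n => by
    change r / (n + 2) ≤ r
    exact div_le_self hr.le (by linarith [(Nat.cast_nonneg n : (0 : ℝ) ≤ n)])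
  have hφ0 : Filter.Tendsto (fun n => (φ n).rOut) Filter.atTop (nhds 0) := by
    change Filter.Tendsto (fun n : ℕ => r / ((n : ℝ) + 2)) Filter.atTop (nhds 0)
    exact tendsto_const_nhds.div_atTop
      (Filter.tendsto_atTop_add_const_right _ _ tendsto_natCast_atTop_atTop)
  let F : ℕ → EuclideanSpace ℝ (Fin d) → ℝ := fun n =>
    convolution ((φ n).normed volume) f (ContinuousLinearMap.lsmul ℝ ℝ) volume
  have hFs : ∀ n, ContDiff ℝ ∞ (F n) := fun n =>
    HasCompactSupport.contDiff_convolution_left _ (φ n).hasCompactSupport_normed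
      (φ n).contDiff_normed hf.continuous.locallyIntegrable
  have hFsupp : ∀ n, tsupport (F n) ⊆ K := by
    intro n
    refine closure_minimal ((support_convolution_subset _).trans ?_) hK.isClosed
    rw [(φ n).support_normed_eq]
    rintro _ ⟨a, ha, b, hb, rfl⟩
    refine Metric.mem_cthickening_of_dist_le _ b _ _ (subset_tsupport _ hb) ?_
    simp only [dist_eq_norm, add_sub_cancel_right]
    rw [mem_ball_zero_iff] at ha
    exact ha.le.trans (hφr n)
  have hFc : ∀ n, HasCompactSupport (F n) := fun n =>
    HasCompactSupport.of_support_subset_isCompact hK ((subset_tsupport _).trans (hFsupp n))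
  obtain ⟨B, hB⟩ := hc.exists_bound_of_continuous hf.continuous
  have hgb : ∀ x, ‖gradient f x‖ ≤ C := fun x =>
    norm_gradient_le isOpen_univ hf.lipschitzOnWith (mem_univ x)
  have bound : ∀ {G : Type} [NormedAddCommGroup G] [NormedSpace ℝ G] (q : _ → G) (c : ℝ),
      (∀ x, ‖q x‖ ≤ c) → ∀ n x, ‖convolution ((φ n).normed volume) q
        (ContinuousLinearMap.lsmul ℝ ℝ) volume x‖ ≤ c := by
    intro G _ _ q c hq n x
    have h1 : ∀ t, ‖(ContinuousLinearMap.lsmul ℝ ℝ) ((φ n).normed volume t) (q (x - t))‖ ≤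
        (φ n).normed volume t * c := fun t => by
      simp only [ContinuousLinearMap.lsmul_apply, norm_smul, Real.norm_eq_abs,
        abs_of_nonneg ((φ n).nonneg_normed t)]
      exact mul_le_mul_of_nonneg_left (hq _) ((φ n).nonneg_normed t)
    refine (norm_integral_le_of_norm_le ((φ n).integrable_normed.mul_const c)
      (.of_forall h1)).trans ?_
    rw [integral_mul_const, (φ n).integral_normed, one_mul]
  have hgl : LocallyIntegrable (gradient f) volume := by
    refine MemLp.locallyIntegrable (p := ⊤) ?_ le_top
    exact memLp_top_of_bound (measurable_gradient f).aestronglyMeasurable C (.of_forall hgb)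
  have hpt : ∀ᵐ x ∂(volume : Measure (EuclideanSpace ℝ (Fin d))),
      Filter.Tendsto (fun n => gradient (F n) x) Filter.atTop (nhds (gradient f x)) := by
    have := ContDiffBump.ae_convolution_tendsto_right_of_locallyIntegrable (μ := volume)
      (φ := φ) (K := 2) hφ0 (.of_forall fun n => by
        change r / (n + 2) ≤ 2 * (r / (n + 2) / 2)
        linarith) hgl
    filter_upwards [this] with x hx
    refine hx.congr fun n => ?_
    exact (gradient_convolution hf (φ n) x).symm
  have hpt0 : ∀ x, Filter.Tendsto (fun n => F n x) Filter.atTop (nhds (f x)) := fun x =>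
    ContDiffBump.convolution_tendsto_right_of_continuous hφ0 hf.continuous x
  have hFz : ∀ n x, x ∉ K → F n x = 0 := fun n x hx =>
    image_eq_zero_of_notMem_tsupport fun h => hx (hFsupp n h)
  have hFgz : ∀ n x, x ∉ K → gradient (F n) x = 0 := fun n x hx =>
    image_eq_zero_of_notMem_tsupport fun h => hx (hFsupp n (tsupport_gradient_subset _ h))
  have huK : IntegrableOn (fun x => K.indicator (fun x => |u x|) x) D volume := by
    have h1 : IntegrableOn u K volume := by
      have : IsFiniteMeasure (volume.restrict K) := ⟨by
        simpa using hK.measure_lt_top⟩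
      exact (hu.memLp.mono_measure (Measure.restrict_mono_set _ hrD)).integrable (by norm_num)
    exact ((integrable_indicator_iff hK.isClosed.measurableSet).2 h1.abs).integrableOn
  have hgK : IntegrableOn (fun x => K.indicator (fun x => ‖g x‖) x) D volume := by
    have h1 : IntegrableOn g K volume := by
      have : IsFiniteMeasure (volume.restrict K) := ⟨by
        simpa using hK.measure_lt_top⟩
      exact (hu.memLp_grad.mono_measure (Measure.restrict_mono_set _ hrD)).integrable (by norm_num)
    exact ((integrable_indicator_iff hK.isClosed.measurableSet).2 h1.norm).integrableOn
  -- The mollified gradients are bounded by `C` and supported in the compact set `K`, where `u` is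
  -- integrable, so `D` itself may have infinite measure.
  have L1 : Filter.Tendsto (fun n => ∫ x in D, u x • gradient (F n) x) Filter.atTop
      (nhds (∫ x in D, u x • gradient f x)) := by
    refine tendsto_integral_of_dominated_convergence
      (fun x => K.indicator (fun x => |u x|) x * C) (fun n => ?_) (huK.mul_const _) (fun n => ?_) ?_
    · exact hu.memLp.1.smul (continuous_gradient (hFs n)).aestronglyMeasurable
    · refine .of_forall fun x => ?_
      by_cases hx : x ∈ K
      · rw [norm_smul, indicator_of_mem hx, gradient_convolution hf (φ n) x]
        exact mul_le_mul_of_nonneg_left (bound _ _ hgb n x) (abs_nonneg _)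
      · simp [hFgz n x hx, hx]
    · filter_upwards [ae_restrict_of_ae hpt] with x hx
      exact hx.const_smul _
  have L2 : Filter.Tendsto (fun n => -∫ x in D, F n x • g x) Filter.atTop
      (nhds (-∫ x in D, f x • g x)) := by
    refine (tendsto_integral_of_dominated_convergence
      (fun x => B * K.indicator (fun x => ‖g x‖) x) (fun n => ?_) (hgK.const_mul _)
      (fun n => ?_) ?_).neg
    · exact (hFs n).continuous.aestronglyMeasurable.smul hu.memLp_grad.1
    · refine .of_forall fun x => ?_
      by_cases hx : x ∈ K
      · rw [norm_smul, indicator_of_mem hx]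
        exact mul_le_mul_of_nonneg_right (bound _ _ hB n x) (norm_nonneg _)
      · simp [hFz n x hx, hx]
    · exact .of_forall fun x => (hpt0 x).smul_const _
  have e : ∀ n, ∫ x in D, u x • gradient (F n) x = -∫ x in D, F n x • g x := fun n =>
    hu.weak _ (hFs n) (hFc n) ((hFsupp n).trans hrD)
  simp only [e] at L1
  exact tendsto_nhds_unique L1 L2

/-- The gradient of a product with a bounded Lipschitz function. -/
theorem IsGrad.mul_lipschitz {D : Set (EuclideanSpace ℝ (Fin d))} (hD : IsOpen D)
    {u σ : EuclideanSpace ℝ (Fin d) → ℝ}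
    {g : EuclideanSpace ℝ (Fin d) → EuclideanSpace ℝ (Fin d)}
    (hu : IsGrad D u g) {C : NNReal} (hσ : LipschitzOnWith C σ D) {M : ℝ}
    (hM : ∀ x ∈ D, |σ x| ≤ M) :
    IsGrad D (fun x => σ x * u x) (fun x => σ x • g x + u x • gradient σ x) := by
  have hσm : AEStronglyMeasurable σ (volume.restrict D) :=
    hσ.continuousOn.aestronglyMeasurable hD.measurableSet
  have m1 : MemLp (fun x => σ x * u x) 2 (volume.restrict D) :=
    hu.memLp.of_le_mul (c := M) (hσm.mul hu.memLp.1) (by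
      filter_upwards [ae_restrict_mem hD.measurableSet] with x hx
      rw [norm_mul]; exact mul_le_mul_of_nonneg_right (hM x hx) (norm_nonneg _))
  have m2 : MemLp (fun x => σ x • g x) 2 (volume.restrict D) :=
    hu.memLp_grad.of_le_mul (c := M) (hσm.smul hu.memLp_grad.1) (by
      filter_upwards [ae_restrict_mem hD.measurableSet] with x hx
      rw [norm_smul]; exact mul_le_mul_of_nonneg_right (hM x hx) (norm_nonneg _))
  have m3 : MemLp (fun x => u x • gradient σ x) 2 (volume.restrict D) :=
    hu.memLp.of_le_mul (c := C)
      (hu.memLp.1.smul (measurable_gradient σ).aestronglyMeasurable) (by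
      filter_upwards [ae_restrict_mem hD.measurableSet] with x hx
      rw [norm_smul, mul_comm]
      exact mul_le_mul_of_nonneg_right (norm_gradient_le hD hσ hx) (norm_nonneg _))
  refine ⟨m1, m2.add m3, fun η a b c => ?_⟩
  -- `IsGrad.integral_lipschitz` wants a globally Lipschitz test function, so `σ` is extended; the
  -- test function is `τ η`, and its values off `D` are `0`.
  obtain ⟨τ, hτ, hτσ⟩ := hσ.extend_real
  obtain ⟨A, hA⟩ := a.lipschitzWith_of_hasCompactSupport b (by simp)
  obtain ⟨R, hR⟩ := b.exists_bound_of_continuous a.continuous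
  have hR0 : 0 ≤ R := (norm_nonneg _).trans (hR 0)
  have hτM : ∀ x ∈ D, |τ x| ≤ M := fun x hx => by rw [← hτσ hx]; exact hM x hx
  have hηz : ∀ x, x ∉ D → η x = 0 := fun x hx => image_eq_zero_of_notMem_tsupport fun h => hx (c h)
  have hlip : LipschitzWith (⟨|M|, abs_nonneg _⟩ * A + C * ⟨R, hR0⟩) (fun x => τ x * η x) := by
    -- The bound `M` for `τ` is known on `D` only, so the difference is expanded with the
    -- undifferenced `τ` at the point of `D`.
    have key : ∀ x y, x ∈ D → |τ x * η x - τ y * η y| ≤ (|M| * A + C * R) * dist x y := by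
      intro x y hx
      have h1 : τ x * η x - τ y * η y = τ x * (η x - η y) + (τ x - τ y) * η y := by ring
      have h2 := hA.dist_le_mul x y
      have h3 := hτ.dist_le_mul x y
      have h4 := hR y
      rw [Real.dist_eq] at h2 h3
      rw [h1]
      refine (abs_add_le _ _).trans ?_
      rw [abs_mul, abs_mul, add_mul, mul_assoc]
      refine add_le_add (mul_le_mul ((hτM x hx).trans (le_abs_self M)) h2 (abs_nonneg _)
        (abs_nonneg _)) ?_
      calc _ ≤ C * dist x y * R := mul_le_mul h3 h4 (abs_nonneg _) (by positivity)
        _ = _ := by ring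
    refine LipschitzWith.of_dist_le_mul fun x y => ?_
    rw [Real.dist_eq]
    change _ ≤ (|M| * A + C * R) * dist x y
    by_cases hx : x ∈ D
    · exact key x y hx
    by_cases hy : y ∈ D
    · rw [abs_sub_comm, dist_comm]; exact key y x hy
    · rw [hηz x hx, hηz y hy]; simp; positivity
  have hsupp : tsupport (fun x => τ x * η x) ⊆ tsupport η :=
    closure_mono (Function.support_mul_subset_right _ _)
  have key := hu.integral_lipschitz hD hlip b.mul_left (hsupp.trans c)
  have hgr : ∀ᵐ x ∂(volume.restrict D), gradient (fun x => τ x * η x) x =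
      σ x • gradient η x + η x • gradient σ x := by
    filter_upwards [ae_restrict_of_ae (hτ.ae_differentiableAt (μ := volume)),
      ae_restrict_mem hD.measurableSet] with x h1 hx
    have h2 : DifferentiableAt ℝ η x := a.differentiable (by simp) x
    have h3 : gradient σ x = gradient τ x :=
      gradient_congr (Filter.eventuallyEq_of_mem (hD.mem_nhds hx) hτσ)
    rw [h3, hτσ hx]
    unfold gradient
    rw [fderiv_fun_mul h1 h2]
    simp
  have hηm := memLp_test a b D
  have hηg := memLp_gradient_test a b D
  have bigη : MemLp (fun x => η x • gradient σ x) 2 (volume.restrict D) :=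
    hηm.of_le_mul (c := C) (hηm.1.smul (measurable_gradient σ).aestronglyMeasurable) (by
      filter_upwards [ae_restrict_mem hD.measurableSet] with x hx
      rw [norm_smul, mul_comm]
      exact mul_le_mul_of_nonneg_right (norm_gradient_le hD hσ hx) (norm_nonneg _))
  have e1 : ∫ x in D, u x • gradient (fun x => τ x * η x) x =
      (∫ x in D, (σ x * u x) • gradient η x) + ∫ x in D, η x • u x • gradient σ x := by
    rw [← integral_add (integrable_smul_of_memLp m1 hηg) (integrable_smul_of_memLp hηm m3)]
    refine integral_congr_ae ?_
    filter_upwards [hgr] with x hx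
    rw [hx, smul_add, smul_smul, smul_smul, smul_smul, mul_comm (u x), mul_comm (u x)]
  have e2 : ∫ x in D, (τ x * η x) • g x = ∫ x in D, η x • σ x • g x := by
    refine setIntegral_congr_fun hD.measurableSet fun x hx => ?_
    rw [hτσ hx, smul_smul, mul_comm]
  rw [e1, e2] at key
  have e3 : ∫ x in D, η x • (σ x • g x + u x • gradient σ x) =
      (∫ x in D, η x • σ x • g x) + ∫ x in D, η x • u x • gradient σ x := by
    rw [← integral_add (integrable_smul_of_memLp hηm m2) (integrable_smul_of_memLp hηm m3)]
    simp [smul_add]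
  rw [e3, neg_add, ← key]
  abel

end CEM
end

/-! ### Rellich compactness on star-shaped sets by averaged contractions -/

open MeasureTheory Set
open scoped ContDiff
noncomputable section
namespace CEM

variable {d : ℕ}

/-! ### Contractions towards a point of a star-shaped set -/

theorem IsGrad.integral_fderiv {D : Set (EuclideanSpace ℝ (Fin d))}
    {u : EuclideanSpace ℝ (Fin d) → ℝ}
    {g : EuclideanSpace ℝ (Fin d) → EuclideanSpace ℝ (Fin d)} (hu : IsGrad D u g)
    {η : EuclideanSpace ℝ (Fin d) → ℝ} (a : ContDiff ℝ ∞ η) (b : HasCompactSupport η)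
    (c : tsupport η ⊆ D) (v : EuclideanSpace ℝ (Fin d)) :
    ∫ x in D, u x * fderiv ℝ η x v = -∫ x in D, η x * inner ℝ (g x) v := by
  have h := congrArg (fun w => inner ℝ v w) (hu.weak η a b c)
  simp only [inner_neg_right] at h
  rw [← integral_inner (integrable_smul_of_memLp hu.memLp (memLp_gradient_test a b D)),
    ← integral_inner (integrable_smul_of_memLp (memLp_test a b D) hu.memLp_grad)] at h
  simp only [inner_smul_right] at h
  simp only [← inner_gradient]
  simpa only [real_inner_comm] using h

/-- The map `z ↦ y + s (z - y)`. -/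
def dil (y : EuclideanSpace ℝ (Fin d)) (s : ℝ) (z : EuclideanSpace ℝ (Fin d)) :
    EuclideanSpace ℝ (Fin d) := y + s • (z - y)

theorem dil_one (y z : EuclideanSpace ℝ (Fin d)) : dil y 1 z = z := by simp [dil]

theorem dil_dil_inv (y z : EuclideanSpace ℝ (Fin d)) {s : ℝ} (hs : s ≠ 0) :
    dil y s (dil y s⁻¹ z) = z := by simp [dil, smul_smul, hs]

theorem dil_inv_dil (y z : EuclideanSpace ℝ (Fin d)) {s : ℝ} (hs : s ≠ 0) :
    dil y s⁻¹ (dil y s z) = z := by simp [dil, smul_smul, hs]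

/-- `dil` as a homeomorphism. -/
def dilHomeo (y : EuclideanSpace ℝ (Fin d)) (s : ℝ) (hs : s ≠ 0) :
    EuclideanSpace ℝ (Fin d) ≃ₜ EuclideanSpace ℝ (Fin d) where
  toFun := dil y s
  invFun := dil y s⁻¹
  left_inv z := dil_inv_dil y z hs
  right_inv z := dil_dil_inv y z hs
  continuous_toFun := by unfold dil; fun_prop
  continuous_invFun := by unfold dil; fun_prop

theorem contDiff_dil (y : EuclideanSpace ℝ (Fin d)) (s : ℝ) : ContDiff ℝ ∞ (dil y s) := by
  unfold dil; fun_prop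

theorem hasFDerivAt_dil (y z : EuclideanSpace ℝ (Fin d)) (s : ℝ) :
    HasFDerivAt (dil y s) (s • ContinuousLinearMap.id ℝ (EuclideanSpace ℝ (Fin d))) z := by
  unfold dil
  exact (((hasFDerivAt_id z).sub_const y).const_smul s).const_add y

/-- The new support is the image of the old one under the contraction `dil y s⁻¹`, which preserves a
set that is star-shaped about `y`. Hence `u` is never needed outside `D`. -/
theorem tsupport_comp_dil_subset {D : Set (EuclideanSpace ℝ (Fin d))}
    {y : EuclideanSpace ℝ (Fin d)} (hst : StarConvex ℝ y D) {η : EuclideanSpace ℝ (Fin d) → ℝ}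
    (c : tsupport η ⊆ D) {s : ℝ} (hs : 1 ≤ s) : tsupport (fun z => η (dil y s z)) ⊆ D := by
  have hs0 : s ≠ 0 := by positivity
  have h1 : tsupport (fun z => η (dil y s z)) ⊆ dil y s ⁻¹' tsupport η :=
    closure_minimal (fun z hz => subset_tsupport η hz)
      ((isClosed_tsupport η).preimage (dilHomeo y s hs0).continuous)
  intro z hz
  have h2 := hst.add_smul_sub_mem (c (h1 hz)) (t := s⁻¹) (by positivity)
    (inv_le_one_of_one_le₀ hs)
  have h3 := dil_inv_dil y z hs0
  rw [dil] at h3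
  rwa [h3] at h2

theorem hasCompactSupport_comp_dil {η : EuclideanSpace ℝ (Fin d) → ℝ} (b : HasCompactSupport η)
    (y : EuclideanSpace ℝ (Fin d)) {s : ℝ} (hs : s ≠ 0) :
    HasCompactSupport (fun z => η (dil y s z)) :=
  b.comp_homeomorph (dilHomeo y s hs)

theorem integral_comp_dil {F : Type*} [NormedAddCommGroup F] [NormedSpace ℝ F]
    (f : EuclideanSpace ℝ (Fin d) → F) (y : EuclideanSpace ℝ (Fin d)) {s : ℝ} (hs : 0 < s) :
    ∫ z, f (dil y s z) = (s ^ d)⁻¹ • ∫ z, f z := by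
  unfold dil
  rw [integral_sub_right_eq_self (fun z => f (y + s • z)) y,
    Measure.integral_comp_smul volume (fun z => f (y + z)) s,
    integral_add_left_eq_self (fun z => f z) y]
  simp [abs_of_pos hs]

theorem nsq_comp_dil_le {η : EuclideanSpace ℝ (Fin d) → ℝ} (y : EuclideanSpace ℝ (Fin d)) {s : ℝ}
    (hs : 1 ≤ s) : nsq volume (fun z => η (dil y s z)) ≤ nsq volume η := by
  have h := integral_comp_dil (fun z => ‖η z‖ ^ 2) y (lt_of_lt_of_le one_pos hs)
  have h2 : 0 ≤ ∫ z, ‖η z‖ ^ 2 := nsq_nonneg η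
  unfold nsq
  rw [h, smul_eq_mul]
  exact mul_le_of_le_one_left h2 (inv_le_one_of_one_le₀ (one_le_pow₀ hs))

theorem nsq_restrict_le {F : Type*} [NormedAddCommGroup F] {f : EuclideanSpace ℝ (Fin d) → F}
    {D D' : Set (EuclideanSpace ℝ (Fin d))} (h : D ⊆ D') (hf : MemLp f 2 (volume.restrict D')) :
    nsq (volume.restrict D) f ≤ nsq (volume.restrict D') f :=
  setIntegral_mono_set (integrable_norm_sq hf) (.of_forall fun _ => by positivity) h.eventuallyLE

/-- The divergence theorem for the field `η(y + s (z - y)) (z - y)`. -/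
theorem IsGrad.integral_div_dil {D : Set (EuclideanSpace ℝ (Fin d))}
    {u : EuclideanSpace ℝ (Fin d) → ℝ}
    {g : EuclideanSpace ℝ (Fin d) → EuclideanSpace ℝ (Fin d)} (hu : IsGrad D u g)
    {y : EuclideanSpace ℝ (Fin d)} (hst : StarConvex ℝ y D)
    {η : EuclideanSpace ℝ (Fin d) → ℝ} (a : ContDiff ℝ ∞ η) (b : HasCompactSupport η)
    (c : tsupport η ⊆ D) {s : ℝ} (hs : 1 ≤ s) :
    (d * ∫ z in D, u z * η (dil y s z)) +
        s * ∫ z in D, u z * fderiv ℝ η (dil y s z) (z - y) =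
      -∫ z in D, inner ℝ (g z) (η (dil y s z) • (z - y)) := by
  have hs0 : s ≠ 0 := by positivity
  have a' : ContDiff ℝ ∞ (fun z => η (dil y s z)) := a.comp (contDiff_dil y s)
  have b' := hasCompactSupport_comp_dil b y hs0
  have c' := tsupport_comp_dil_subset hst c hs
  -- Components of the field. Testing `ζ k` in the direction of the `k`-th basis vector and summing
  -- over `k` produces its divergence.
  let ζ : Fin d → EuclideanSpace ℝ (Fin d) → ℝ := fun k z => η (dil y s z) * (z k - y k)
  have hco : ∀ k, ContDiff ℝ ∞ (fun z : EuclideanSpace ℝ (Fin d) => z k - y k) := fun k =>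
    (contDiff_euclidean.1 contDiff_id k).sub contDiff_const
  have aζ : ∀ k, ContDiff ℝ ∞ (ζ k) := fun k => a'.mul (hco k)
  have bζ : ∀ k, HasCompactSupport (ζ k) := fun k => b'.mul_right
  have cζ : ∀ k, tsupport (ζ k) ⊆ D := fun k =>
    (closure_mono (Function.support_mul_subset_left _ _)).trans c'
  have key : ∀ k, ∫ z in D, u z * (η (dil y s z) + s * (fderiv ℝ η (dil y s z)
      (EuclideanSpace.single k 1) * (z k - y k))) =
      -∫ z in D, inner ℝ (g z) (ζ k z • EuclideanSpace.single k 1) := by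
    intro k
    have := hu.integral_fderiv (aζ k) (bζ k) (cζ k) (EuclideanSpace.single k 1)
    simp only [inner_smul_right]
    rw [← this]
    refine integral_congr_ae (.of_forall fun z => ?_)
    have h1 : HasFDerivAt (fun z => η (dil y s z)) _ z :=
      ((a.differentiable (by simp) (dil y s z)).hasFDerivAt).comp z (hasFDerivAt_dil y z s)
    have h2 : HasFDerivAt (fun z : EuclideanSpace ℝ (Fin d) => z k - y k)
        (EuclideanSpace.proj k : EuclideanSpace ℝ (Fin d) →L[ℝ] ℝ) z :=
      (EuclideanSpace.proj k : EuclideanSpace ℝ (Fin d) →L[ℝ] ℝ).hasFDerivAt.sub_const (y k)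
    have h3 := (h1.mul h2).fderiv
    have h4 : fderiv ℝ (ζ k) z = _ := h3
    simp only [h4]
    simp
    left; ring
  have hηL := memLp_test a' b' D
  have hd' : ∀ k, MemLp (fun z => fderiv ℝ η (dil y s z) (EuclideanSpace.single k 1) *
      (z k - y k)) 2 (volume.restrict D) := fun k => by
    refine Continuous.memLp_of_hasCompactSupport ?_ ?_
    · exact (((a.continuous_fderiv (by simp)).comp (contDiff_dil y s).continuous).clm_apply
        continuous_const).mul (hco k).continuous
    · have h5 : HasCompactSupport (fun z => fderiv ℝ η (dil y s z)) :=
        (b.fderiv ℝ).comp_homeomorph (dilHomeo y s hs0)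
      have h6 : HasCompactSupport (fun z => fderiv ℝ η (dil y s z) (EuclideanSpace.single k 1)) :=
        h5.comp_left (g := fun L : EuclideanSpace ℝ (Fin d) →L[ℝ] ℝ =>
          L (EuclideanSpace.single k 1)) (by simp)
      exact h6.mul_right
  have sum1 : ∀ z : EuclideanSpace ℝ (Fin d), ∑ k, (z k - y k) • EuclideanSpace.single k (1 : ℝ) =
      z - y := fun z => by
    ext m
    simp [Finset.sum_apply, Pi.single_apply]
  have e1 : ∑ k, ∫ z in D, u z * (η (dil y s z) + s * (fderiv ℝ η (dil y s z)
      (EuclideanSpace.single k 1) * (z k - y k))) = (d * ∫ z in D, u z * η (dil y s z)) +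
        s * ∫ z in D, u z * fderiv ℝ η (dil y s z) (z - y) := by
    have e2 : ∀ k, ∫ z in D, u z * (η (dil y s z) + s * (fderiv ℝ η (dil y s z)
      (EuclideanSpace.single k 1) * (z k - y k))) = (∫ z in D, u z * η (dil y s z)) +
        s * ∫ z in D, u z * (fderiv ℝ η (dil y s z)
      (EuclideanSpace.single k 1) * (z k - y k)) := fun k => by
      rw [← integral_const_mul]
      refine Eq.trans ?_ (integral_add (integrable_smul_of_memLp hu.memLp hηL)
        ((integrable_smul_of_memLp hu.memLp (hd' k)).const_mul s))
      refine integral_congr_ae (.of_forall fun z => ?_)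
      simp only
      ring
    simp only [e2, Finset.sum_add_distrib, Finset.sum_const, Finset.card_univ, Fintype.card_fin,
      nsmul_eq_mul, ← Finset.mul_sum]
    congr 2
    refine (integral_finsetSum _ fun k _ => (integrable_smul_of_memLp hu.memLp (hd' k))).symm.trans ?_
    refine integral_congr_ae (.of_forall fun z => ?_)
    simp only [smul_eq_mul]
    rw [← Finset.mul_sum, ← sum1 z, map_sum]
    simp [mul_comm]
  have e3 : ∑ k, -∫ z in D, inner ℝ (g z) (ζ k z • EuclideanSpace.single k (1 : ℝ)) =
      -∫ z in D, inner ℝ (g z) (η (dil y s z) • (z - y)) := by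
    rw [Finset.sum_neg_distrib, ← integral_finsetSum]
    · congr 1
      refine integral_congr_ae (.of_forall fun z => ?_)
      simp only
      rw [← inner_sum, ← sum1 z, Finset.smul_sum]
      simp [ζ, smul_smul]
    · intro k _
      have : MemLp (fun z => ζ k z • (EuclideanSpace.single k (1 : ℝ) :
          EuclideanSpace ℝ (Fin d))) 2 (volume.restrict D) :=
        Continuous.memLp_of_hasCompactSupport ((aζ k).continuous.smul continuous_const)
          (bζ k).smul_right
      exact integrable_inner hu.memLp_grad this
  rw [← e1, ← e3]
  exact Finset.sum_congr rfl fun k _ => key k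

/-- After a change of variables, with `s ^ d` as Jacobian, the differentiated quantity pairs `η`
with the contracted function `u ∘ dil y s⁻¹`. Differentiation under the integral gives exactly the
divergence in `IsGrad.integral_div_dil`, which turns it into a pairing with `g`. -/
theorem IsGrad.hasDerivAt_dil {D : Set (EuclideanSpace ℝ (Fin d))}
    {u : EuclideanSpace ℝ (Fin d) → ℝ}
    {g : EuclideanSpace ℝ (Fin d) → EuclideanSpace ℝ (Fin d)} (hu : IsGrad D u g)
    [IsFiniteMeasure (volume.restrict D)] (hD : MeasurableSet D)
    {y : EuclideanSpace ℝ (Fin d)} (hst : StarConvex ℝ y D)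
    {R : ℝ} (hR : ∀ z ∈ D, ‖z - y‖ ≤ R)
    {η : EuclideanSpace ℝ (Fin d) → ℝ} (a : ContDiff ℝ ∞ η) (b : HasCompactSupport η)
    (c : tsupport η ⊆ D) {s : ℝ} (hs : 1 ≤ s) :
    HasDerivAt (fun s => s ^ d * ∫ z in D, u z * η (dil y s z))
      (-(s ^ d * s⁻¹ * ∫ z in D, inner ℝ (g z) (η (dil y s z) • (z - y)))) s := by
  have hs0 : s ≠ 0 := by positivity
  have hui : Integrable u (volume.restrict D) := hu.memLp.integrable (by norm_num)
  obtain ⟨B, hB⟩ := b.exists_bound_of_continuous a.continuous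
  obtain ⟨B', hB'⟩ := (b.fderiv ℝ).exists_bound_of_continuous (a.continuous_fderiv (by simp))
  have hB0 : 0 ≤ B' := (norm_nonneg _).trans (hB' 0)
  have cont : ∀ t, Continuous (dil y t) := fun t => (contDiff_dil y t).continuous
  have main := (hasDerivAt_integral_of_dominated_loc_of_deriv_le (μ := volume.restrict D)
    (F := fun s z => u z * η (dil y s z)) (x₀ := s) (s := univ) Filter.univ_mem
    (F' := fun s z => u z * fderiv ℝ η (dil y s z) (z - y)) (bound := fun z => |u z| * (B' * R))
    (.of_forall fun t => hu.memLp.1.mul (a.continuous.comp (cont t)).aestronglyMeasurable)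
    (hui.mul_bdd (c := B) (a.continuous.comp (cont s)).aestronglyMeasurable
      (.of_forall fun z => hB _))
    (hu.memLp.1.mul (((a.continuous_fderiv (by simp)).comp (cont s)).clm_apply
      (continuous_id.sub continuous_const)).aestronglyMeasurable)
    (by
      filter_upwards [ae_restrict_mem hD] with z hz t _
      rw [norm_mul]
      refine mul_le_mul_of_nonneg_left ?_ (abs_nonneg _)
      exact (ContinuousLinearMap.le_opNorm _ _).trans
        (mul_le_mul (hB' _) (hR z hz) (norm_nonneg _) hB0))
    (hui.abs.mul_const _)
    (.of_forall fun z t _ => by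
      refine HasDerivAt.const_mul (u z) ?_
      have h1 : HasDerivAt (fun t => dil y t z) (z - y) t := by
        unfold dil
        simpa using ((hasDerivAt_id t).smul_const (z - y)).const_add y
      exact ((a.differentiable (by simp) (dil y t z)).hasFDerivAt).comp_hasDerivAt t h1)).2
  have h2 := (hasDerivAt_pow d s).mul main
  refine h2.congr_deriv ?_
  have h3 := hu.integral_div_dil hst a b c hs
  have h4 : (∫ z in D, inner ℝ (g z) (η (dil y s z) • (z - y))) =
    -((d * ∫ z in D, u z * η (dil y s z)) +
        s * ∫ z in D, u z * fderiv ℝ η (dil y s z) (z - y)) := by rw [h3, neg_neg]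
  rw [h4]
  -- The derivative of `s ^ d` carries the truncated exponent `d - 1`, so `d = 0` is separate.
  rcases d with _ | n
  · simp only [pow_zero]; field_simp; simp
  · simp only [Nat.add_sub_cancel]
    field_simp
    ring

/-- Mean value inequality on `[1, s]`: contracting `u` by the factor `s⁻¹` changes it, in duality
with `η`, by `O(s - 1)` times the norm of its gradient. -/
theorem IsGrad.abs_dil_sub_le {D : Set (EuclideanSpace ℝ (Fin d))}
    {u : EuclideanSpace ℝ (Fin d) → ℝ}
    {g : EuclideanSpace ℝ (Fin d) → EuclideanSpace ℝ (Fin d)} (hu : IsGrad D u g)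
    [IsFiniteMeasure (volume.restrict D)] (hD : MeasurableSet D)
    {y : EuclideanSpace ℝ (Fin d)} (hst : StarConvex ℝ y D)
    {R : ℝ} (hR0 : 0 ≤ R) (hR : ∀ z ∈ D, ‖z - y‖ ≤ R)
    {η : EuclideanSpace ℝ (Fin d) → ℝ} (a : ContDiff ℝ ∞ η) (b : HasCompactSupport η)
    (c : tsupport η ⊆ D) {s : ℝ} (hs : 1 ≤ s) (hs2 : s ≤ 2) :
    |s ^ d * (∫ z in D, u z * η (dil y s z)) - ∫ z in D, u z * η z| ≤
      2 ^ d * (√(nsq (volume.restrict D) g) * (R * √(nsq volume η))) * (s - 1) := by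
  have h := norm_image_sub_le_of_norm_deriv_le_segment'
    (f := fun s => s ^ d * ∫ z in D, u z * η (dil y s z)) (a := 1) (b := s)
    (C := 2 ^ d * (√(nsq (volume.restrict D) g) * (R * √(nsq volume η))))
    (fun t ht => (hu.hasDerivAt_dil hD hst hR a b c ht.1).hasDerivWithinAt) ?_ s ⟨hs, le_rfl⟩
  · simpa [dil_one] using h
  · intro t ht
    have ht0 : 0 < t := lt_of_lt_of_le one_pos ht.1
    have b' := hasCompactSupport_comp_dil b y ht0.ne'
    have a' : ContDiff ℝ ∞ (fun z => η (dil y t z)) := a.comp (contDiff_dil y t)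
    have hη' := memLp_test a' b' D
    rw [norm_neg, norm_mul]
    refine mul_le_mul ?_ ?_ (norm_nonneg _) (by positivity)
    · rw [Real.norm_of_nonneg (by positivity)]
      calc t ^ d * t⁻¹ ≤ t ^ d * 1 := by
            gcongr; exact inv_le_one_of_one_le₀ ht.1
        _ ≤ 2 ^ d := by
            rw [mul_one]; gcongr; exact ht.2.le.trans hs2
    · have h1 := norm_integral_le_of_norm_mul_norm (μ := volume.restrict D)
        (f := g) (g := R • fun z => η (dil y t z))
        (q := fun z => inner ℝ (g z) (η (dil y t z) • (z - y))) hu.memLp_grad (hη'.const_smul R)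
        (by
          filter_upwards [ae_restrict_mem hD] with z hz
          refine (norm_inner_le_norm _ _).trans (mul_le_mul_of_nonneg_left ?_ (norm_nonneg _))
          simp only [norm_smul, Pi.smul_apply, Real.norm_of_nonneg hR0]
          rw [mul_comm]
          exact mul_le_mul_of_nonneg_right (hR z hz) (norm_nonneg _))
      refine h1.trans (mul_le_mul_of_nonneg_left ?_ (Real.sqrt_nonneg _))
      rw [nsq_smul, Real.sqrt_mul (sq_nonneg R), Real.sqrt_sq hR0]
      refine mul_le_mul_of_nonneg_left (Real.sqrt_le_sqrt ?_) hR0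
      refine le_trans ?_ (nsq_comp_dil_le y ht.1)
      have h5 := nsq_restrict_le (f := fun z => η (dil y t z)) (D := D) (D' := univ)
        (subset_univ _) (memLp_test a' b' univ)
      simpa using h5

end CEM
end

open MeasureTheory Set
open scoped ContDiff
noncomputable section
namespace CEM

variable {d : ℕ}

/-! ### Averaged contractions -/

/-- The kernel of the operator that averages the contractions `x ↦ s⁻¹ x + (1 - s⁻¹) y` over `y`
with the density `ρ`. -/
def avgKernel (ρ : EuclideanSpace ℝ (Fin d) → ℝ) (s : ℝ) (x z : EuclideanSpace ℝ (Fin d)) : ℝ :=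
  ((1 - s⁻¹) ^ d)⁻¹ * ρ ((1 - s⁻¹)⁻¹ • (z - s⁻¹ • x))

/-- Substitute `x = s z + (1 - s) y`, which is `dil y s z`. So the transpose of the averaging
operator is an average over `y` of dilated test functions, and the averaged operator inherits the
bounds for single contractions. -/
theorem integral_avgKernel (ρ η : EuclideanSpace ℝ (Fin d) → ℝ) {s : ℝ} (hs : 1 < s)
    (z : EuclideanSpace ℝ (Fin d)) :
    ∫ x, η x * avgKernel ρ s x z = s ^ d * ∫ y, ρ y * η (dil y s z) := by
  have hs0 : 0 < s := by linarith
  have hb : 0 < 1 - s⁻¹ := by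
    have := inv_lt_one_of_one_lt₀ hs; linarith
  set G : EuclideanSpace ℝ (Fin d) → ℝ := fun x => η x * avgKernel ρ s x z with hG
  have h1 := Measure.integral_comp_smul volume (fun w => G (s • z + w)) (1 - s)
  rw [integral_add_left_eq_self (fun w => G w) (s • z)] at h1
  have h2 : ∀ y, G (s • z + (1 - s) • y) = ((1 - s⁻¹) ^ d)⁻¹ * (ρ y * η (dil y s z)) := by
    intro y
    have e1 : s • z + (1 - s) • y = dil y s z := by
      simp only [dil, smul_sub, sub_smul, one_smul]; abel
    have e2 : (1 - s⁻¹)⁻¹ • (z - s⁻¹ • (s • z + (1 - s) • y)) = y := by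
      rw [smul_add, smul_smul, smul_smul, inv_mul_cancel₀ hs0.ne', one_smul,
        show z - (z + (s⁻¹ * (1 - s)) • y) = (1 - s⁻¹) • y by
          rw [mul_sub, inv_mul_cancel₀ hs0.ne', mul_one, sub_smul, sub_smul, one_smul]; abel,
        smul_smul, inv_mul_cancel₀ hb.ne', one_smul]
    simp only [hG, avgKernel]
    rw [e2, e1]; ring
  simp only [h2, finrank_euclideanSpace, Fintype.card_fin, smul_eq_mul] at h1
  rw [integral_const_mul] at h1
  have h3 : |((1 - s) ^ d)⁻¹| = (s ^ d)⁻¹ * ((1 - s⁻¹) ^ d)⁻¹ := by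
    rw [abs_inv, abs_pow, abs_sub_comm, abs_of_pos (by linarith), ← mul_inv, ← mul_pow]
    congr 3
    field_simp
  rw [h3] at h1
  have h4 : (0 : ℝ) < (1 - s⁻¹) ^ d := by positivity
  have h5 : (0 : ℝ) < s ^ d := by positivity
  generalize (1 - s⁻¹) ^ d = q at h1 h4
  field_simp at h1
  linarith

theorem continuous_avgKernel {ρ : EuclideanSpace ℝ (Fin d) → ℝ} (hρ : Continuous ρ) (s : ℝ) :
    Continuous (fun p : EuclideanSpace ℝ (Fin d) × EuclideanSpace ℝ (Fin d) =>
      avgKernel ρ s p.1 p.2) := by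
  unfold avgKernel
  exact continuous_const.mul (hρ.comp (by fun_prop))

theorem abs_avgKernel_le {ρ : EuclideanSpace ℝ (Fin d) → ℝ} {B : ℝ} (hB : ∀ x, ‖ρ x‖ ≤ B) (s : ℝ)
    (x z : EuclideanSpace ℝ (Fin d)) : |avgKernel ρ s x z| ≤ |((1 - s⁻¹) ^ d)⁻¹| * B := by
  rw [avgKernel, abs_mul]
  exact mul_le_mul_of_nonneg_left (hB _) (abs_nonneg _)

theorem abs_avgKernel_sub_le {ρ : EuclideanSpace ℝ (Fin d) → ℝ} {L : NNReal}
    (hL : LipschitzWith L ρ) (s : ℝ) (x x' z : EuclideanSpace ℝ (Fin d)) :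
    |avgKernel ρ s x z - avgKernel ρ s x' z| ≤
      |((1 - s⁻¹) ^ d)⁻¹| * (L * (|(1 - s⁻¹)⁻¹| * |s⁻¹|)) * dist x x' := by
  rw [avgKernel, avgKernel, ← mul_sub, abs_mul, mul_assoc]
  refine mul_le_mul_of_nonneg_left ?_ (abs_nonneg _)
  have := hL.dist_le_mul ((1 - s⁻¹)⁻¹ • (z - s⁻¹ • x)) ((1 - s⁻¹)⁻¹ • (z - s⁻¹ • x'))
  rw [Real.dist_eq, dist_smul₀, dist_sub_left, dist_smul₀] at this
  simp only [Real.norm_eq_abs] at this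
  linarith

theorem integral_mul_avg {D : Set (EuclideanSpace ℝ (Fin d))}
    [IsFiniteMeasure (volume.restrict D)] {u : EuclideanSpace ℝ (Fin d) → ℝ}
    (hu : MemLp u 2 (volume.restrict D))
    {ρ : EuclideanSpace ℝ (Fin d) → ℝ} (hρ : Continuous ρ) (hρc : HasCompactSupport ρ)
    {η : EuclideanSpace ℝ (Fin d) → ℝ} (a : ContDiff ℝ ∞ η) (b : HasCompactSupport η)
    (c : tsupport η ⊆ D) {s : ℝ} (hs : 1 < s) :
    ∫ x in D, η x * ∫ z in D, u z * avgKernel ρ s x z =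
      ∫ y, ρ y * (s ^ d * ∫ z in D, u z * η (dil y s z)) := by
  have hui : Integrable u (volume.restrict D) := hu.integrable (by norm_num)
  have hηi : Integrable η (volume.restrict D) := (memLp_test a b D).integrable (by norm_num)
  have hρi : Integrable ρ volume := hρ.integrable_of_hasCompactSupport hρc
  obtain ⟨B, hB⟩ := hρc.exists_bound_of_continuous hρ
  obtain ⟨A, hA⟩ := b.exists_bound_of_continuous a.continuous
  have i1 : Integrable (fun p : EuclideanSpace ℝ (Fin d) × EuclideanSpace ℝ (Fin d) =>
      η p.1 * (u p.2 * avgKernel ρ s p.1 p.2))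
      ((volume.restrict D).prod (volume.restrict D)) := by
    have := (hηi.mul_prod hui).mul_bdd (c := |((1 - s⁻¹) ^ d)⁻¹| * B)
      (continuous_avgKernel hρ s).aestronglyMeasurable
      (.of_forall fun p => abs_avgKernel_le hB s p.1 p.2)
    simpa only [mul_assoc] using this
  have i2 : Integrable (fun p : EuclideanSpace ℝ (Fin d) × EuclideanSpace ℝ (Fin d) =>
      u p.1 * (ρ p.2 * η (dil p.2 s p.1))) ((volume.restrict D).prod volume) := by
    have := (hui.mul_prod hρi).mul_bdd (c := A) (g := fun p => η (dil p.2 s p.1))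
      (a.continuous.comp (by unfold dil; fun_prop)).aestronglyMeasurable
      (.of_forall fun p => hA _)
    simpa only [mul_assoc] using this
  calc _ = ∫ x in D, ∫ z in D, η x * (u z * avgKernel ρ s x z) := by
        simp only [integral_const_mul]
    _ = ∫ z in D, ∫ x in D, η x * (u z * avgKernel ρ s x z) := integral_integral_swap i1
    _ = ∫ z in D, s ^ d * ∫ y, u z * (ρ y * η (dil y s z)) := by
        refine integral_congr_ae (.of_forall fun z => ?_)
        simp only
        rw [setIntegral_eq_integral_of_forall_compl_eq_zero fun x hx => by
          rw [image_eq_zero_of_notMem_tsupport fun h => hx (c h), zero_mul]]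
        simp only [mul_left_comm (η _)]
        rw [integral_const_mul, integral_const_mul, integral_avgKernel ρ η hs z]
        ring
    _ = s ^ d * ∫ y, ∫ z in D, u z * (ρ y * η (dil y s z)) := by
        rw [integral_const_mul, integral_integral_swap i2]
    _ = _ := by
        rw [← integral_const_mul]
        refine integral_congr_ae (.of_forall fun y => ?_)
        simp only [mul_left_comm (u _)]
        rw [integral_const_mul]; ring

theorem continuous_avg {D : Set (EuclideanSpace ℝ (Fin d))}
    {u : EuclideanSpace ℝ (Fin d) → ℝ} (hui : Integrable u (volume.restrict D))
    {ρ : EuclideanSpace ℝ (Fin d) → ℝ} (hρ : Continuous ρ) (hρc : HasCompactSupport ρ) (s : ℝ) :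
    Continuous (fun x => ∫ z in D, u z * avgKernel ρ s x z) := by
  obtain ⟨B, hB⟩ := hρc.exists_bound_of_continuous hρ
  refine continuous_of_dominated (bound := fun z => |u z| * (|((1 - s⁻¹) ^ d)⁻¹| * B))
    (fun x => ?_) (fun x => .of_forall fun z => ?_) (hui.abs.mul_const _)
    (.of_forall fun z => ?_)
  · exact hui.1.mul ((continuous_avgKernel hρ s).comp
      (Continuous.prodMk_right x)).aestronglyMeasurable
  · rw [norm_mul]
    exact mul_le_mul_of_nonneg_left (abs_avgKernel_le hB s x z) (abs_nonneg _)
  · exact continuous_const.mul ((continuous_avgKernel hρ s).comp (Continuous.prodMk_left z))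

/-- Averaged contractions of a star-shaped set are close to the identity on `H1`. -/
theorem IsGrad.abs_avg_sub_le {D : Set (EuclideanSpace ℝ (Fin d))} (hD : IsOpen D)
    [IsFiniteMeasure (volume.restrict D)]
    {R : ℝ} (hR0 : 0 ≤ R) (hR : ∀ y ∈ D, ∀ z ∈ D, ‖z - y‖ ≤ R) {c : EuclideanSpace ℝ (Fin d)}
    (φ : ContDiffBump c) (hφD : Metric.ball c φ.rOut ⊆ D)
    (hst : ∀ y ∈ Metric.ball c φ.rOut, StarConvex ℝ y D)
    {u : EuclideanSpace ℝ (Fin d) → ℝ}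
    {g : EuclideanSpace ℝ (Fin d) → EuclideanSpace ℝ (Fin d)} (hu : IsGrad D u g)
    {η : EuclideanSpace ℝ (Fin d) → ℝ} (a : ContDiff ℝ ∞ η) (b : HasCompactSupport η)
    (hη : tsupport η ⊆ D) {s : ℝ} (hs : 1 < s) (hs2 : s ≤ 2) :
    |∫ x in D, η x * ((∫ z in D, u z * avgKernel (φ.normed volume) s x z) - u x)| ≤
      2 ^ d * (√(nsq (volume.restrict D) g) * (R * √(nsq volume η))) * (s - 1) := by
  have hρ : Continuous (φ.normed volume) := φ.continuous_normed
  have hρc : HasCompactSupport (φ.normed volume) := φ.hasCompactSupport_normed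
  have hui : Integrable u (volume.restrict D) := hu.memLp.integrable (by norm_num)
  have hηL := memLp_test a b D
  obtain ⟨A, hA⟩ := b.exists_bound_of_continuous a.continuous
  obtain ⟨B, hB⟩ := hρc.exists_bound_of_continuous hρ
  set C := 2 ^ d * (√(nsq (volume.restrict D) g) * (R * √(nsq volume η))) * (s - 1)
  have i0 : Integrable (fun x => η x * ∫ z in D, u z * avgKernel (φ.normed volume) s x z)
      (volume.restrict D) :=
    ((a.continuous.mul (continuous_avg hui hρ hρc s)).integrable_of_hasCompactSupport
      b.mul_right).integrableOn
  -- As the density has integral `1`, the error of the averaged operator is the average over `y` of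
  -- the errors of single contractions.
  have e0 : ∫ x in D, η x * ((∫ z in D, u z * avgKernel (φ.normed volume) s x z) - u x) =
      ∫ y, φ.normed volume y * ((s ^ d * ∫ z in D, u z * η (dil y s z)) -
        ∫ z in D, u z * η z) := by
    simp only [mul_sub]
    rw [integral_sub i0 (integrable_mul_of_memLp hηL hu.memLp),
      integral_mul_avg hu.memLp hρ hρc a b hη hs, integral_sub,
      integral_mul_const, φ.integral_normed, one_mul]
    · congr 1
      exact integral_congr_ae (.of_forall fun x => mul_comm _ _)
    · refine Continuous.integrable_of_hasCompactSupport (hρ.mul (continuous_const.mul ?_))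
        hρc.mul_right
      refine continuous_of_dominated (bound := fun z => |u z| * A)
        (fun x => hui.1.mul (a.continuous.comp (contDiff_dil x s).continuous).aestronglyMeasurable)
        (fun x => .of_forall fun z => ?_) (hui.abs.mul_const _) (.of_forall fun z => ?_)
      · rw [norm_mul]
        exact mul_le_mul_of_nonneg_left (hA _) (abs_nonneg _)
      · exact continuous_const.mul (a.continuous.comp (by unfold dil; fun_prop))
    · exact φ.integrable_normed.mul_const _
  rw [e0, ← Real.norm_eq_abs]
  refine (norm_integral_le_of_norm_le (g := fun y => φ.normed volume y * C)
    (φ.integrable_normed.mul_const C) (.of_forall fun y => ?_)).trans ?_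
  · rw [norm_mul, Real.norm_of_nonneg (φ.nonneg_normed y)]
    by_cases hy : y ∈ Metric.ball c φ.rOut
    · exact mul_le_mul_of_nonneg_left (hu.abs_dil_sub_le hD.measurableSet (hst y hy) hR0
        (hR y (hφD hy)) a b hη hs.le hs2) (φ.nonneg_normed y)
    · rw [← φ.support_normed_eq (μ := volume), Function.notMem_support] at hy
      simp [hy]
  · rw [integral_mul_const, φ.integral_normed, one_mul]

/-! ### Duality with test functions -/

/-- Test functions are dense in `L²(D)`, since by the fundamental lemma their orthogonal complement
is trivial. So the bound extends to all of `L²(D)` by continuity, and `f` may be tested with itself.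
-/
theorem sqrt_nsq_le_of_test {D : Set (EuclideanSpace ℝ (Fin d))} (hD : IsOpen D)
    {f : EuclideanSpace ℝ (Fin d) → ℝ} (hf : MemLp f 2 (volume.restrict D)) {K : ℝ} (hK : 0 ≤ K)
    (H : ∀ η : EuclideanSpace ℝ (Fin d) → ℝ, ContDiff ℝ ∞ η → HasCompactSupport η →
      tsupport η ⊆ D → |∫ x in D, η x * f x| ≤ K * √(nsq (volume.restrict D) η)) :
    √(nsq (volume.restrict D) f) ≤ K := by
  set S : Set (Lp ℝ 2 (volume.restrict D)) := {w | ∃ η : EuclideanSpace ℝ (Fin d) → ℝ,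
    ContDiff ℝ ∞ η ∧ HasCompactSupport η ∧ tsupport η ⊆ D ∧ w =ᵐ[volume.restrict D] η}
  let W : Submodule ℝ (Lp ℝ 2 (volume.restrict D)) :=
    { carrier := S
      add_mem' := by
        rintro _ _ ⟨η, a, b, c, e⟩ ⟨η', a', b', c', e'⟩
        refine ⟨η + η', a.add a', b.add b', (tsupport_add η η').trans (union_subset c c'), ?_⟩
        exact (Lp.coeFn_add _ _).trans (e.add e')
      zero_mem' := ⟨0, contDiff_const, HasCompactSupport.zero, by simp, Lp.coeFn_zero _ _ _⟩
      smul_mem' := by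
        rintro t _ ⟨η, a, b, c, e⟩
        refine ⟨t • η, a.const_smul t, b.smul_left (f := fun _ => t),
          (closure_mono (Function.support_const_smul_subset t η)).trans c, ?_⟩
        exact (Lp.coeFn_smul _ _).trans (e.const_smul t) }
  have inner_eq : ∀ v w : Lp ℝ 2 (volume.restrict D), inner ℝ v w = ∫ x in D, v x * w x := by
    intro v w
    rw [L2.inner_def]
    refine integral_congr_ae (.of_forall fun x => ?_)
    simp [mul_comm]
  have hWd : Dense (W : Set (Lp ℝ 2 (volume.restrict D))) := by
    rw [Submodule.dense_iff_topologicalClosure_eq_top, Submodule.topologicalClosure_eq_top_iff,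
      Submodule.eq_bot_iff]
    intro w hw
    rw [Submodule.mem_orthogonal] at hw
    have h0 : ∀ᵐ x ∂volume, x ∈ D → w x = 0 := by
      refine IsOpen.ae_eq_zero_of_integral_contDiff_smul_eq_zero hD
        (locallyIntegrableOn_of_locallyIntegrable_restrict
          ((Lp.memLp w).locallyIntegrable (by norm_num))) fun η a b c => ?_
      have h1 := hw ((memLp_test a b D).toLp η) ⟨η, a, b, c, (memLp_test a b D).coeFn_toLp⟩
      rw [inner_eq] at h1
      rw [← setIntegral_eq_integral_of_forall_compl_eq_zero (s := D) fun x hx => by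
        rw [image_eq_zero_of_notMem_tsupport fun h => hx (c h), zero_smul], ← h1]
      refine integral_congr_ae ?_
      filter_upwards [(memLp_test a b D).coeFn_toLp] with x hx
      rw [hx, smul_eq_mul]
    rw [Lp.eq_zero_iff_ae_eq_zero, Filter.EventuallyEq, ae_restrict_iff' hD.measurableSet]
    exact h0
  have key : ∀ w : Lp ℝ 2 (volume.restrict D), inner ℝ w (hf.toLp f) ≤ K * ‖w‖ := by
    intro w
    have hcl : IsClosed {w : Lp ℝ 2 (volume.restrict D) | inner ℝ w (hf.toLp f) ≤ K * ‖w‖} :=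
      isClosed_le (by fun_prop) (by fun_prop)
    refine hWd.induction (P := fun w => inner ℝ w (hf.toLp f) ≤ K * ‖w‖) ?_ hcl w
    rintro w ⟨η, a, b, c, e⟩
    have e' : w = (memLp_test a b D).toLp η :=
      Lp.ext (e.trans (memLp_test a b D).coeFn_toLp.symm)
    have h2 : √(nsq (volume.restrict D) η) = ‖w‖ := by
      rw [nsq_eq_norm_toLp_sq (memLp_test a b D), ← e', Real.sqrt_sq (norm_nonneg _)]
    rw [← h2, inner_eq]
    refine le_trans (le_of_eq ?_) ((le_abs_self _).trans (H η a b c))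
    refine integral_congr_ae ?_
    filter_upwards [e, hf.coeFn_toLp] with x h3 h4
    rw [h3, h4]
  have h5 := key (hf.toLp f)
  rw [real_inner_self_eq_norm_sq] at h5
  rw [nsq_eq_norm_toLp_sq hf, Real.sqrt_sq (norm_nonneg _)]
  by_contra hlt
  push Not at hlt
  nlinarith [norm_nonneg (hf.toLp f)]

end CEM
end

open MeasureTheory Set
open scoped ContDiff
noncomputable section
namespace CEM

variable {d : ℕ}

/-! ### Compactness of `H1` in `L²` -/

theorem dist_toLp_eq {α F : Type*} [MeasurableSpace α] {μ : Measure α} [NormedAddCommGroup F]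
    [NormedSpace ℝ F] {f g : α → F} (hf : MemLp f 2 μ) (hg : MemLp g 2 μ) :
    dist (hf.toLp f) (hg.toLp g) = √(nsq μ (f - g)) := by
  rw [dist_eq_norm, ← MemLp.toLp_sub, nsq_eq_norm_toLp_sq (hf.sub hg),
    Real.sqrt_sq (norm_nonneg _)]

theorem sqrt_nsq_le_of_bound {α F : Type*} [MeasurableSpace α] {μ : Measure α}
    [IsFiniteMeasure μ] [NormedAddCommGroup F] {f : α → F} {c : ℝ} (hc : 0 ≤ c)
    (h : ∀ᵐ x ∂μ, ‖f x‖ ≤ c) : √(nsq μ f) ≤ c * √(μ.real univ) := by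
  have h1 : nsq μ f ≤ nsq μ (fun _ : α => c) :=
    nsq_le_of_norm_le (memLp_const c) (by
      filter_upwards [h] with x hx
      rwa [Real.norm_of_nonneg hc])
  calc _ ≤ √(nsq μ (fun _ : α => c)) := Real.sqrt_le_sqrt h1
    _ = _ := by
      simp only [nsq, Real.norm_eq_abs, sq_abs, integral_const, smul_eq_mul]
      rw [Real.sqrt_mul (by positivity), Real.sqrt_sq hc, mul_comm]

theorem integral_abs_le {α : Type*} [MeasurableSpace α] {μ : Measure α}
    [IsFiniteMeasure μ] {f : α → ℝ} (hf : MemLp f 2 μ) :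
    ∫ x, |f x| ∂μ ≤ √(nsq μ f) * √(μ.real univ) := by
  have := integral_le_of_norm_mul_norm (μ := μ) (f := f) (g := fun _ => (1 : ℝ))
    (q := fun x => |f x|) hf (memLp_const 1) (.of_forall fun x => by simp)
  simpa [nsq] using this

theorem nsq_volume_eq {D : Set (EuclideanSpace ℝ (Fin d))} {η : EuclideanSpace ℝ (Fin d) → ℝ}
    (c : tsupport η ⊆ D) : nsq volume η = nsq (volume.restrict D) η := by
  refine (setIntegral_eq_integral_of_forall_compl_eq_zero fun x hx => ?_).symm
  rw [image_eq_zero_of_notMem_tsupport fun h => hx (c h)]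
  simp

theorem IsGrad.sqrt_nsq_avg_sub_le {D : Set (EuclideanSpace ℝ (Fin d))} (hD : IsOpen D)
    [IsFiniteMeasure (volume.restrict D)]
    {R : ℝ} (hR0 : 0 ≤ R) (hR : ∀ y ∈ D, ∀ z ∈ D, ‖z - y‖ ≤ R) {c : EuclideanSpace ℝ (Fin d)}
    (φ : ContDiffBump c) (hφD : Metric.ball c φ.rOut ⊆ D)
    (hst : ∀ y ∈ Metric.ball c φ.rOut, StarConvex ℝ y D)
    {u : EuclideanSpace ℝ (Fin d) → ℝ}
    {g : EuclideanSpace ℝ (Fin d) → EuclideanSpace ℝ (Fin d)} (hu : IsGrad D u g)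
    {s : ℝ} (hs : 1 < s) (hs2 : s ≤ 2)
    (hm : MemLp (fun x => ∫ z in D, u z * avgKernel (φ.normed volume) s x z) 2
      (volume.restrict D)) :
    √(nsq (volume.restrict D)
      ((fun x => ∫ z in D, u z * avgKernel (φ.normed volume) s x z) - u)) ≤
      2 ^ d * (√(nsq (volume.restrict D) g) * R) * (s - 1) := by
  have hs' : 0 ≤ s - 1 := by linarith
  refine sqrt_nsq_le_of_test hD (hm.sub hu.memLp) (by positivity) fun η a b e => ?_
  refine (hu.abs_avg_sub_le hD hR0 hR φ hφD hst a b e hs hs2).trans (le_of_eq ?_)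
  rw [nsq_volume_eq e]; ring

/-- The averaged contraction `M` is close to the identity on an `H1`-ball when `s` is close to `1`.
For fixed `s` it is an integral operator with a bounded Lipschitz kernel, so it maps the ball to
uniformly bounded, equi-Lipschitz functions. Such a function is determined up to a small error by
its rounded values on a finite net of `D`. -/
theorem totallyBounded_of_starShaped {D : Set (EuclideanSpace ℝ (Fin d))} (hD : IsOpen D)
    (hb : Bornology.IsBounded D) (hst : StarShapedBall D) (C : ℝ) :
    TotallyBounded {w : Lp ℝ 2 (volume.restrict D) | ∃ g, IsGrad D w g ∧
      nsq (volume.restrict D) w ≤ C ∧ nsq (volume.restrict D) g ≤ C} := by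
  have hfin : IsFiniteMeasure (volume.restrict D) := ⟨by simpa using hb.measure_lt_top⟩
  obtain ⟨c, r, hr, hrD, hstar⟩ := hst
  obtain ⟨R, hR⟩ := Metric.isBounded_iff.1 hb
  have hR' : ∀ y ∈ D, ∀ z ∈ D, ‖z - y‖ ≤ |R| := fun y hy z hz => by
    rw [← dist_eq_norm]; exact (hR hz hy).trans (le_abs_self R)
  let φ : ContDiffBump c := ⟨r / 2, r, by positivity, half_lt_self hr⟩
  set ρ := φ.normed volume
  have hρ : Continuous ρ := φ.continuous_normed
  have hρc : HasCompactSupport ρ := φ.hasCompactSupport_normed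
  obtain ⟨Lρ, hLρ⟩ := (φ.contDiff_normed (μ := volume) (n := 1)).lipschitzWith_of_hasCompactSupport
    hρc (by simp)
  obtain ⟨B, hB⟩ := hρc.exists_bound_of_continuous hρ
  have hB0 : 0 ≤ B := (norm_nonneg _).trans (hB 0)
  refine Metric.totallyBounded_of_finite_discretization fun ε hε => ?_
  set A := √C
  set Vol := √((volume.restrict D).real univ)
  -- Chosen so that `M` moves every function of the ball by at most `ε / 8`.
  set s : ℝ := 1 + min 1 (ε / (8 * (2 ^ d * (A * |R|) + 1))) with hs_def
  have hmin : 0 < min 1 (ε / (8 * (2 ^ d * (A * |R|) + 1))) := lt_min one_pos (by positivity)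
  have hs : 1 < s := by linarith
  have hs2 : s ≤ 2 := by
    have := min_le_left 1 (ε / (8 * (2 ^ d * (A * |R|) + 1)))
    linarith
  have hK : 2 ^ d * (A * |R|) * (s - 1) ≤ ε / 8 := by
    have h1 := min_le_right 1 (ε / (8 * (2 ^ d * (A * |R|) + 1)))
    have h2 : s - 1 ≤ ε / (8 * (2 ^ d * (A * |R|) + 1)) := by linarith
    calc _ ≤ 2 ^ d * (A * |R|) * (ε / (8 * (2 ^ d * (A * |R|) + 1))) := by gcongr
      _ = ε / 8 * (2 ^ d * (A * |R|) / (2 ^ d * (A * |R|) + 1)) := by field_simp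
      _ ≤ ε / 8 * 1 := by
          gcongr
          rw [div_le_one (by positivity)]; linarith
      _ = _ := mul_one _
  set Bk := |((1 - s⁻¹) ^ d)⁻¹| * B
  set Lk := |((1 - s⁻¹) ^ d)⁻¹| * (Lρ * (|(1 - s⁻¹)⁻¹| * |s⁻¹|))
  have hLk : 0 ≤ Lk := by positivity
  have hBk : 0 ≤ Bk := by positivity
  set I := A * Vol
  have hI : 0 ≤ I := by positivity
  -- Used both as mesh size in `D` and as rounding error of the values. Comparing two functions
  -- costs each of these errors twice, and in `L²(D)` the total must stay below `ε / 4`.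
  set ε1 := ε / (4 * (2 * Lk * I + 2) * (Vol + 1))
  have hVol : 0 ≤ Vol := Real.sqrt_nonneg _
  have hε1 : 0 < ε1 := by positivity
  have he : (2 * (Lk * ε1 * I) + 2 * ε1) * Vol ≤ ε / 4 := by
    have : (2 * (Lk * ε1 * I) + 2 * ε1) * Vol = ε / 4 * (Vol / (Vol + 1)) := by
      simp only [ε1]; field_simp
    rw [this]
    have h2 : Vol / (Vol + 1) ≤ 1 := by rw [div_le_one (by positivity)]; linarith
    nlinarith
  obtain ⟨t, htf, ht⟩ := Metric.totallyBounded_iff.1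
    (hb.isCompact_closure.totallyBounded.subset subset_closure) ε1 hε1
  have := htf.fintype
  obtain ⟨T, hTf, hT⟩ := Metric.totallyBounded_iff.1
    (isCompact_closedBall (0 : t → ℝ) (Bk * I)).totallyBounded ε1 hε1
  have := hTf.fintype
  set M : Lp ℝ 2 (volume.restrict D) → EuclideanSpace ℝ (Fin d) → ℝ := fun w x =>
    ∫ z in D, w z * avgKernel ρ s x z
  set S := {w : Lp ℝ 2 (volume.restrict D) | ∃ g, IsGrad D w g ∧
      nsq (volume.restrict D) w ≤ C ∧ nsq (volume.restrict D) g ≤ C}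
  have hL1 : ∀ w : S, ∫ z in D, |(w : Lp ℝ 2 (volume.restrict D)) z| ≤ I := by
    rintro ⟨w, g, hw, h1, h2⟩
    exact (integral_abs_le hw.memLp).trans
      (mul_le_mul_of_nonneg_right (Real.sqrt_le_sqrt h1) hVol)
  have hint : ∀ w : S, Integrable (w : Lp ℝ 2 (volume.restrict D)) (volume.restrict D) := by
    rintro ⟨w, g, hw, h1, h2⟩
    exact hw.memLp.integrable (by norm_num)
  have hkm : ∀ x, AEStronglyMeasurable (fun z => avgKernel ρ s x z) (volume.restrict D) :=
    fun x => ((continuous_avgKernel hρ s).comp (Continuous.prodMk_right x)).aestronglyMeasurable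
  have hMb : ∀ (w : S) x, |M w x| ≤ Bk * I := by
    intro w x
    rw [← Real.norm_eq_abs]
    refine (norm_integral_le_of_norm_le ((hint w).abs.const_mul Bk) (.of_forall fun z => ?_)).trans
      ?_
    · rw [norm_mul, mul_comm]
      exact mul_le_mul_of_nonneg_right (abs_avgKernel_le hB s x z) (abs_nonneg _)
    · rw [integral_const_mul]
      exact mul_le_mul_of_nonneg_left (hL1 w) hBk
  have hMl : ∀ (w : S) x x', dist x x' < ε1 → |M w x - M w x'| ≤ Lk * ε1 * I := by
    intro w x x' hxx
    simp only [M]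
    have i : ∀ x, Integrable (fun z => (w : Lp ℝ 2 (volume.restrict D)) z * avgKernel ρ s x z)
        (volume.restrict D) := fun x =>
      (hint w).mul_bdd (hkm x) (.of_forall fun z => abs_avgKernel_le hB s x z)
    rw [← integral_sub (i x) (i x'), ← Real.norm_eq_abs]
    refine (norm_integral_le_of_norm_le ((hint w).abs.const_mul (Lk * ε1))
      (.of_forall fun z => ?_)).trans ?_
    · rw [← mul_sub, norm_mul, mul_comm]
      refine mul_le_mul_of_nonneg_right ?_ (abs_nonneg _)
      exact (abs_avgKernel_sub_le hLρ s x x' z).trans (mul_le_mul_of_nonneg_left hxx.le hLk)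
    · rw [integral_const_mul]
      exact mul_le_mul_of_nonneg_left (hL1 w) (by positivity)
  -- The centre `q` of a finite net of the cube is the finite code of `w`: its averaged values on
  -- the net `t`, rounded.
  have hcen : ∀ w : S, ∃ q : T, dist (fun x : t => M w x) q < ε1 := by
    intro w
    have h1 : (fun x : t => M w x) ∈ Metric.closedBall (0 : t → ℝ) (Bk * I) := by
      rw [mem_closedBall_zero_iff, pi_norm_le_iff_of_nonneg (by positivity)]
      exact fun x => hMb w x
    have h2 := hT h1
    simp only [mem_iUnion] at h2
    obtain ⟨q, hq, h3⟩ := h2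
    exact ⟨⟨q, hq⟩, h3⟩
  choose F hF using hcen
  refine ⟨T, inferInstance, F, fun w w' hww => ?_⟩
  have hMm : ∀ w : S, MemLp (M w) 2 (volume.restrict D) := fun w =>
    MemLp.of_bound (continuous_avg (hint w) hρ hρc s).aestronglyMeasurable (Bk * I)
      (.of_forall fun x => hMb w x)
  have hclose : ∀ w : S, dist ((hMm w).toLp (M w)) (w : Lp ℝ 2 (volume.restrict D)) ≤ ε / 8 := by
    rintro ⟨w, g, hw, h1, h2⟩
    have h3 := dist_toLp_eq (hMm ⟨w, g, hw, h1, h2⟩) hw.memLp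
    rw [Lp.toLp_coeFn] at h3
    rw [h3]
    refine (hw.sqrt_nsq_avg_sub_le hD (abs_nonneg R) hR' φ hrD hstar hs hs2
      (hMm ⟨w, g, hw, h1, h2⟩)).trans (le_trans ?_ hK)
    have hs' : 0 ≤ s - 1 := by linarith
    have : √(nsq (volume.restrict D) g) ≤ A := Real.sqrt_le_sqrt h2
    gcongr
  -- For equal codes, the averaged functions are compared at a nearby net point, through the common
  -- centre.
  have hfar : dist ((hMm w).toLp (M w)) ((hMm w').toLp (M w')) ≤ ε / 4 := by
    rw [dist_toLp_eq]
    refine le_trans (sqrt_nsq_le_of_bound (c := 2 * (Lk * ε1 * I) + 2 * ε1) (by positivity) ?_) he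
    filter_upwards [ae_restrict_mem hD.measurableSet] with x hx
    have h1 := ht hx
    simp only [mem_iUnion] at h1
    obtain ⟨q, hq, h2⟩ := h1
    have h3 := hMl w x q h2
    have h4 := hMl w' x q h2
    have h5 := (dist_le_pi_dist _ _ (⟨q, hq⟩ : t)).trans_lt (hF w)
    have h6 := (dist_le_pi_dist _ _ (⟨q, hq⟩ : t)).trans_lt (hF w')
    rw [hww] at h5
    simp only [Real.dist_eq] at h5 h6
    rw [Pi.sub_apply, Real.norm_eq_abs, abs_le]
    rw [abs_le] at h3 h4
    rw [abs_lt] at h5 h6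
    constructor <;> linarith
  have h1 := hclose w
  have h2 := hclose w'
  rw [dist_comm] at h1
  have h3 := dist_triangle4 (w : Lp ℝ 2 (volume.restrict D)) ((hMm w).toLp (M w))
    ((hMm w').toLp (M w')) w'
  linarith

/-- Bounded sequences of `H1 D` have subsequences that are Cauchy in `L²(D)`. -/
def SeqCompactH1 (D : Set (EuclideanSpace ℝ (Fin d))) : Prop :=
  ∀ (u : ℕ → EuclideanSpace ℝ (Fin d) → ℝ) (C : ℝ),
    (∀ n, ∃ g, IsGrad D (u n) g ∧ nsq (volume.restrict D) (u n) ≤ C ∧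
      nsq (volume.restrict D) g ≤ C) →
    ∃ φ : ℕ → ℕ, StrictMono φ ∧ ∀ ε > 0, ∃ N, ∀ m ≥ N, ∀ n ≥ N,
      nsq (volume.restrict D) (u (φ m) - u (φ n)) < ε

theorem seqCompactH1_of_starShaped {D : Set (EuclideanSpace ℝ (Fin d))} (hD : IsOpen D)
    (hb : Bornology.IsBounded D) (hst : StarShapedBall D) : SeqCompactH1 D := by
  intro u C hu
  choose g hg h1 h2 using hu
  have hc := (totallyBounded_of_starShaped hD hb hst C).closure
  have hc' : IsCompact (closure {w : Lp ℝ 2 (volume.restrict D) | ∃ g, IsGrad D w g ∧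
      nsq (volume.restrict D) w ≤ C ∧ nsq (volume.restrict D) g ≤ C}) :=
    hc.isCompact_of_isClosed isClosed_closure
  obtain ⟨w, -, φ, hφ, hlim⟩ := hc'.tendsto_subseq (x := fun n => (hg n).memLp.toLp (u n))
    (fun n => subset_closure ⟨g n, (hg n).congr (hg n).memLp.coeFn_toLp.symm .rfl, by
      rw [nsq_congr (hg n).memLp.coeFn_toLp]; exact h1 n, h2 n⟩)
  refine ⟨φ, hφ, fun ε hε => ?_⟩
  obtain ⟨N, hN⟩ := Metric.cauchySeq_iff.1 hlim.cauchySeq (√ε) (Real.sqrt_pos.2 hε)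
  refine ⟨N, fun m hm n hn => ?_⟩
  have h3 := hN m hm n hn
  simp only [Function.comp_apply] at h3
  rw [dist_toLp_eq] at h3
  exact (Real.sqrt_lt_sqrt_iff (nsq_nonneg _)).1 h3

/-- Subsequences are extracted successively for the finitely many pieces. No gluing of functions is
needed, because only the `L²` norm over the union has to be controlled by those over the pieces. -/
theorem seqCompactH1_of_finiteUnion {K : Set (EuclideanSpace ℝ (Fin d))}
    (hb : Bornology.IsBounded K) (hK : IsFiniteUnionOfStarShaped K) : SeqCompactH1 K := by
  obtain ⟨n, D, hD, hnull⟩ := hK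
  intro u C hu
  choose g hg h1 h2 using hu
  have hsub : ∀ k (φ : ℕ → ℕ), ∃ ψ : ℕ → ℕ, StrictMono ψ ∧ ∀ ε > 0, ∃ N, ∀ m ≥ N, ∀ p ≥ N,
      nsq (volume.restrict (D k)) (u (φ (ψ m)) - u (φ (ψ p))) < ε := fun k φ =>
    seqCompactH1_of_starShaped (hD k).1 (hb.subset (hD k).2.1) (hD k).2.2 (fun n => u (φ n)) C
      fun n => ⟨g (φ n), (hg _).mono (hD k).2.1,
        (nsq_restrict_le (hD k).2.1 (hg _).memLp).trans (h1 _),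
        (nsq_restrict_le (hD k).2.1 (hg _).memLp_grad).trans (h2 _)⟩
  have hall : ∀ s : Finset (Fin n), ∃ φ : ℕ → ℕ, StrictMono φ ∧ ∀ k ∈ s, ∀ ε > 0, ∃ N, ∀ m ≥ N,
      ∀ p ≥ N, nsq (volume.restrict (D k)) (u (φ m) - u (φ p)) < ε := by
    intro s
    induction s using Finset.induction_on with
    | empty => exact ⟨id, strictMono_id, by simp⟩
    | insert k s _ ih =>
      obtain ⟨φ, hφ, h3⟩ := ih
      obtain ⟨ψ, hψ, h4⟩ := hsub k φ
      refine ⟨φ ∘ ψ, hφ.comp hψ, fun j hj ε hε => ?_⟩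
      rcases Finset.mem_insert.1 hj with rfl | hj
      · exact h4 ε hε
      · obtain ⟨N, hN⟩ := h3 j hj ε hε
        exact ⟨N, fun m hm p hp => hN _ (hm.trans (hψ.id_le m)) _ (hp.trans (hψ.id_le p))⟩
  obtain ⟨φ, hφ, h3⟩ := hall Finset.univ
  refine ⟨φ, hφ, fun ε hε => ?_⟩
  have h4 : ∀ k, ∃ N, ∀ m ≥ N, ∀ p ≥ N,
      nsq (volume.restrict (D k)) (u (φ m) - u (φ p)) < ε / (n + 1) := fun k =>
    h3 k (Finset.mem_univ k) _ (by positivity)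
  choose N hN using h4
  refine ⟨Finset.univ.sup N, fun m hm p hp => ?_⟩
  have hmem : MemLp (u (φ m) - u (φ p)) 2 (volume.restrict K) := (hg _).memLp.sub (hg _).memLp
  -- The pieces may overlap, hence only an inequality.
  have h5 : nsq (volume.restrict K) (u (φ m) - u (φ p)) ≤
      ∑ k, nsq (volume.restrict (D k)) (u (φ m) - u (φ p)) := by
    have e1 : volume.restrict K = volume.restrict (⋃ k, D k) :=
      Measure.restrict_congr_set (Filter.EventuallyLE.antisymm
        (ae_le_set.2 hnull) (iUnion_subset fun k => (hD k).2.1).eventuallyLE)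
    have e2 : volume.restrict (⋃ k, D k) ≤ Measure.sum fun k => volume.restrict (D k) :=
      Measure.restrict_iUnion_le
    have i : Integrable (fun x => ‖(u (φ m) - u (φ p)) x‖ ^ 2)
        (Measure.sum fun k => volume.restrict (D k)) := by
      rw [Measure.sum_fintype, integrable_finsetSum_measure]
      exact fun k _ => integrable_norm_sq (hmem.mono_measure (Measure.restrict_mono_set _ (hD k).2.1))
    rw [e1]
    refine (integral_mono_measure e2 (.of_forall fun x => by positivity) i).trans (le_of_eq ?_)
    rw [Measure.sum_fintype] at i ⊢
    rw [integral_finsetSum_measure fun k _ => (integrable_finsetSum_measure.1 i) k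
      (Finset.mem_univ k)]
    rfl
  calc _ ≤ _ := h5
    _ ≤ ∑ k : Fin n, ε / (n + 1) := Finset.sum_le_sum fun k _ =>
        (hN k m ((Finset.le_sup (Finset.mem_univ k)).trans hm) p
          ((Finset.le_sup (Finset.mem_univ k)).trans hp)).le
    _ = ε * (n / (n + 1)) := by simp; ring
    _ < ε * 1 := by
        gcongr
        rw [div_lt_one (by positivity)]; linarith
    _ = ε := mul_one _

end CEM
end

/-! ### Rayleigh quotients and the spectral inequality -/

open MeasureTheory Set
open scoped ContDiff
noncomputable section
namespace CEM

/-! ### An abstract spectral inequality -/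

section Forms

open Filter Topology

variable {X : Type*} [AddCommGroup X] [Module ℝ X]

/-- The first order condition at a minimum: for small `t` of sign opposite to `p`, the linear term
wins. The denominator `|r| + 1` makes `t` small enough. -/
theorem eq_zero_of_quadratic_nonneg {p r : ℝ} (h : ∀ t : ℝ, 0 ≤ 2 * t * p + t ^ 2 * r) : p = 0 := by
  by_contra hp
  have h1 := h (-p / (|r| + 1))
  have hr : 0 < |r| + 1 := by positivity
  have e : 2 * (-p / (|r| + 1)) * p + (-p / (|r| + 1)) ^ 2 * r =
      p ^ 2 / (|r| + 1) * (r / (|r| + 1) - 2) := by field_simp; ring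
  rw [e] at h1
  have h2 : r / (|r| + 1) ≤ 1 := by
    rw [div_le_one hr]; linarith [le_abs_self r]
  have h3 : 0 < p ^ 2 / (|r| + 1) := by positivity
  nlinarith

/-- A symmetric positive semidefinite bilinear form. -/
structure IsPSD (b : LinearMap.BilinForm ℝ X) : Prop where
  symm : ∀ x y, b x y = b y x
  nonneg : ∀ x, 0 ≤ b x x

variable {a s m b : LinearMap.BilinForm ℝ X}

theorem IsPSD.sq_le (hb : IsPSD b) (x y : X) : b x y ^ 2 ≤ b x x * b y y := by
  have := LinearMap.BilinForm.apply_mul_apply_le_of_forall_zero_le b hb.nonneg x y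
  rwa [hb.symm y x, ← sq] at this

theorem IsPSD.abs_le (hb : IsPSD b) (x y : X) : |b x y| ≤ √(b x x) * √(b y y) := by
  rw [← Real.sqrt_mul (hb.nonneg x)]
  exact Real.abs_le_sqrt (hb.sq_le x y)

theorem IsPSD.eq_zero (hb : IsPSD b) {x : X} (hx : b x x = 0) (y : X) : b x y = 0 := by
  have := hb.sq_le x y
  rw [hx, zero_mul] at this
  exact pow_eq_zero_iff (two_ne_zero) |>.1 (le_antisymm this (sq_nonneg _))

theorem IsPSD.add_self (hb : IsPSD b) (x y : X) :
    b (x + y) (x + y) = b x x + 2 * b x y + b y y := by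
  simp only [map_add, LinearMap.add_apply, hb.symm y x]; ring

theorem IsPSD.sub_self (hb : IsPSD b) (x y : X) :
    b (x - y) (x - y) = b x x - 2 * b x y + b y y := by
  simp only [map_sub, LinearMap.sub_apply, hb.symm y x]; ring

theorem IsPSD.tendsto_left (hb : IsPSD b) {u : ℕ → X} {x : X}
    (h : Tendsto (fun n => b (u n - x) (u n - x)) atTop (𝓝 0)) (y : X) :
    Tendsto (fun n => b (u n) y) atTop (𝓝 (b x y)) := by
  rw [tendsto_iff_norm_sub_tendsto_zero]
  have h1 : Tendsto (fun n => √(b (u n - x) (u n - x)) * √(b y y)) atTop (𝓝 0) := by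
    simpa using (h.sqrt).mul_const (√(b y y))
  refine squeeze_zero (fun _ => norm_nonneg _) (fun n => ?_) h1
  have e : b (u n - x) y = b (u n) y - b x y := by rw [map_sub, LinearMap.sub_apply]
  rw [Real.norm_eq_abs, ← e]
  exact hb.abs_le (u n - x) y

theorem IsPSD.tendsto_self (hb : IsPSD b) {u : ℕ → X} {x : X}
    (h : Tendsto (fun n => b (u n - x) (u n - x)) atTop (𝓝 0)) :
    Tendsto (fun n => b (u n) (u n)) atTop (𝓝 (b x x)) := by
  have h1 := hb.tendsto_left h x
  have h2 := (h.add (h1.const_mul 2)).sub_const (b x x)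
  have e : 0 + 2 * b x x - b x x = b x x := by ring
  rw [e] at h2
  refine h2.congr fun n => ?_
  rw [hb.sub_self]; ring

/-- Bounded sequences for `m + a` have `m`-Cauchy subsequences, and `m + a` is complete. -/
structure IsCompactPair (m a : LinearMap.BilinForm ℝ X) : Prop where
  psd : IsPSD m
  psd' : IsPSD a
  compact : ∀ (u : ℕ → X) (C : ℝ), (∀ n, m (u n) (u n) ≤ C ∧ a (u n) (u n) ≤ C) →
    ∃ φ : ℕ → ℕ, StrictMono φ ∧ ∀ ε > 0, ∃ N, ∀ p ≥ N, ∀ q ≥ N,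
      m (u (φ p) - u (φ q)) (u (φ p) - u (φ q)) < ε
  complete : ∀ u : ℕ → X, (∀ ε > 0, ∃ N, ∀ p ≥ N, ∀ q ≥ N,
      m (u p - u q) (u p - u q) < ε ∧ a (u p - u q) (u p - u q) < ε) →
    ∃ x, Tendsto (fun n => m (u n - x) (u n - x)) atTop (𝓝 0) ∧
      Tendsto (fun n => a (u n - x) (u n - x)) atTop (𝓝 0)

theorem tendsto_of_le_mul (hs : IsPSD s) {C : ℝ} (h : ∀ x, s x x ≤ C * m x x) {u : ℕ → X} {x : X}
    (hu : Tendsto (fun n => m (u n - x) (u n - x)) atTop (𝓝 0)) :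
    Tendsto (fun n => s (u n - x) (u n - x)) atTop (𝓝 0) :=
  squeeze_zero (fun _ => hs.nonneg _) (fun _ => h _) (by simpa using hu.const_mul C)

/-- A Poincaré inequality by compactness. A counterexample sequence with `m = 1` and `a + s → 0`
would converge along a subsequence to an element with `a = s = 0` but `m = 1`, against `hker`. -/
theorem IsCompactPair.coercive (hma : IsCompactPair m a) (hs : IsPSD s) {C : ℝ}
    (hC : ∀ x, s x x ≤ C * m x x) (hker : ∀ x, a x x = 0 → s x x = 0 → m x x = 0) :
    ∃ C', 0 ≤ C' ∧ ∀ x, m x x ≤ C' * (a x x + s x x) := by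
  by_contra hcon
  push Not at hcon
  have h1 : ∀ n : ℕ, ∃ x, m x x = 1 ∧ a x x + s x x ≤ 1 / ((n : ℝ) + 1) := by
    intro n
    obtain ⟨x, hx⟩ := hcon (n + 1) (by positivity)
    have h0 : 0 ≤ a x x + s x x := add_nonneg (hma.psd'.nonneg x) (hs.nonneg x)
    have hm : 0 < m x x := lt_of_le_of_lt (by positivity) hx
    refine ⟨(√(m x x))⁻¹ • x, ?_, ?_⟩
    · simp only [map_smul, LinearMap.smul_apply, smul_eq_mul]
      rw [← mul_assoc, ← mul_inv, Real.mul_self_sqrt hm.le, inv_mul_cancel₀ hm.ne']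
    · simp only [map_smul, LinearMap.smul_apply, smul_eq_mul]
      rw [← mul_assoc, ← mul_assoc, ← mul_inv, Real.mul_self_sqrt hm.le, ← mul_add,
        inv_mul_le_iff₀ hm, mul_one_div, le_div_iff₀ (by positivity)]
      linarith
  choose u hu hu' using h1
  have ha : ∀ n, a (u n) (u n) ≤ 1 / ((n : ℝ) + 1) := fun n => by
    linarith [hu' n, hs.nonneg (u n)]
  have hs' : ∀ n, s (u n) (u n) ≤ 1 / ((n : ℝ) + 1) := fun n => by
    linarith [hu' n, hma.psd'.nonneg (u n)]
  have hle1 : ∀ n : ℕ, 1 / ((n : ℝ) + 1) ≤ 1 := fun n => by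
    rw [div_le_one (by positivity)]; linarith [(Nat.cast_nonneg n : (0 : ℝ) ≤ n)]
  obtain ⟨φ, hφ, hcau⟩ := hma.compact u 1 fun n => ⟨(hu n).le, (ha n).trans (hle1 n)⟩
  have lim0 : Tendsto (fun n => 1 / (((φ n : ℕ) : ℝ) + 1)) atTop (𝓝 0) :=
    tendsto_one_div_add_atTop_nhds_zero_nat.comp hφ.tendsto_atTop
  obtain ⟨x, hx1, hx2⟩ := hma.complete (fun n => u (φ n)) (by
    intro ε hε
    obtain ⟨N, hN⟩ := hcau ε hε
    obtain ⟨N', hN'⟩ := eventually_atTop.1 ((tendsto_order.1 lim0).2 (ε / 4) (by positivity))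
    refine ⟨max N N', fun p hp q hq => ⟨hN p (le_of_max_le_left hp) q (le_of_max_le_left hq), ?_⟩⟩
    -- Parallelogram law: `a(p - q) ≤ 2 a(p) + 2 a(q)`, so energies tending to `0` make the sequence
    -- Cauchy for `a`.
    have e1 := hma.psd'.nonneg (u (φ p) + u (φ q))
    have e2 := hN' p (le_of_max_le_right hp)
    have e3 := hN' q (le_of_max_le_right hq)
    have e4 := ha (φ p)
    have e5 := ha (φ q)
    rw [hma.psd'.add_self] at e1
    rw [hma.psd'.sub_self]
    linarith)
  have l1 := tendsto_nhds_unique (hma.psd.tendsto_self hx1)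
    (tendsto_const_nhds.congr fun n => (hu (φ n)).symm)
  have l2 : a x x = 0 := tendsto_nhds_unique (hma.psd'.tendsto_self hx2)
    (squeeze_zero (fun _ => hma.psd'.nonneg _) (fun n => ha (φ n)) lim0)
  have l3 : s x x = 0 := tendsto_nhds_unique (hs.tendsto_self (tendsto_of_le_mul hs hC hx1))
    (squeeze_zero (fun _ => hs.nonneg _) (fun n => hs' (φ n)) lim0)
  have := hker x l2 l3
  linarith

/-- The direct method for the Rayleigh quotient on the closed subspace `W`. Coercivity bounds a
minimizing sequence, compactness makes it `m`-Cauchy, and minimality makes it `a`-Cauchy. The last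
clause is the Euler equation, so far only against `W`. -/
theorem IsCompactPair.exists_min (hma : IsCompactPair m a) (hs : IsPSD s) {C : ℝ}
    (hC : ∀ x, s x x ≤ C * m x x) (hker : ∀ x, a x x = 0 → s x x = 0 → m x x = 0)
    (W : Submodule ℝ X)
    (hW : ∀ (u : ℕ → X) (x : X), (∀ n, u n ∈ W) →
      Tendsto (fun n => m (u n - x) (u n - x)) atTop (𝓝 0) → x ∈ W)
    {x₀ : X} (hx₀ : x₀ ∈ W) (hx₀s : 0 < s x₀ x₀) :
    ∃ w ∈ W, s w w = 1 ∧ (∀ v ∈ W, a w w * s v v ≤ a v v) ∧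
      ∀ v ∈ W, a w v = a w w * s w v := by
  obtain ⟨C', hC', hcoer⟩ := hma.coercive hs hC hker
  have scale : ∀ v ∈ W, 0 < s v v → (√(s v v))⁻¹ • v ∈ W ∧
      s ((√(s v v))⁻¹ • v) ((√(s v v))⁻¹ • v) = 1 ∧
      a ((√(s v v))⁻¹ • v) ((√(s v v))⁻¹ • v) = (s v v)⁻¹ * a v v := by
    intro v hv hsv
    refine ⟨W.smul_mem _ hv, ?_, ?_⟩
    · simp only [map_smul, LinearMap.smul_apply, smul_eq_mul]
      rw [← mul_assoc, ← mul_inv, Real.mul_self_sqrt hsv.le, inv_mul_cancel₀ hsv.ne']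
    · simp only [map_smul, LinearMap.smul_apply, smul_eq_mul]
      rw [← mul_assoc, ← mul_inv, Real.mul_self_sqrt hsv.le]
  set T : Set ℝ := {t | ∃ v ∈ W, s v v = 1 ∧ t = a v v} with hT
  have hTne : T.Nonempty := ⟨_, _, (scale x₀ hx₀ hx₀s).1, (scale x₀ hx₀ hx₀s).2.1, rfl⟩
  have hTb : BddBelow T := ⟨0, by rintro _ ⟨v, -, -, rfl⟩; exact hma.psd'.nonneg v⟩
  set μ := sInf T with hμ
  have hμ0 : 0 ≤ μ := le_csInf hTne (by rintro _ ⟨v, -, -, rfl⟩; exact hma.psd'.nonneg v)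
  have hmin : ∀ v ∈ W, μ * s v v ≤ a v v := by
    intro v hv
    rcases (hs.nonneg v).eq_or_lt with h0 | h0
    · rw [← h0, mul_zero]; exact hma.psd'.nonneg v
    · obtain ⟨e1, e2, e3⟩ := scale v hv h0
      have := csInf_le hTb ⟨_, e1, e2, rfl⟩
      rw [e3, ← hμ, inv_mul_eq_div, le_div_iff₀ h0] at this
      exact this
  have h1 : ∀ n : ℕ, ∃ v ∈ W, s v v = 1 ∧ a v v < μ + 1 / ((n : ℝ) + 1) := by
    intro n
    obtain ⟨_, ⟨v, e1, e2, rfl⟩, e3⟩ := exists_lt_of_csInf_lt hTne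
      (show sInf T < μ + 1 / ((n : ℝ) + 1) by
        have : 0 < 1 / ((n : ℝ) + 1) := by positivity
        linarith)
    exact ⟨v, e1, e2, e3⟩
  choose u huW hus hua using h1
  have hle1 : ∀ n : ℕ, 1 / ((n : ℝ) + 1) ≤ 1 := fun n => by
    rw [div_le_one (by positivity)]; linarith [(Nat.cast_nonneg n : (0 : ℝ) ≤ n)]
  obtain ⟨φ, hφ, hcau⟩ := hma.compact u ((C' + 1) * (μ + 3)) fun n => by
    have e1 := hcoer (u n)
    have e2 := hua n
    have e3 := hle1 n
    rw [hus n] at e1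
    constructor
    · calc _ ≤ _ := e1
        _ ≤ C' * (μ + 3) := mul_le_mul_of_nonneg_left (by linarith) hC'
        _ ≤ _ := by nlinarith
    · nlinarith
  have lim0 : Tendsto (fun n => 1 / (((φ n : ℕ) : ℝ) + 1)) atTop (𝓝 0) :=
    tendsto_one_div_add_atTop_nhds_zero_nat.comp hφ.tendsto_atTop
  obtain ⟨w, hw1, hw2⟩ := hma.complete (fun n => u (φ n)) (by
    intro ε hε
    -- The second threshold makes `μ s(p - q) ≤ ε / 2`, through `s ≤ C m`.
    obtain ⟨N, hN⟩ := hcau (min ε (ε / (2 * (|C| + 1) * (μ + 1)))) (lt_min hε (by positivity))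
    obtain ⟨N', hN'⟩ := eventually_atTop.1 ((tendsto_order.1 lim0).2 (ε / 8) (by positivity))
    refine ⟨max N N', fun p hp q hq => ?_⟩
    have e0 := hN p (le_of_max_le_left hp) q (le_of_max_le_left hq)
    refine ⟨e0.trans_le (min_le_left _ _), ?_⟩
    -- As `s(p + q) = 4 - s(p - q)`, the lower bound `a(p + q) ≥ μ s(p + q)` and the parallelogram
    -- identity give `a(p - q) < 4 (ε / 8) + μ s(p - q)`.
    have e1 := hmin _ (W.add_mem (huW (φ p)) (huW (φ q)))
    have e2 := hN' p (le_of_max_le_right hp)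
    have e3 := hN' q (le_of_max_le_right hq)
    have e4 := hua (φ p)
    have e5 := hua (φ q)
    have e6 : μ * s (u (φ p) - u (φ q)) (u (φ p) - u (φ q)) ≤ ε / 2 := by
      have e8 := hC (u (φ p) - u (φ q))
      have e9 := e0.trans_le (min_le_right _ _)
      have e10 := hma.psd.nonneg (u (φ p) - u (φ q))
      calc _ ≤ μ * (|C| * m (u (φ p) - u (φ q)) (u (φ p) - u (φ q))) := by
            gcongr
            exact e8.trans (mul_le_mul_of_nonneg_right (le_abs_self C) e10)
        _ ≤ (μ + 1) * ((|C| + 1) * (ε / (2 * (|C| + 1) * (μ + 1)))) := by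
            gcongr <;> linarith
        _ = ε / 2 := by field_simp
    have e7 := hs.add_self (u (φ p)) (u (φ q))
    rw [hs.sub_self] at e6
    rw [hma.psd'.add_self, e7] at e1
    rw [hma.psd'.sub_self]
    rw [hus, hus] at e1 e6
    nlinarith)
  have hwW : w ∈ W := hW _ w (fun n => huW (φ n)) hw1
  have l1 : s w w = 1 := tendsto_nhds_unique (hs.tendsto_self (tendsto_of_le_mul hs hC hw1))
    (tendsto_const_nhds.congr fun n => (hus (φ n)).symm)
  have l2 : a w w = μ := by
    refine le_antisymm ?_ ?_
    · refine le_of_tendsto_of_tendsto (hma.psd'.tendsto_self hw2)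
        (by simpa using lim0.const_add μ) (.of_forall fun n => (hua (φ n)).le)
    · have := hmin w hwW
      rwa [l1, mul_one] at this
  refine ⟨w, hwW, l1, fun v hv => by rw [l2]; exact hmin v hv, fun v hv => ?_⟩
  rw [← sub_eq_zero]
  refine eq_zero_of_quadratic_nonneg (r := a v v - μ * s v v) fun t => ?_
  have e1 := hmin _ (W.add_mem hwW (W.smul_mem t hv))
  rw [hma.psd'.add_self, hs.add_self] at e1
  simp only [map_smul, LinearMap.smul_apply, smul_eq_mul, l1] at e1
  rw [l2] at e1 ⊢
  nlinarith

/-- The spectral inequality behind the auxiliary space. -/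
theorem IsCompactPair.spectral_le (hma : IsCompactPair m a) (hs : IsPSD s) {C : ℝ}
    (hC : ∀ x, s x x ≤ C * m x x) {φ : ℕ → X} {lam : ℕ → ℝ}
    (hφ : ∀ n v, a (φ n) v = lam n * s (φ n) v)
    (hort : ∀ i j, s (φ i) (φ j) = if i = j then 1 else 0) (hmono : Monotone lam)
    (hall : ∀ (μ : ℝ) (w : X), (∀ v, a w v = μ * s w v) → ∃ c : ℕ →₀ ℝ,
      (∀ n ∈ c.support, lam n = μ) ∧
      m (w - ∑ n ∈ c.support, c n • φ n) (w - ∑ n ∈ c.support, c n • φ n) = 0)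
    {l : ℕ} (hl : 0 < lam l) (u : X) :
    s u u ≤ ∑ n ∈ Finset.range l, s u (φ n) ^ 2 + (lam l)⁻¹ * a u u := by
  have hlam : ∀ n, 0 ≤ lam n := fun n => by
    have h1 := hφ n (φ n)
    rw [hort, if_pos rfl, mul_one] at h1
    rw [← h1]; exact hma.psd'.nonneg _
  -- An element with `a = s = 0` is an eigenvector for every `μ`. For `μ = -1` no listed eigenvalue
  -- matches, since all are nonnegative, so the combination is empty and `m x x = 0`. This covers
  -- weights that vanish somewhere.
  have hker : ∀ x, a x x = 0 → s x x = 0 → m x x = 0 := by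
    intro x hx hx'
    obtain ⟨c, hc, h1⟩ := hall (-1) x fun v => by
      rw [hma.psd'.eq_zero hx, hs.eq_zero hx', mul_zero]
    have h2 : c.support = ∅ := Finset.eq_empty_of_forall_notMem fun n hn => by
      have := hc n hn
      linarith [hlam n]
    simpa [h2] using h1
  let W : Submodule ℝ X :=
    { carrier := {x | ∀ n < l, s x (φ n) = 0}
      add_mem' := fun hx hy n hn => by simp [hx n hn, hy n hn]
      zero_mem' := fun n _ => by simp
      smul_mem' := fun t x hx n hn => by simp [hx n hn] }
  let Q : X → X := fun v => ∑ n ∈ Finset.range l, s v (φ n) • φ n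
  have hQ : ∀ v, ∀ k < l, s (Q v) (φ k) = s v (φ k) := by
    intro v k hk
    simp only [Q, map_sum, LinearMap.sum_apply, map_smul, LinearMap.smul_apply, hort, smul_eq_mul]
    simp [hk]
  have hWQ : ∀ v, v - Q v ∈ W := fun v k hk => by
    rw [map_sub, LinearMap.sub_apply, hQ v k hk, sub_self]
  have hsW : ∀ x ∈ W, ∀ v, s x (Q v) = 0 := fun x hx v => by
    simp only [Q, map_sum, map_smul, smul_eq_mul]
    exact Finset.sum_eq_zero fun n hn => by rw [hx n (Finset.mem_range.1 hn), mul_zero]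
  have haW : ∀ x ∈ W, ∀ v, a x (Q v) = 0 := fun x hx v => by
    simp only [Q, map_sum, map_smul, smul_eq_mul]
    exact Finset.sum_eq_zero fun n hn => by
      rw [hma.psd'.symm, hφ, hs.symm _ x, hx n (Finset.mem_range.1 hn), mul_zero, mul_zero]
  have hcl : ∀ (u : ℕ → X) (x : X), (∀ n, u n ∈ W) →
      Tendsto (fun n => m (u n - x) (u n - x)) atTop (𝓝 0) → x ∈ W := by
    intro v x hv hx k hk
    refine tendsto_nhds_unique (hs.tendsto_left (tendsto_of_le_mul hs hC hx) (φ k)) ?_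
    exact tendsto_const_nhds.congr fun n => (hv n k hk).symm
  set ρ := u - Q u with hρ
  have hρW : ρ ∈ W := hWQ u
  -- Otherwise the minimizer on `W` is an eigenvector with eigenvalue below `lam l`. It is then a
  -- combination of the first `l` eigenvectors, to which it is `s`-orthogonal, contradicting `s w w
  -- = 1`.
  have key : lam l * s ρ ρ ≤ a ρ ρ := by
    by_contra hlt
    push Not at hlt
    have hsρ : 0 < s ρ ρ := by
      by_contra h0
      have h1 : s ρ ρ = 0 := le_antisymm (not_lt.1 h0) (hs.nonneg ρ)
      rw [h1, mul_zero] at hlt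
      exact absurd (hma.psd'.nonneg ρ) (not_le.2 hlt)
    obtain ⟨w, hwW, hw1, hw2, hw3⟩ := hma.exists_min hs hC hker W hcl hρW hsρ
    have hμ : a w w < lam l := by
      have := (hw2 ρ hρW).trans_lt hlt
      exact lt_of_mul_lt_mul_right this hsρ.le
    -- The Euler equation extends from `W` to the whole space because `W` is orthogonal to the range
    -- of `Q` for both `s` and `a`.
    have hweig : ∀ v, a w v = a w w * s w v := by
      intro v
      have e : v = (v - Q v) + Q v := by abel
      have e1 := hw3 _ (hWQ v)
      rw [e, map_add, map_add, haW w hwW, hsW w hwW, add_zero, add_zero, e1]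
    obtain ⟨c, hc, h1⟩ := hall _ w hweig
    have h2 : s w (∑ n ∈ c.support, c n • φ n) = 0 := by
      simp only [map_sum, map_smul, smul_eq_mul]
      refine Finset.sum_eq_zero fun n hn => ?_
      have h3 : n < l := by
        by_contra h4
        have h5 := hmono (not_lt.1 h4)
        rw [hc n hn] at h5
        linarith
      rw [hwW n h3, mul_zero]
    have h3 : s (w - ∑ n ∈ c.support, c n • φ n) (w - ∑ n ∈ c.support, c n • φ n) = 0 :=
      le_antisymm ((hC _).trans (by rw [h1, mul_zero])) (hs.nonneg _)
    have h4 := hs.eq_zero h3 w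
    rw [map_sub, LinearMap.sub_apply, hw1, hs.symm, h2] at h4
    norm_num at h4
  have hu : u = ρ + Q u := by simp [hρ]
  -- Pythagoras for `s`, and below for `a`.
  have e1 : s u u = s ρ ρ + s (Q u) (Q u) := by
    conv_lhs => rw [hu]
    rw [hs.add_self, hsW ρ hρW]; ring
  have e2 : a u u = a ρ ρ + a (Q u) (Q u) := by
    conv_lhs => rw [hu]
    rw [hma.psd'.add_self, haW ρ hρW]; ring
  have e3 : s (Q u) (Q u) = ∑ n ∈ Finset.range l, s u (φ n) ^ 2 := by
    conv_lhs => rw [show s (Q u) (Q u) = s (Q u) (∑ n ∈ Finset.range l, s u (φ n) • φ n) from rfl]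
    simp only [map_sum, map_smul, smul_eq_mul]
    refine Finset.sum_congr rfl fun n hn => ?_
    rw [hQ u n (Finset.mem_range.1 hn)]; ring
  have e4 : s ρ ρ ≤ (lam l)⁻¹ * a ρ ρ := by
    rw [inv_mul_eq_div, le_div_iff₀ hl]; linarith
  have e5 : (lam l)⁻¹ * a ρ ρ ≤ (lam l)⁻¹ * a u u := by
    rw [e2]
    have := hma.psd'.nonneg (Q u)
    gcongr; linarith
  rw [e1, e3]; linarith

end Forms

end CEM
end

open MeasureTheory Set
open scoped ContDiff
noncomputable section
namespace CEM

variable {d : ℕ}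

/-! ### The weighted form -/

/-- A bounded nonnegative weight on `D`. -/
structure IsWeight (D : Set (EuclideanSpace ℝ (Fin d))) (κ : EuclideanSpace ℝ (Fin d) → ℝ)
    (C : ℝ) : Prop where
  open_set : IsOpen D
  meas : Measurable κ
  nonneg : ∀ x, 0 ≤ κ x
  bound : ∀ x ∈ D, κ x ≤ C

variable {D D' : Set (EuclideanSpace ℝ (Fin d))} {κ : EuclideanSpace ℝ (Fin d) → ℝ} {C : ℝ}
  {u v w : EuclideanSpace ℝ (Fin d) → ℝ}

theorem IsWeight.mono (h : IsWeight D κ C) (hD : IsOpen D') (hDD : D' ⊆ D) : IsWeight D' κ C :=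
  ⟨hD, h.meas, h.nonneg, fun x hx => h.bound x (hDD hx)⟩

theorem IsWeight.memLp_sqrt_mul (h : IsWeight D κ C) (hu : MemLp u 2 (volume.restrict D)) :
    MemLp (fun x => √(κ x) * u x) 2 (volume.restrict D) :=
  hu.of_le_mul (c := √C) ((h.meas.sqrt.aestronglyMeasurable).mul hu.1) (by
    filter_upwards [ae_restrict_mem h.open_set.measurableSet] with x hx
    rw [norm_mul, Real.norm_of_nonneg (Real.sqrt_nonneg _)]
    exact mul_le_mul_of_nonneg_right (Real.sqrt_le_sqrt (h.bound x hx)) (norm_nonneg _))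

/-- The weighted form is the plain `L²` product of `√κ u` and `√κ v`, which reduces weighted
estimates to Cauchy-Schwarz for `nsq`. -/
theorem IsWeight.sForm_eq (h : IsWeight D κ C) (u v : EuclideanSpace ℝ (Fin d) → ℝ) :
    sForm κ D u v = ∫ x in D, (√(κ x) * u x) * (√(κ x) * v x) := by
  refine integral_congr_ae (.of_forall fun x => ?_)
  simp only
  calc κ x * u x * v x = (√(κ x) * √(κ x)) * u x * v x := by rw [Real.mul_self_sqrt (h.nonneg x)]
    _ = _ := by ring

theorem IsWeight.integrable (h : IsWeight D κ C) (hu : MemLp u 2 (volume.restrict D))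
    (hv : MemLp v 2 (volume.restrict D)) :
    Integrable (fun x => κ x * u x * v x) (volume.restrict D) := by
  refine (integrable_mul_of_memLp (h.memLp_sqrt_mul hu) (h.memLp_sqrt_mul hv)).congr
    (.of_forall fun x => ?_)
  simp only
  calc _ = (√(κ x) * √(κ x)) * u x * v x := by ring
    _ = _ := by rw [Real.mul_self_sqrt (h.nonneg x)]

theorem sForm_comm (κ : EuclideanSpace ℝ (Fin d) → ℝ) (D : Set (EuclideanSpace ℝ (Fin d)))
    (u v : EuclideanSpace ℝ (Fin d) → ℝ) : sForm κ D u v = sForm κ D v u := by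
  simp only [sForm, mul_assoc, mul_comm (u _)]

theorem IsWeight.sForm_add_left (h : IsWeight D κ C) (hu : MemLp u 2 (volume.restrict D))
    (hv : MemLp v 2 (volume.restrict D)) (hw : MemLp w 2 (volume.restrict D)) :
    sForm κ D (u + v) w = sForm κ D u w + sForm κ D v w := by
  unfold sForm
  rw [← integral_add (h.integrable hu hw) (h.integrable hv hw)]
  refine integral_congr_ae (.of_forall fun x => ?_)
  simp only [Pi.add_apply]; ring

theorem sForm_smul_left (κ : EuclideanSpace ℝ (Fin d) → ℝ) (D : Set (EuclideanSpace ℝ (Fin d)))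
    (c : ℝ) (u v : EuclideanSpace ℝ (Fin d) → ℝ) : sForm κ D (c • u) v = c * sForm κ D u v := by
  unfold sForm
  rw [← integral_const_mul]
  refine integral_congr_ae (.of_forall fun x => ?_)
  simp only [Pi.smul_apply, smul_eq_mul]; ring

theorem IsWeight.sForm_add_right (h : IsWeight D κ C) (hu : MemLp u 2 (volume.restrict D))
    (hv : MemLp v 2 (volume.restrict D)) (hw : MemLp w 2 (volume.restrict D)) :
    sForm κ D w (u + v) = sForm κ D w u + sForm κ D w v := by
  rw [sForm_comm, h.sForm_add_left hu hv hw, sForm_comm, sForm_comm κ D v]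

theorem sForm_smul_right (κ : EuclideanSpace ℝ (Fin d) → ℝ) (D : Set (EuclideanSpace ℝ (Fin d)))
    (c : ℝ) (u v : EuclideanSpace ℝ (Fin d) → ℝ) : sForm κ D v (c • u) = c * sForm κ D v u := by
  rw [sForm_comm, sForm_smul_left, sForm_comm]

theorem sForm_congr {u' v' : EuclideanSpace ℝ (Fin d) → ℝ} (hu : u =ᵐ[volume.restrict D] u')
    (hv : v =ᵐ[volume.restrict D] v') : sForm κ D u v = sForm κ D u' v' :=
  integral_congr_ae (by filter_upwards [hu, hv] with x h1 h2; rw [h1, h2])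

theorem IsWeight.sForm_self (h : IsWeight D κ C) (u : EuclideanSpace ℝ (Fin d) → ℝ) :
    sForm κ D u u = nsq (volume.restrict D) (fun x => √(κ x) * u x) := by
  rw [h.sForm_eq]
  simp only [nsq, Real.norm_eq_abs, sq_abs]
  simp only [sq]

theorem IsWeight.sForm_self_nonneg (h : IsWeight D κ C) (u : EuclideanSpace ℝ (Fin d) → ℝ) :
    0 ≤ sForm κ D u u := by rw [h.sForm_self]; exact nsq_nonneg _

theorem sForm_one_self (D : Set (EuclideanSpace ℝ (Fin d))) (u : EuclideanSpace ℝ (Fin d) → ℝ) :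
    sForm (fun _ => 1) D u u = nsq (volume.restrict D) u := by
  simp [sForm, nsq, sq]

theorem isWeight_one (hD : IsOpen D) : IsWeight D (fun _ => 1) 1 :=
  ⟨hD, measurable_const, fun _ => zero_le_one, fun _ _ => le_rfl⟩

theorem IsWeight.sForm_self_le (h : IsWeight D κ C) (hu : MemLp u 2 (volume.restrict D)) :
    sForm κ D u u ≤ C * nsq (volume.restrict D) u := by
  unfold sForm nsq
  rw [← integral_const_mul]
  refine integral_mono_ae (h.integrable hu hu) ((integrable_norm_sq hu).const_mul C) ?_
  filter_upwards [ae_restrict_mem h.open_set.measurableSet] with x hx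
  rw [Real.norm_eq_abs, sq_abs, mul_assoc, ← sq]
  exact mul_le_mul_of_nonneg_right (h.bound x hx) (sq_nonneg _)

/-! ### Bilinear forms on `H1` -/

/-- `H1 D` as a vector space of functions. -/
def H1Space (D : Set (EuclideanSpace ℝ (Fin d))) :
    Submodule ℝ (EuclideanSpace ℝ (Fin d) → ℝ) where
  carrier := H1 D
  add_mem' := add_mem_H1
  zero_mem' := isGrad_zero.mem_H1
  smul_mem' c _ hu := smul_mem_H1 c hu

/-- The energy form on `H1 D`. -/
def aBil (hD : IsOpen D) : LinearMap.BilinForm ℝ (H1Space D) :=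
  LinearMap.mk₂ ℝ (fun u v => aForm D u v)
    (fun u v w => aForm_add_left hD u.2 v.2 w.2) (fun c u v => aForm_smul_left hD c u.2 v.2)
    (fun w u v => aForm_add_right hD u.2 v.2 w.2) (fun c v u => aForm_smul_right hD c u.2 v.2)

/-- The weighted form on `H1 D`. -/
def sBil (h : IsWeight D κ C) : LinearMap.BilinForm ℝ (H1Space D) :=
  LinearMap.mk₂ ℝ (fun u v => sForm κ D u v)
    (fun u v w => h.sForm_add_left u.2.1 v.2.1 w.2.1) (fun c u v => sForm_smul_left κ D c u v)
    (fun w u v => h.sForm_add_right u.2.1 v.2.1 w.2.1) (fun c v u => sForm_smul_right κ D c u v)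

theorem aBil_apply (hD : IsOpen D) (u v : H1Space D) : aBil hD u v = aForm D u v := rfl

theorem sBil_apply (h : IsWeight D κ C) (u v : H1Space D) : sBil h u v = sForm κ D u v := rfl

theorem isPSD_aBil (hD : IsOpen D) : IsPSD (aBil hD) :=
  ⟨fun _ _ => aForm_comm _ _ _, fun _ => aForm_self_nonneg⟩

theorem isPSD_sBil (h : IsWeight D κ C) : IsPSD (sBil h) :=
  ⟨fun _ _ => sForm_comm _ _ _ _, fun u => h.sForm_self_nonneg u⟩

theorem exists_lim_nsq {α F : Type*} [MeasurableSpace α] {μ : Measure α} [NormedAddCommGroup F]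
    [NormedSpace ℝ F] [CompleteSpace F] {f : ℕ → α → F} (hf : ∀ n, MemLp (f n) 2 μ)
    (hc : ∀ ε > 0, ∃ N, ∀ p ≥ N, ∀ q ≥ N, nsq μ (f p - f q) < ε) :
    ∃ g, MemLp g 2 μ ∧ Filter.Tendsto (fun n => nsq μ (f n - g)) Filter.atTop (nhds 0) := by
  have h1 : CauchySeq fun n => (hf n).toLp (f n) := by
    rw [Metric.cauchySeq_iff]
    intro ε hε
    obtain ⟨N, hN⟩ := hc (ε ^ 2) (by positivity)
    refine ⟨N, fun p hp q hq => ?_⟩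
    rw [dist_toLp_eq, Real.sqrt_lt' hε]
    exact hN p hp q hq
  obtain ⟨g, hg⟩ := cauchySeq_tendsto_of_complete h1
  refine ⟨g, Lp.memLp g, ?_⟩
  rw [tendsto_iff_dist_tendsto_zero] at hg
  have h2 := hg.pow 2
  rw [zero_pow two_ne_zero] at h2
  refine h2.congr fun n => ?_
  have := dist_toLp_eq (hf n) (Lp.memLp g)
  rw [Lp.toLp_coeFn] at this
  rw [this, Real.sq_sqrt (nsq_nonneg _)]

theorem aForm_sub_self_eq (hD : IsOpen D) {g h : EuclideanSpace ℝ (Fin d) →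
    EuclideanSpace ℝ (Fin d)} (hu : IsGrad D u g) (hv : IsGrad D v h) :
    aForm D (u - v) (u - v) = nsq (volume.restrict D) (g - h) := by
  rw [(hu.sub hv).aForm_eq hD (hu.sub hv)]
  simp [nsq]

/-- The form `m` is the unweighted one, since `κ` may vanish and control nothing. Completeness
combines that of `L²` with the closedness of the weak gradient (`isGrad_of_approx`). -/
theorem isCompactPair_of_seqCompactH1 (hD : IsOpen D) (hc : SeqCompactH1 D) :
    IsCompactPair (sBil (isWeight_one hD)) (aBil hD) where
  psd := isPSD_sBil _
  psd' := isPSD_aBil hD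
  compact u C hu := by
    obtain ⟨φ, hφ, h⟩ := hc (fun n => u n) C fun n => ⟨_, isGrad_weakGrad (u n).2, by
      rw [← sForm_one_self]; exact (hu n).1, by rw [← aForm_self]; exact (hu n).2⟩
    refine ⟨φ, hφ, fun ε hε => ?_⟩
    obtain ⟨N, hN⟩ := h ε hε
    refine ⟨N, fun p hp q hq => ?_⟩
    rw [sBil_apply, sForm_one_self]
    exact hN p hp q hq
  complete u hu := by
    have hg := fun n => isGrad_weakGrad (u n).2
    obtain ⟨f, hf, h1⟩ := exists_lim_nsq (fun n => (hg n).memLp) fun ε hε => by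
      obtain ⟨N, hN⟩ := hu ε hε
      refine ⟨N, fun p hp q hq => ?_⟩
      rw [← sForm_one_self]
      exact (hN p hp q hq).1
    obtain ⟨k, hk, h2⟩ := exists_lim_nsq (fun n => (hg n).memLp_grad) fun ε hε => by
      obtain ⟨N, hN⟩ := hu ε hε
      refine ⟨N, fun p hp q hq => ?_⟩
      rw [← aForm_sub_self_eq hD (hg p) (hg q)]
      exact (hN p hp q hq).2
    have hfk : IsGrad D f k := isGrad_of_approx hf hk fun ε hε => by
      obtain ⟨n, hn1, hn2⟩ := (((tendsto_order.1 h1).2 ε hε).and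
        ((tendsto_order.1 h2).2 ε hε)).exists
      exact ⟨_, _, hg n, by rw [nsq_sub_comm]; exact hn1, by rw [nsq_sub_comm]; exact hn2⟩
    refine ⟨⟨f, hfk.mem_H1⟩, h1.congr fun n => ?_, h2.congr fun n => ?_⟩
    · rw [sBil_apply, sForm_one_self]; rfl
    · rw [aBil_apply]
      exact (aForm_sub_self_eq hD (hg n) hfk).symm

/-- The spectral inequality of a coarse element. -/
theorem IsEigenSystem.sForm_self_le (h : IsWeight D κ C) (hc : SeqCompactH1 D) {lam : ℕ → ℝ}
    {φ : ℕ → EuclideanSpace ℝ (Fin d) → ℝ} (hφ : IsEigenSystem D κ lam φ) {l : ℕ}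
    (hl : 0 < lam l) (hu : u ∈ H1 D) :
    sForm κ D u u ≤ ∑ n ∈ Finset.range l, sForm κ D u (φ n) ^ 2 + (lam l)⁻¹ * aForm D u u := by
  refine (isCompactPair_of_seqCompactH1 h.open_set hc).spectral_le (isPSD_sBil h) (C := C)
    (fun x => ?_) (φ := fun n => (⟨φ n, (hφ.isEigen n).1⟩ : H1Space D)) (lam := lam)
    (fun n v => (hφ.isEigen n).2 v v.2) hφ.orthonormal hφ.mono (fun μ w hw => ?_) hl ⟨u, hu⟩
  · simp only [sBil_apply, sForm_one_self]
    exact h.sForm_self_le x.2.1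
  · obtain ⟨c, hc1, hc2⟩ := hφ.all μ w ⟨w.2, fun v hv => hw ⟨v, hv⟩⟩
    refine ⟨c, hc1, ?_⟩
    rw [sBil_apply, sForm_one_self]
    refine (nsq_congr (g := fun _ => (0 : ℝ)) ?_).trans (by simp [nsq])
    filter_upwards [hc2] with x hx
    simp [hx, Finset.sum_apply]

end CEM
end

/-! ### Zero boundary values: products, extension by zero, cutoff -/

open MeasureTheory Set
open scoped ContDiff
noncomputable section
namespace CEM

variable {d : ℕ} {D D' Γ Γ' U : Set (EuclideanSpace ℝ (Fin d))}
  {u v w σ : EuclideanSpace ℝ (Fin d) → ℝ}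
  {g h : EuclideanSpace ℝ (Fin d) → EuclideanSpace ℝ (Fin d)}

/-! ### Functions vanishing on a part of the boundary -/

/-- `w = 0` in a neighbourhood of `Γ`. -/
def VanishesNear (D Γ : Set (EuclideanSpace ℝ (Fin d))) (w : EuclideanSpace ℝ (Fin d) → ℝ) :
    Prop :=
  ∃ U : Set (EuclideanSpace ℝ (Fin d)), IsOpen U ∧ Γ ⊆ U ∧
      ∀ᵐ x ∂(volume.restrict (D ∩ U)), w x = 0

theorem VanishesNear.add (hv : VanishesNear D Γ v) (hw : VanishesNear D Γ w) :
    VanishesNear D Γ (v + w) := by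
  obtain ⟨U, h1, h2, h3⟩ := hv
  obtain ⟨U', h1', h2', h3'⟩ := hw
  refine ⟨U ∩ U', h1.inter h1', subset_inter h2 h2', ?_⟩
  filter_upwards [ae_restrict_of_ae_restrict_of_subset
      (inter_subset_inter_right D (inter_subset_left (s := U) (t := U'))) h3,
    ae_restrict_of_ae_restrict_of_subset
      (inter_subset_inter_right D (inter_subset_right (s := U) (t := U'))) h3'] with x e1 e2
  simp [e1, e2]

theorem VanishesNear.mul (hv : VanishesNear D Γ v) (σ : EuclideanSpace ℝ (Fin d) → ℝ) :
    VanishesNear D Γ (fun x => σ x * v x) := by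
  obtain ⟨U, h1, h2, h3⟩ := hv
  refine ⟨U, h1, h2, ?_⟩
  filter_upwards [h3] with x e1
  simp [e1]

/-- With `exists_approx_of_mem_H1Zero`, this replaces the chosen `weakGrad` by explicit gradients,
which are stable under sums, products and extension. -/
theorem mem_H1Zero_of_approx (hD : IsOpen D) (hu : IsGrad D u g)
    (H : ∀ ε > 0, ∃ w k, IsGrad D w k ∧ VanishesNear D Γ w ∧
      nsq (volume.restrict D) (u - w) < ε ∧ nsq (volume.restrict D) (g - k) < ε) :
    u ∈ H1Zero D Γ := by
  refine ⟨hu.mem_H1, fun ε hε => ?_⟩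
  obtain ⟨w, k, hw, h1, h2, h3⟩ := H (ε / 2) (by positivity)
  refine ⟨w, hw.mem_H1, h1, ?_⟩
  rw [(hu.sub hw).h1NormSq_eq hD]
  linarith

theorem exists_approx_of_mem_H1Zero (hD : IsOpen D) (hu : u ∈ H1Zero D Γ) (hg : IsGrad D u g)
    {ε : ℝ} (hε : 0 < ε) : ∃ w k, IsGrad D w k ∧ VanishesNear D Γ w ∧
      nsq (volume.restrict D) (u - w) < ε ∧ nsq (volume.restrict D) (g - k) < ε := by
  obtain ⟨w, hw, h1, h2⟩ := hu.2 ε hε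
  have hw' := isGrad_weakGrad hw
  refine ⟨w, _, hw', h1, ?_⟩
  rw [(hg.sub hw').h1NormSq_eq hD] at h2
  have e1 := nsq_nonneg (μ := volume.restrict D) (u - w)
  have e2 := nsq_nonneg (μ := volume.restrict D) (g - weakGrad D w)
  constructor <;> linarith

theorem H1Zero_congr (hD : IsOpen D) (hu : u ∈ H1Zero D Γ) (huv : u =ᵐ[volume.restrict D] v) :
    v ∈ H1Zero D Γ := by
  have hg := isGrad_weakGrad hu.1
  refine mem_H1Zero_of_approx hD (hg.congr huv .rfl) fun ε hε => ?_
  obtain ⟨w, k, hw, h1, h2, h3⟩ := exists_approx_of_mem_H1Zero hD hu hg hε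
  refine ⟨w, k, hw, h1, ?_, h3⟩
  rwa [← nsq_congr (f := u - w)]
  filter_upwards [huv] with x hx
  simp [hx]

theorem H1Zero_add (hD : IsOpen D) (hu : u ∈ H1Zero D Γ) (hv : v ∈ H1Zero D Γ) :
    u + v ∈ H1Zero D Γ := by
  have hg := isGrad_weakGrad hu.1
  have hh := isGrad_weakGrad hv.1
  refine mem_H1Zero_of_approx hD (hg.add hh) fun ε hε => ?_
  obtain ⟨w, k, hw, h1, h2, h3⟩ := exists_approx_of_mem_H1Zero hD hu hg (ε := ε / 4)
    (by positivity)
  obtain ⟨w', k', hw', h1', h2', h3'⟩ := exists_approx_of_mem_H1Zero hD hv hh (ε := ε / 4)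
    (by positivity)
  refine ⟨w + w', k + k', hw.add hw', h1.add h1', ?_, ?_⟩
  · rw [add_sub_add_comm]
    linarith [nsq_add_le (hg.memLp.sub hw.memLp) (hh.memLp.sub hw'.memLp)]
  · rw [add_sub_add_comm]
    linarith [nsq_add_le (hg.memLp_grad.sub hw.memLp_grad) (hh.memLp_grad.sub hw'.memLp_grad)]

theorem nsq_mul_le {F : Type*} [NormedAddCommGroup F] [NormedSpace ℝ F]
    {f : EuclideanSpace ℝ (Fin d) → F} {τ : EuclideanSpace ℝ (Fin d) → ℝ} {M : ℝ}
    (hD : MeasurableSet D) (hf : MemLp f 2 (volume.restrict D)) (hM : ∀ x ∈ D, |τ x| ≤ M) :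
    nsq (volume.restrict D) (fun x => τ x • f x) ≤ M ^ 2 * nsq (volume.restrict D) f := by
  rw [← nsq_smul]
  refine nsq_le_of_norm_le (hf.const_smul M) ?_
  filter_upwards [ae_restrict_mem hD] with x hx
  rw [norm_smul, Pi.smul_apply, norm_smul]
  exact mul_le_mul_of_nonneg_right ((hM x hx).trans (le_abs_self M)) (norm_nonneg _)

theorem nsq_mul_gradient_le {L : NNReal} (hD : IsOpen D) (hu : MemLp u 2 (volume.restrict D))
    (hσ : LipschitzOnWith L σ D) :
    nsq (volume.restrict D) (fun x => u x • gradient σ x) ≤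
      (L : ℝ) ^ 2 * nsq (volume.restrict D) u := by
  rw [← nsq_smul]
  refine nsq_le_of_norm_le (hu.const_smul (L : ℝ)) ?_
  filter_upwards [ae_restrict_mem hD.measurableSet] with x hx
  rw [norm_smul, Pi.smul_apply, norm_smul, mul_comm]
  simp only [Real.norm_eq_abs, NNReal.abs_eq]
  exact mul_le_mul_of_nonneg_right (norm_gradient_le hD hσ hx) (abs_nonneg _)

theorem memLp_smul_bdd {F : Type*} [NormedAddCommGroup F] [NormedSpace ℝ F]
    {f : EuclideanSpace ℝ (Fin d) → F} {M : ℝ} {L : NNReal}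
    (hD : IsOpen D) (hf : MemLp f 2 (volume.restrict D)) (hσ : LipschitzOnWith L σ D)
    (hM : ∀ x ∈ D, |σ x| ≤ M) : MemLp (fun x => σ x • f x) 2 (volume.restrict D) :=
  hf.of_le_mul (c := M) ((hσ.continuousOn.aestronglyMeasurable hD.measurableSet).smul hf.1) (by
      filter_upwards [ae_restrict_mem hD.measurableSet] with x hx
      rw [norm_smul]; exact mul_le_mul_of_nonneg_right (hM x hx) (norm_nonneg _))

theorem memLp_smul_gradient {L : NNReal}
    (hD : IsOpen D) (hu : MemLp u 2 (volume.restrict D)) (hσ : LipschitzOnWith L σ D) :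
    MemLp (fun x => u x • gradient σ x) 2 (volume.restrict D) :=
  hu.of_le_mul (c := L) (hu.1.smul (measurable_gradient σ).aestronglyMeasurable) (by
      filter_upwards [ae_restrict_mem hD.measurableSet] with x hx
      rw [norm_smul, mul_comm]
      exact mul_le_mul_of_nonneg_right (norm_gradient_le hD hσ hx) (norm_nonneg _))

/-- Quantitative continuity of the multiplication by a Lipschitz function. -/
theorem nsq_grad_mul_le {M : ℝ} {L : NNReal} (hD : IsOpen D) (hu : MemLp u 2 (volume.restrict D))
    (hg : MemLp g 2 (volume.restrict D)) (hσ : LipschitzOnWith L σ D)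
    (hM : ∀ x ∈ D, |σ x| ≤ M) :
    nsq (volume.restrict D) (fun x => σ x • g x + u x • gradient σ x) ≤
      2 * (M ^ 2 * nsq (volume.restrict D) g) + 2 * (L ^ 2 * nsq (volume.restrict D) u) := by
  have h1 := nsq_add_le (memLp_smul_bdd hD hg hσ hM) (memLp_smul_gradient hD hu hσ)
  have h2 := nsq_mul_le hD.measurableSet hg hM
  have h3 := nsq_mul_gradient_le hD hu hσ
  refine h1.trans ?_
  linarith

/-- Provides the `δ` that makes the bounds of `nsq_mul_le` and `nsq_grad_mul_le` smaller than `ε`.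
-/
theorem exists_small {M : ℝ} {L : NNReal} {ε : ℝ} (hε : 0 < ε) : ∃ δ > 0, M ^ 2 * δ < ε ∧
    2 * (M ^ 2 * δ) + 2 * ((L : ℝ) ^ 2 * δ) < ε := by
  have hq : 0 < ε / (3 * (M ^ 2 + L ^ 2 + 1)) := by positivity
  have he : ε / (3 * (M ^ 2 + L ^ 2 + 1)) * (3 * (M ^ 2 + L ^ 2 + 1)) = ε :=
    div_mul_cancel₀ _ (by positivity)
  generalize ε / (3 * (M ^ 2 + (L : ℝ) ^ 2 + 1)) = q at hq he
  refine ⟨q, hq, ?_, ?_⟩ <;>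
    nlinarith [mul_nonneg hq.le (sq_nonneg M), mul_nonneg hq.le (sq_nonneg (L : ℝ))]

theorem H1Zero_mul {M : ℝ} {L : NNReal} (hD : IsOpen D) (hu : u ∈ H1Zero D Γ)
    (hσ : LipschitzOnWith L σ D) (hM : ∀ x ∈ D, |σ x| ≤ M) :
    (fun x => σ x * u x) ∈ H1Zero D Γ := by
  have hg := isGrad_weakGrad hu.1
  refine mem_H1Zero_of_approx hD (hg.mul_lipschitz hD hσ hM) fun ε hε => ?_
  obtain ⟨δ, hδ, hδ1, hδ2⟩ := exists_small (M := M) (L := L) hε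
  obtain ⟨w, k, hw, h1, h2, h3⟩ := exists_approx_of_mem_H1Zero hD hu hg hδ
  refine ⟨_, _, hw.mul_lipschitz hD hσ hM, h1.mul σ, ?_, ?_⟩
  · have e : ((fun x => σ x * u x) - fun x => σ x * w x) = fun x => σ x • (u - w) x := by
      ext x; simp [mul_sub]
    rw [e]
    refine (nsq_mul_le hD.measurableSet (hg.memLp.sub hw.memLp) hM).trans_lt (lt_of_le_of_lt ?_ hδ1)
    gcongr
  · have e : ((fun x => σ x • weakGrad D u x + u x • gradient σ x) -
        fun x => σ x • k x + w x • gradient σ x) =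
        fun x => σ x • (weakGrad D u - k) x + (u - w) x • gradient σ x := by
      ext1 x; simp only [Pi.sub_apply, smul_sub, sub_smul]; abel
    rw [e]
    refine (nsq_grad_mul_le hD (hg.memLp.sub hw.memLp) (hg.memLp_grad.sub hw.memLp_grad) hσ
      hM).trans_lt (lt_of_le_of_lt ?_ hδ2)
    gcongr

theorem H1Zero_smul (hD : IsOpen D) (c : ℝ) (hu : u ∈ H1Zero D Γ) : c • u ∈ H1Zero D Γ :=
  H1Zero_mul (M := |c|) (L := 0) (σ := fun _ => c) hD hu
    (LipschitzWith.const c).lipschitzOnWith fun _ _ => le_rfl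

/-! ### Extension by zero -/

theorem IsGrad.ae_eq_zero_of_vanish (hD : IsOpen D) (hw : IsGrad D w g) (hU : IsOpen U)
    (h0 : ∀ᵐ x ∂(volume.restrict (D ∩ U)), w x = 0) :
    ∀ᵐ x ∂(volume.restrict (D ∩ U)), g x = 0 :=
  (hw.mono inter_subset_left).unique' (hD.inter hU) isGrad_zero h0

theorem nsq_indicator {F : Type*} [NormedAddCommGroup F] (hD' : MeasurableSet D') (hDD : D' ⊆ D)
    (f : EuclideanSpace ℝ (Fin d) → F) :
    nsq (volume.restrict D) (D'.indicator f) = nsq (volume.restrict D') f := by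
  unfold nsq
  have : (fun x => ‖D'.indicator f x‖ ^ 2) = D'.indicator (fun x => ‖f x‖ ^ 2) := by
    ext x; by_cases hx : x ∈ D' <;> simp [hx]
  rw [this, setIntegral_indicator hD', inter_eq_self_of_subset_right hDD]

theorem memLp_indicator_ext {F : Type*} [NormedAddCommGroup F] (hD' : MeasurableSet D')
    {f : EuclideanSpace ℝ (Fin d) → F} (hf : MemLp f 2 (volume.restrict D')) :
    MemLp (D'.indicator f) 2 (volume.restrict D) := by
  have := (memLp_indicator_iff_restrict (μ := volume) (p := 2) hD').2 hf
  exact this.restrict D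

/-- A test function `η` of `D` need not be one of `D'`. But `w` vanishes near the part of `∂D'`
inside `D`, so `η` may be multiplied by a smooth `ζ` supported in `D'` without changing either
integral. -/
theorem IsGrad.extend_zero (hD' : IsOpen D') (hDD : D' ⊆ D) (hw : IsGrad D' w g)
    (hU : IsOpen U) (hfr : D ∩ frontier D' ⊆ U)
    (h0 : ∀ᵐ x ∂(volume.restrict (D' ∩ U)), w x = 0) :
    IsGrad D (D'.indicator w) (D'.indicator g) := by
  refine ⟨memLp_indicator_ext hD'.measurableSet hw.memLp,
    memLp_indicator_ext hD'.measurableSet hw.memLp_grad, fun η a b c => ?_⟩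
  have hg0 := hw.ae_eq_zero_of_vanish hD' hU h0
  rw [ae_restrict_iff' (hD'.inter hU).measurableSet] at h0 hg0
  -- The part of the support where `w` may be nonzero. Compact, and inside `D'` because `U` covers
  -- `D ∩ frontier D'`; so `ζ` can be `1` near it.
  set K₀ := (tsupport η ∩ closure D') \ U with hK₀
  have hK₀c : IsCompact K₀ := (b.isCompact.inter_right isClosed_closure).diff hU
  have hK₀D : K₀ ⊆ D' := by
    rintro x ⟨⟨h1, h2⟩, h3⟩
    by_contra h4
    exact h3 (hfr ⟨c h1, h2, by rwa [hD'.interior_eq]⟩)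
  obtain ⟨K₁, hK₁, hK₀₁, hK₁D⟩ := exists_compact_between hK₀c hD' hK₀D
  obtain ⟨K₂, hK₂, hK₁₂, hK₂D⟩ := exists_compact_between hK₁ hD' hK₁D
  obtain ⟨ζ, hζ0, hζ1, -⟩ := exists_contMDiffMap_zero_one_of_isClosed (n := ⊤)
    (modelWithCornersSelf ℝ (EuclideanSpace ℝ (Fin d))) (s := (interior K₂)ᶜ) (t := K₁)
    isOpen_interior.isClosed_compl hK₁.isClosed
    (disjoint_left.2 fun x hx hx' => hx (hK₁₂ hx'))
  have hζd : ContDiff ℝ ∞ ζ := ζ.contMDiff.contDiff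
  have hζs : tsupport ζ ⊆ K₂ := by
    refine closure_minimal (fun x hx => ?_) hK₂.isClosed
    by_contra h
    exact hx (hζ0 fun h' => h (interior_subset h'))
  have hη' : ContDiff ℝ ∞ (fun x => ζ x * η x) := hζd.mul a
  have hηc : HasCompactSupport (fun x => ζ x * η x) := b.mul_left
  have hηs : tsupport (fun x => ζ x * η x) ⊆ D' :=
    (closure_mono (Function.support_mul_subset_left _ _)).trans (hζs.trans hK₂D)
  have hηs' : tsupport (fun x => ζ x * η x) ⊆ tsupport η :=
    closure_mono (Function.support_mul_subset_right _ _)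
  have key := hw.weak _ hη' hηc hηs
  have loc : ∀ x ∈ D', x ∉ U → (ζ x * η x = η x ∧
      gradient (fun x => ζ x * η x) x = gradient η x) := by
    intro x hx hxU
    by_cases hxη : x ∈ tsupport η
    · have hx₀ : x ∈ K₀ := ⟨⟨hxη, subset_closure hx⟩, hxU⟩
      have ev : (fun x => ζ x * η x) =ᶠ[nhds x] η := by
        filter_upwards [isOpen_interior.mem_nhds (hK₀₁ hx₀)] with y hy
        rw [hζ1 (interior_subset hy)]; simp
      exact ⟨ev.self_of_nhds, gradient_congr ev⟩
    · rw [image_eq_zero_of_notMem_tsupport hxη, mul_zero,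
        image_eq_zero_of_notMem_tsupport fun h => hxη (tsupport_gradient_subset η h),
        image_eq_zero_of_notMem_tsupport fun h => hxη (hηs' (tsupport_gradient_subset _ h))]
      exact ⟨rfl, rfl⟩
  have e1 : ∫ x in D, D'.indicator w x • gradient η x =
      ∫ x in D', w x • gradient (fun x => ζ x * η x) x := by
    have : (fun x => D'.indicator w x • gradient η x) =
        D'.indicator (fun x => w x • gradient η x) := by
      ext1 x; by_cases hx : x ∈ D' <;> simp [hx]
    rw [this, setIntegral_indicator hD'.measurableSet, inter_eq_self_of_subset_right hDD]
    refine setIntegral_congr_ae hD'.measurableSet ?_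
    filter_upwards [h0] with x hx hxD
    by_cases hxU : x ∈ U
    · rw [hx ⟨hxD, hxU⟩, zero_smul, zero_smul]
    · rw [(loc x hxD hxU).2]
  have e2 : ∫ x in D, η x • D'.indicator g x =
      ∫ x in D', (ζ x * η x) • g x := by
    have : (fun x => η x • D'.indicator g x) = D'.indicator (fun x => η x • g x) := by
      ext1 x; by_cases hx : x ∈ D' <;> simp [hx]
    rw [this, setIntegral_indicator hD'.measurableSet, inter_eq_self_of_subset_right hDD]
    refine setIntegral_congr_ae hD'.measurableSet ?_
    filter_upwards [hg0] with x hx hxD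
    by_cases hxU : x ∈ U
    · rw [hx ⟨hxD, hxU⟩, smul_zero, smul_zero]
    · rw [(loc x hxD hxU).1]
  rw [e1, e2]
  exact key

/-- Extension by zero. -/
theorem H1Zero_extend_zero (hD : IsOpen D) (hD' : IsOpen D') (hDD : D' ⊆ D)
    (hfr : D ∩ frontier D' ⊆ Γ') (hΓ : Γ ∩ closure D' ⊆ Γ') (hu : u ∈ H1Zero D' Γ') :
    D'.indicator u ∈ H1Zero D Γ := by
  have hg := isGrad_weakGrad hu.1
  have main : ∀ ε > 0, ∃ w k, IsGrad D w k ∧ VanishesNear D Γ w ∧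
      nsq (volume.restrict D) (D'.indicator u - w) < ε ∧
      nsq (volume.restrict D) (D'.indicator (weakGrad D' u) - k) < ε := by
    intro ε hε
    obtain ⟨w, k, hw, ⟨U, hU1, hU2, hU3⟩, h2, h3⟩ := exists_approx_of_mem_H1Zero hD' hu hg hε
    refine ⟨D'.indicator w, D'.indicator k, hw.extend_zero hD' hDD hU1 (hfr.trans hU2) hU3,
      ⟨U ∪ (closure D')ᶜ, hU1.union isClosed_closure.isOpen_compl, fun x hx => ?_, ?_⟩, ?_, ?_⟩
    -- A point of `Γ` is either in `Γ'`, where the approximant vanishes nearby, or away from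
    -- `closure D'`, where the extension is zero.
    · by_cases hxc : x ∈ closure D'
      · exact Or.inl (hU2 (hΓ ⟨hx, hxc⟩))
      · exact Or.inr hxc
    · rw [ae_restrict_iff' (hD'.inter hU1).measurableSet] at hU3
      rw [ae_restrict_iff' (hD.inter (hU1.union isClosed_closure.isOpen_compl)).measurableSet]
      filter_upwards [hU3] with x hx hx'
      by_cases hxD : x ∈ D'
      · rw [indicator_of_mem hxD]
        refine hx ⟨hxD, ?_⟩
        rcases hx'.2 with h | h
        · exact h
        · exact absurd (subset_closure hxD) h
      · exact indicator_of_notMem hxD _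
    · rwa [← indicator_sub', nsq_indicator hD'.measurableSet hDD]
    · rwa [← indicator_sub', nsq_indicator hD'.measurableSet hDD]
  have hG : IsGrad D (D'.indicator u) (D'.indicator (weakGrad D' u)) :=
    isGrad_of_approx (memLp_indicator_ext hD'.measurableSet hg.memLp)
      (memLp_indicator_ext hD'.measurableSet hg.memLp_grad) fun ε hε => by
      obtain ⟨w, k, h1, -, h2, h3⟩ := main ε hε
      exact ⟨w, k, h1, h2, h3⟩
  exact mem_H1Zero_of_approx hD hG main

/-! ### Restriction by cutoff functions -/

theorem tendsto_nsq_zero {F : Type*} [NormedAddCommGroup F] {μ : Measure (EuclideanSpace ℝ (Fin d))}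
    {f : ℕ → EuclideanSpace ℝ (Fin d) → F} {G : EuclideanSpace ℝ (Fin d) → ℝ} (hG : MemLp G 2 μ)
    (hf : ∀ n, AEStronglyMeasurable (f n) μ) (hb : ∀ n, ∀ᵐ x ∂μ, ‖f n x‖ ≤ G x)
    (hlim : ∀ᵐ x ∂μ, Filter.Tendsto (fun n => f n x) Filter.atTop (nhds 0)) :
    Filter.Tendsto (fun n => nsq μ (f n)) Filter.atTop (nhds 0) := by
  have := tendsto_integral_of_dominated_convergence (μ := μ) (F := fun n x => ‖f n x‖ ^ 2)
    (f := fun _ => (0 : ℝ)) (fun x => ‖G x‖ ^ 2) (fun n => (hf n).norm.pow 2)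
    (integrable_norm_sq hG) (fun n => by
      filter_upwards [hb n] with x hx
      rw [norm_pow, norm_norm]
      gcongr
      exact hx.trans (le_abs_self _)) (by
      filter_upwards [hlim] with x hx
      simpa using hx.norm.pow 2)
  simpa [nsq] using this

/-- At a zero of `σ` the truncation has a local minimum, and `fderiv` is `0` there, differentiable
or not; above level `δ` it is locally constant. -/
theorem gradient_min_eq_zero (hD : IsOpen D) (hσ : ContinuousOn σ D) (h0 : ∀ x ∈ D, 0 ≤ σ x)
    {x : EuclideanSpace ℝ (Fin d)} (hx : x ∈ D) {δ : ℝ} (hδ : 0 < δ) (h : σ x = 0 ∨ δ < σ x) :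
    gradient (fun y => min (σ y) δ) x = 0 := by
  have hn := hD.mem_nhds hx
  rcases h with h | h
  · have hmin : IsLocalMin (fun y => min (σ y) δ) x := by
      filter_upwards [hn] with y hy
      rw [h, min_eq_left hδ.le]
      exact le_min (h0 y hy) hδ.le
    simp [gradient, hmin.fderiv_eq_zero]
  · have ev : (fun y => min (σ y) δ) =ᶠ[nhds x] fun _ => δ := by
      filter_upwards [(hσ.continuousAt hn).eventually (lt_mem_nhds h)] with y hy
      exact min_eq_right hy.le
    rw [gradient_congr ev]
    simp [gradient]

/-- Multiplication by a Lipschitz function that vanishes outside `D'`. -/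
theorem H1Zero_cutoff {L : NNReal} (hD : IsOpen D) (hD' : IsOpen D') (hDD : D' ⊆ D)
    (hu : u ∈ H1Zero D Γ) (hσ : LipschitzOnWith L σ D) (hσ0 : ∀ x ∈ D, 0 ≤ σ x)
    (hσ1 : ∀ x ∈ D, σ x ≤ 1) (hσz : ∀ x ∈ D, x ∉ D' → σ x = 0)
    (hΓ : ∀ x ∈ Γ', x ∈ Γ ∨ (x ∈ D ∧ x ∉ D')) :
    (fun x => σ x * u x) ∈ H1Zero D' Γ' := by
  have hg := isGrad_weakGrad hu.1
  have hM : ∀ x ∈ D, |σ x| ≤ 1 := fun x hx => abs_le.2 ⟨by linarith [hσ0 x hx], hσ1 x hx⟩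
  refine mem_H1Zero_of_approx hD' ((hg.mul_lipschitz hD hσ hM).mono hDD) fun ε hε => ?_
  obtain ⟨δ, hδ, hδ1, hδ2⟩ := exists_small (M := 1) (L := L) (ε := ε / 4) (by positivity)
  obtain ⟨w, k, hw, ⟨U, hU1, hU2, hU3⟩, h2, h3⟩ := exists_approx_of_mem_H1Zero hD hu hg hδ
  -- `σ w` need not vanish near the part of `∂D'` inside `D`, so it is replaced by `(σ - min σ (t
  -- n)) w`, which vanishes on the open set `{σ < t n}`. The removed piece `min σ (t n) w` tends to
  -- `0` in `H1` by dominated convergence.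
  let t : ℕ → ℝ := fun n => 1 / ((n : ℝ) + 1)
  have ht0 : ∀ n, 0 < t n := fun n => by positivity
  have htl : Filter.Tendsto t Filter.atTop (nhds 0) := tendsto_one_div_add_atTop_nhds_zero_nat
  have hminL : ∀ c : ℝ, LipschitzOnWith L (fun x => min (σ x) c) D := fun c x hx y hy => by
    refine le_trans ?_ (hσ hx hy)
    rw [edist_dist, edist_dist]
    exact ENNReal.ofReal_le_ofReal (by
      rw [Real.dist_eq, Real.dist_eq]
      exact (abs_min_sub_min_le_max _ _ _ _).trans (by simp))
  have hminM : ∀ n, ∀ x ∈ D, |min (σ x) (t n)| ≤ 1 := fun n x hx => by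
    rw [abs_of_nonneg (le_min (hσ0 x hx) (ht0 n).le)]
    exact (min_le_left _ _).trans (hσ1 x hx)
  have hGn := fun n => hw.mul_lipschitz hD (hminL (t n)) (hminM n)
  have hσw := hw.mul_lipschitz hD hσ hM
  have l1 : Filter.Tendsto (fun n => nsq (volume.restrict D) (fun x => min (σ x) (t n) * w x))
      Filter.atTop (nhds 0) := by
    refine tendsto_nsq_zero hw.memLp.norm (fun n => (hGn n).memLp.1) (fun n => ?_) ?_
    · filter_upwards [ae_restrict_mem hD.measurableSet] with x hx
      rw [norm_mul]
      exact mul_le_of_le_one_left (norm_nonneg _) (hminM n x hx)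
    · filter_upwards [ae_restrict_mem hD.measurableSet] with x hx
      have : Filter.Tendsto (fun n => min (σ x) (t n)) Filter.atTop (nhds 0) := by
        refine squeeze_zero (fun n => le_min (hσ0 x hx) (ht0 n).le) (fun n => min_le_right _ _) htl
      simpa using this.mul_const (w x)
  have l2 : Filter.Tendsto (fun n => nsq (volume.restrict D)
      (fun x => min (σ x) (t n) • k x + w x • gradient (fun x => min (σ x) (t n)) x))
      Filter.atTop (nhds 0) := by
    refine tendsto_nsq_zero (hw.memLp_grad.norm.add (hw.memLp.norm.const_mul L))
      (fun n => (hGn n).memLp_grad.1) (fun n => ?_) ?_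
    · filter_upwards [ae_restrict_mem hD.measurableSet] with x hx
      refine (norm_add_le _ _).trans (add_le_add ?_ ?_)
      · rw [norm_smul]
        exact mul_le_of_le_one_left (norm_nonneg _) (hminM n x hx)
      · rw [norm_smul, mul_comm]
        exact mul_le_mul_of_nonneg_right (norm_gradient_le hD (hminL (t n)) hx) (norm_nonneg _)
    · filter_upwards [ae_restrict_mem hD.measurableSet] with x hx
      have e1 : Filter.Tendsto (fun n => min (σ x) (t n)) Filter.atTop (nhds 0) := by
        refine squeeze_zero (fun n => le_min (hσ0 x hx) (ht0 n).le) (fun n => min_le_right _ _) htl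
      have e2 : Filter.Tendsto (fun n => gradient (fun x => min (σ x) (t n)) x) Filter.atTop
          (nhds 0) := by
        -- At each point the gradient of the truncation is eventually zero: at once where `σ x = 0`,
        -- and as soon as `t n < σ x` otherwise.
        refine tendsto_const_nhds.congr' ?_
        rcases (hσ0 x hx).eq_or_lt with h | h
        · exact .of_forall fun n =>
            (gradient_min_eq_zero hD hσ.continuousOn hσ0 hx (ht0 n) (Or.inl h.symm)).symm
        · filter_upwards [htl.eventually (gt_mem_nhds h)] with n hn
          exact (gradient_min_eq_zero hD hσ.continuousOn hσ0 hx (ht0 n) (Or.inr hn)).symm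
      simpa using (e1.smul_const (k x)).add (e2.const_smul (w x))
  obtain ⟨n, hn1, hn2⟩ := (((tendsto_order.1 l1).2 (ε / 4) (by positivity)).and
    ((tendsto_order.1 l2).2 (ε / 4) (by positivity))).exists
  have hdiff := hσw.sub (hGn n)
  have hem := memLp_smul_bdd hD (hg.memLp.sub hw.memLp) hσ hM
  have hem' := (memLp_smul_bdd hD (hg.memLp_grad.sub hw.memLp_grad) hσ hM).add
    (memLp_smul_gradient hD (hg.memLp.sub hw.memLp) hσ)
  -- `U` takes care of the points of `Γ`, the sublevel set of those in `D` outside `D'`.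
  refine ⟨_, _, hdiff.mono hDD, ⟨U ∪ {x ∈ D | σ x < t n}, hU1.union ?_, fun x hx => ?_, ?_⟩, ?_, ?_⟩
  · exact hσ.continuousOn.isOpen_inter_preimage hD isOpen_Iio
  · rcases hΓ x hx with h | ⟨h, h'⟩
    · exact Or.inl (hU2 h)
    · refine Or.inr ⟨h, ?_⟩
      rw [hσz x h h']; exact ht0 n
  · have hopen : IsOpen {x ∈ D | σ x < t n} :=
      hσ.continuousOn.isOpen_inter_preimage hD isOpen_Iio
    rw [ae_restrict_iff' (hD.inter hU1).measurableSet] at hU3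
    rw [ae_restrict_iff' (hD'.inter (hU1.union hopen)).measurableSet]
    filter_upwards [hU3] with x hx hx'
    simp only [Pi.sub_apply]
    rcases hx'.2 with h | h
    · rw [hx ⟨hDD hx'.1, h⟩]; simp
    · rw [min_eq_left h.2.le, sub_self]
  · have e : ((fun x => σ x * u x) - ((fun x => σ x * w x) - fun x => min (σ x) (t n) * w x)) =
        (fun x => σ x • (u - w) x) + fun x => min (σ x) (t n) * w x := by
      ext x; simp only [Pi.sub_apply, Pi.add_apply, smul_eq_mul]; ring
    rw [e]
    refine (nsq_restrict_le hDD (hem.add (hGn n).memLp)).trans_lt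
      ((nsq_add_le hem (hGn n).memLp).trans_lt ?_)
    have e3 := nsq_mul_le hD.measurableSet (hg.memLp.sub hw.memLp) hM
    have e4 : (1 : ℝ) ^ 2 * nsq (volume.restrict D) (u - w) ≤ 1 ^ 2 * δ := by gcongr
    linarith
  · have e : ((fun x => σ x • weakGrad D u x + u x • gradient σ x) -
        ((fun x => σ x • k x + w x • gradient σ x) - fun x => min (σ x) (t n) • k x +
          w x • gradient (fun x => min (σ x) (t n)) x)) =
        (fun x => σ x • (weakGrad D u - k) x + (u - w) x • gradient σ x) +
          fun x => min (σ x) (t n) • k x + w x • gradient (fun x => min (σ x) (t n)) x := by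
      ext1 x; simp only [Pi.sub_apply, Pi.add_apply, smul_sub, sub_smul]; abel
    rw [e]
    refine (nsq_restrict_le hDD (hem'.add (hGn n).memLp_grad)).trans_lt
      ((nsq_add_le hem' (hGn n).memLp_grad).trans_lt ?_)
    have e3 := nsq_grad_mul_le hD (hg.memLp.sub hw.memLp) (hg.memLp_grad.sub hw.memLp_grad) hσ hM
    have e4 : 2 * ((1 : ℝ) ^ 2 * nsq (volume.restrict D) (weakGrad D u - k)) +
        2 * ((L : ℝ) ^ 2 * nsq (volume.restrict D) (u - w)) ≤
        2 * (1 ^ 2 * δ) + 2 * ((L : ℝ) ^ 2 * δ) := by gcongr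
    have e5 : nsq (volume.restrict D) ((fun x => σ x • (weakGrad D u - k) x) +
      fun x => (u - w) x • gradient σ x) ≤ _ := e3
    linarith

end CEM
end

/-! ### Geometry of the coarse grid, cutoff functions, local and global spaces -/

open MeasureTheory Set
open scoped ContDiff
noncomputable section
namespace CEM

/-! ### The coarse grid -/

section Grid

variable {d Nc Nv : ℕ} {P : PerforatedDomain d} {G : CoarseGrid P Nc Nv}
  {χ : Fin Nv → EuclideanSpace ℝ (Fin d) → ℝ} {u v : EuclideanSpace ℝ (Fin d) → ℝ}

theorem PerforatedDomain.isOpen_dom (P : PerforatedDomain d) : IsOpen P.dom :=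
  P.isOpen_Omega.sdiff P.isCompact_B.isClosed

theorem PerforatedDomain.isBounded_dom (P : PerforatedDomain d) : Bornology.IsBounded P.dom :=
  P.isBounded_Omega.subset sdiff_subset

theorem CoarseGrid.isOpen_K (G : CoarseGrid P Nc Nv) (p : Fin Nc) : IsOpen (G.K p) :=
  isOpen_interior.inter P.isOpen_dom

theorem CoarseGrid.K_subset_dom (G : CoarseGrid P Nc Nv) (p : Fin Nc) : G.K p ⊆ P.dom :=
  inter_subset_right

theorem CoarseGrid.K_subset_cell (G : CoarseGrid P Nc Nv) (p : Fin Nc) : G.K p ⊆ G.cell p :=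
  inter_subset_left.trans interior_subset

theorem CoarseGrid.nonempty_K (G : CoarseGrid P Nc Nv) (p : Fin Nc) : (G.K p).Nonempty :=
  G.nonempty p

theorem CoarseGrid.convex_cell (G : CoarseGrid P Nc Nv) (p : Fin Nc) : Convex ℝ (G.cell p) :=
  convex_convexHull ℝ _

theorem CoarseGrid.seqCompactH1_K (G : CoarseGrid P Nc Nv) (p : Fin Nc) :
    SeqCompactH1 (G.K p) :=
  seqCompactH1_of_finiteUnion (P.isBounded_dom.subset (G.K_subset_dom p)) (G.regular p)

theorem CoarseGrid.disjoint_K (G : CoarseGrid P Nc Nv) :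
    Pairwise (Function.onFun Disjoint G.K) := fun p q hpq =>
  (G.disjoint p q hpq).mono inter_subset_left inter_subset_left

/-- What the open elements miss lies on boundaries of cells, which are null sets because cells are
convex. -/
theorem CoarseGrid.ae_eq_iUnion_K (G : CoarseGrid P Nc Nv) :
    P.dom =ᵐ[volume] ⋃ p, G.K p := by
  refine Filter.EventuallyLE.antisymm (ae_le_set.2 ?_)
    (iUnion_subset fun p => G.K_subset_dom p).eventuallyLE
  refine measure_mono_null (t := ⋃ p, frontier (G.cell p)) ?_
    (measure_iUnion_null fun p => (G.convex_cell p).addHaar_frontier volume)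
  rintro x ⟨hx, hx'⟩
  obtain ⟨p, hp⟩ := mem_iUnion.1 (G.covers hx)
  refine mem_iUnion.2 ⟨p, subset_closure hp, fun h => hx' (mem_iUnion.2 ⟨p, h, hx⟩)⟩

theorem CoarseGrid.setIntegral_dom (G : CoarseGrid P Nc Nv) {f : EuclideanSpace ℝ (Fin d) → ℝ}
    (hf : IntegrableOn f P.dom) : ∫ x in P.dom, f x = ∑ p, ∫ x in G.K p, f x := by
  rw [setIntegral_congr_set G.ae_eq_iUnion_K,
    integral_iUnion_fintype (fun p => (G.isOpen_K p).measurableSet) G.disjoint_K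
      fun p => hf.mono_set (G.K_subset_dom p)]

theorem CoarseGrid.aForm_dom (G : CoarseGrid P Nc Nv) (hu : u ∈ H1 P.dom) (hv : v ∈ H1 P.dom) :
    aForm P.dom u v = ∑ p, aForm (G.K p) u v := by
  have h1 := isGrad_weakGrad hu
  have h2 := isGrad_weakGrad hv
  rw [aForm, G.setIntegral_dom (integrable_inner h1.memLp_grad h2.memLp_grad)]
  refine Finset.sum_congr rfl fun p _ => ?_
  rw [(h1.mono (G.K_subset_dom p)).aForm_eq (G.isOpen_K p) (h2.mono (G.K_subset_dom p))]

theorem CoarseGrid.isOpen_over (G : CoarseGrid P Nc Nv) (i : Fin Nc) (m : ℕ) :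
    IsOpen (G.over i m) := isOpen_interior.inter P.isOpen_dom

theorem CoarseGrid.over_subset_dom (G : CoarseGrid P Nc Nv) (i : Fin Nc) (m : ℕ) :
    G.over i m ⊆ P.dom := inter_subset_right

theorem CoarseGrid.K_subset_over (G : CoarseGrid P Nc Nv) {i p : Fin Nc} {m : ℕ}
    (hp : p ∈ G.layer i m) : G.K p ⊆ G.over i m :=
  inter_subset_inter_left _ (interior_mono (subset_biUnion_of_mem (u := G.cell) hp))

/-- A point in the interior of cell `p` and in a closed cell `q` is a limit of interior points of
`q`, as `q` is convex with nonempty interior. So the interiors would meet. -/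
theorem CoarseGrid.disjoint_K_over (G : CoarseGrid P Nc Nv) {i p : Fin Nc} {m : ℕ}
    (hp : p ∉ G.layer i m) : Disjoint (G.K p) (G.over i m) := by
  rw [disjoint_left]
  rintro x ⟨hx, -⟩ ⟨hx', -⟩
  obtain ⟨q, hq, hxq⟩ := mem_iUnion₂.1 (interior_subset hx')
  have hpq : p ≠ q := fun h => hp (h ▸ hq)
  have hne : (interior (G.cell q)).Nonempty := (G.nonempty q).mono inter_subset_left
  have h1 : x ∈ closure (interior (G.cell q)) := by
    rw [(G.convex_cell q).closure_interior_eq_closure_of_nonempty_interior hne]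
    exact subset_closure hxq
  obtain ⟨y, hy, hy'⟩ := mem_closure_iff.1 h1 _ isOpen_interior hx
  exact disjoint_left.1 (G.disjoint p q hpq) hy hy'

theorem CoarseGrid.vert_nonempty (G : CoarseGrid P Nc Nv) (p : Fin Nc) : (G.vert p).Nonempty := by
  by_contra h
  rw [Finset.not_nonempty_iff_eq_empty] at h
  obtain ⟨x, hx⟩ := G.nonempty_K p
  have := G.K_subset_cell p hx
  simp [CoarseGrid.cell, h] at this

theorem CoarseGrid.layer_subset_succ (G : CoarseGrid P Nc Nv) (i : Fin Nc) (m : ℕ) :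
    G.layer i m ⊆ G.layer i (m + 1) := fun p hp => by
  obtain ⟨a, ha⟩ := G.vert_nonempty p
  exact ⟨p, hp, a, ha, ha⟩

theorem CoarseGrid.layer_mono (G : CoarseGrid P Nc Nv) (i : Fin Nc) : Monotone (G.layer i) :=
  monotone_nat_of_le_succ (G.layer_subset_succ i)

theorem CoarseGrid.self_mem_layer (G : CoarseGrid P Nc Nv) (i : Fin Nc) (m : ℕ) :
    i ∈ G.layer i m := G.layer_mono i (Nat.zero_le m) rfl

/-! ### The weight -/

theorem isWeight_kappa (hχ : IsPartitionOfUnity G χ) : ∃ C, IsWeight P.dom (kappa χ) C := by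
  choose L hL using hχ.lipschitz
  refine ⟨∑ a, (L a : ℝ) ^ 2, P.isOpen_dom, ?_, fun x => ?_, fun x hx => ?_⟩
  · unfold kappa
    exact Finset.measurable_sum _ fun a _ => (measurable_gradient (χ a)).norm.pow_const 2
  · exact Finset.sum_nonneg fun a _ => by positivity
  · refine Finset.sum_le_sum fun a _ => ?_
    have := norm_gradient_le P.isOpen_dom (hL a) hx
    gcongr

/-! ### Cutoff functions -/

open Classical in
/-- The vertices of the `m`-th layer. -/
def layerVert (G : CoarseGrid P Nc Nv) (i : Fin Nc) (m : ℕ) : Finset (Fin Nv) :=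
  Finset.univ.filter fun a => ∃ p ∈ G.layer i m, a ∈ G.vert p

/-- The cutoff function that is `1` on the `m`-th layer and `0` outside the next one. -/
def cutoff (G : CoarseGrid P Nc Nv) (χ : Fin Nv → EuclideanSpace ℝ (Fin d) → ℝ) (i : Fin Nc)
    (m : ℕ) (x : EuclideanSpace ℝ (Fin d)) : ℝ :=
  ∑ a ∈ layerVert G i m, χ a x

theorem mem_layerVert {i : Fin Nc} {m : ℕ} {a : Fin Nv} :
    a ∈ layerVert G i m ↔ ∃ p ∈ G.layer i m, a ∈ G.vert p := by
  simp [layerVert]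

theorem cutoff_nonneg (hχ : IsPartitionOfUnity G χ) (i : Fin Nc) (m : ℕ)
    {x : EuclideanSpace ℝ (Fin d)} (hx : x ∈ P.dom) : 0 ≤ cutoff G χ i m x :=
  Finset.sum_nonneg fun a _ => (hχ.mem_Icc a x hx).1

theorem cutoff_le_one (hχ : IsPartitionOfUnity G χ) (i : Fin Nc) (m : ℕ)
    {x : EuclideanSpace ℝ (Fin d)} (hx : x ∈ P.dom) : cutoff G χ i m x ≤ 1 := by
  rw [← hχ.sum_eq_one x hx]
  exact Finset.sum_le_sum_of_subset_of_nonneg (Finset.subset_univ _)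
    fun a _ _ => (hχ.mem_Icc a x hx).1

theorem cutoff_eq_one (hχ : IsPartitionOfUnity G χ) {i p : Fin Nc} {m : ℕ}
    (hp : p ∈ G.layer i m) {x : EuclideanSpace ℝ (Fin d)} (hx : x ∈ G.cell p ∩ P.dom) :
    cutoff G χ i m x = 1 := by
  rw [← hχ.sum_eq_one x hx.2]
  refine Finset.sum_subset (Finset.subset_univ _) fun a _ ha => ?_
  exact hχ.eq_zero p a (fun h => ha (mem_layerVert.2 ⟨p, hp, h⟩)) x hx

/-- A vertex of layer `m` that also belongs to cell `p` would put `p` into layer `m + 1`, by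
definition of a layer. -/
theorem cutoff_eq_zero (hχ : IsPartitionOfUnity G χ) {i p : Fin Nc} {m : ℕ}
    (hp : p ∉ G.layer i (m + 1)) {x : EuclideanSpace ℝ (Fin d)} (hx : x ∈ G.cell p ∩ P.dom) :
    cutoff G χ i m x = 0 := by
  refine Finset.sum_eq_zero fun a ha => ?_
  obtain ⟨q, hq, haq⟩ := mem_layerVert.1 ha
  exact hχ.eq_zero p a (fun h => hp ⟨q, hq, a, haq, h⟩) x hx

theorem lipschitzOnWith_finset_sum {ι : Type*} (s : Finset ι) {D : Set (EuclideanSpace ℝ (Fin d))}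
    {f : ι → EuclideanSpace ℝ (Fin d) → ℝ} (h : ∀ a, ∃ C, LipschitzOnWith C (f a) D) :
    ∃ C, LipschitzOnWith C (fun x => ∑ a ∈ s, f a x) D := by
  classical
  induction s using Finset.induction_on with
  | empty => exact ⟨0, by simp⟩
  | insert a s ha ih =>
    obtain ⟨C, hC⟩ := ih
    obtain ⟨C', hC'⟩ := h a
    refine ⟨C' + C, ?_⟩
    simp only [Finset.sum_insert ha]
    exact hC'.add hC

theorem lipschitzOnWith_cutoff (hχ : IsPartitionOfUnity G χ) (i : Fin Nc) (m : ℕ) :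
    ∃ C, LipschitzOnWith C (cutoff G χ i m) P.dom :=
  lipschitzOnWith_finset_sum _ hχ.lipschitz

/-- By continuity the cutoff stays nonzero near a point where it is nonzero. All cells containing
nearby points then belong to layer `m + 1`, so the point is interior to their union. -/
theorem cutoff_eq_zero_of_notMem_over (hχ : IsPartitionOfUnity G χ) {i : Fin Nc} {m : ℕ}
    {x : EuclideanSpace ℝ (Fin d)} (hx : x ∈ P.dom) (hx' : x ∉ G.over i (m + 1)) :
    cutoff G χ i m x = 0 := by
  by_contra h
  obtain ⟨C, hC⟩ := lipschitzOnWith_cutoff hχ i m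
  have hn := P.isOpen_dom.mem_nhds hx
  have ev := ((hC.continuousOn.continuousAt hn).eventually_ne h).and hn
  refine hx' ⟨mem_interior_iff_mem_nhds.2 ?_, hx⟩
  filter_upwards [ev] with y hy
  obtain ⟨p, hp⟩ := mem_iUnion.1 (G.covers hy.2)
  have hpl : p ∈ G.layer i (m + 1) := by
    by_contra h'
    exact hy.1 (cutoff_eq_zero hχ h' ⟨hp, hy.2⟩)
  exact mem_iUnion₂.2 ⟨p, hpl, hp⟩

theorem norm_sum_sq_le {ι F : Type*} [NormedAddCommGroup F] (s : Finset ι) (f : ι → F) :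
    ‖∑ a ∈ s, f a‖ ^ 2 ≤ s.card * ∑ a ∈ s, ‖f a‖ ^ 2 :=
  (pow_le_pow_left₀ (norm_nonneg _) (norm_sum_le _ _) 2).trans sq_sum_le_card_mul_sum_sq

theorem gradient_finset_sum {ι : Type*} (s : Finset ι) {f : ι → EuclideanSpace ℝ (Fin d) → ℝ}
    {x : EuclideanSpace ℝ (Fin d)} (h : ∀ a, DifferentiableAt ℝ (f a) x) :
    gradient (fun y => ∑ a ∈ s, f a y) x = ∑ a ∈ s, gradient (f a) x := by
  unfold gradient
  rw [fderiv_fun_sum fun a _ => h a, map_sum]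

/-- On one element only the gradients of its at most `8` vertices survive, and they sum to zero. So
`∇χ` is, up to sign, both the sum over its `A` vertices in the layer and the sum over the other `B`.
Cauchy-Schwarz on both gives `|∇χ|² ≤ AB / (A + B) κ̃`, and `AB / (A + B) ≤ (A + B) / 4 ≤ 2`. -/
theorem norm_gradient_cutoff_sq_le (hd : d ≤ 3) (hχ : IsPartitionOfUnity G χ) (i : Fin Nc) (m : ℕ)
    (p : Fin Nc) : ∀ᵐ x ∂(volume.restrict (G.K p)),
      ‖gradient (cutoff G χ i m) x‖ ^ 2 ≤ 2 * kappa χ x := by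
  classical
  have hdiff : ∀ᵐ x ∂(volume.restrict (G.K p)), ∀ a, DifferentiableAt ℝ (χ a) x := by
    rw [ae_all_iff]
    intro a
    obtain ⟨C, hC⟩ := hχ.lipschitz a
    exact ae_differentiableAt_of_lipschitzOnWith (G.isOpen_K p) (hC.mono (G.K_subset_dom p))
  filter_upwards [hdiff, ae_restrict_mem (G.isOpen_K p).measurableSet] with x hx hxK
  have hn := (G.isOpen_K p).mem_nhds hxK
  have hz : ∀ a, a ∉ G.vert p → gradient (χ a) x = 0 := fun a ha => by
    have ev : χ a =ᶠ[nhds x] fun _ => 0 := by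
      filter_upwards [hn] with y hy
      exact hχ.eq_zero p a ha y ⟨G.K_subset_cell p hy, G.K_subset_dom p hy⟩
    rw [gradient_congr ev]; simp [gradient]
  have htot : ∑ a, gradient (χ a) x = 0 := by
    rw [← gradient_finset_sum _ hx]
    have ev : (fun y => ∑ a, χ a y) =ᶠ[nhds x] fun _ => 1 := by
      filter_upwards [hn] with y hy
      exact hχ.sum_eq_one y (G.K_subset_dom p hy)
    rw [gradient_congr ev]; simp [gradient]
  set S := layerVert G i m
  set N := G.vert p
  have h1 : gradient (cutoff G χ i m) x = ∑ a ∈ S ∩ N, gradient (χ a) x := by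
    unfold cutoff
    rw [gradient_finset_sum _ hx]
    exact (Finset.sum_subset Finset.inter_subset_left fun a ha hb =>
      hz a fun h => hb (Finset.mem_inter.2 ⟨ha, h⟩)).symm
  have hN : ∑ a ∈ N, gradient (χ a) x = 0 := by
    rw [← htot]
    exact Finset.sum_subset (Finset.subset_univ _) fun a _ hb => hz a hb
  have h2 : ∑ a ∈ N \ S, gradient (χ a) x = -gradient (cutoff G χ i m) x := by
    have h3 := Finset.sum_inter_add_sum_sdiff N S fun a => gradient (χ a) x
    rw [hN, Finset.inter_comm, ← h1] at h3
    exact (neg_eq_of_add_eq_zero_right h3).symm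
  have hκ : ∑ a ∈ S ∩ N, ‖gradient (χ a) x‖ ^ 2 + ∑ a ∈ N \ S, ‖gradient (χ a) x‖ ^ 2 ≤
      kappa χ x := by
    rw [Finset.inter_comm, Finset.sum_inter_add_sum_sdiff]
    exact Finset.sum_le_sum_of_subset_of_nonneg (Finset.subset_univ _) fun a _ _ => by positivity
  have b1 := norm_sum_sq_le (S ∩ N) fun a => gradient (χ a) x
  have b2 := norm_sum_sq_le (N \ S) fun a => gradient (χ a) x
  rw [← h1] at b1
  rw [h2, norm_neg] at b2
  have hcard : ((S ∩ N).card : ℝ) + (N \ S).card ≤ 8 := by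
    have h3 : (S ∩ N).card + (N \ S).card = N.card := by
      rw [Finset.inter_comm, Finset.card_inter_add_card_sdiff]
    have h4 : N.card ≤ 8 := (G.card_vert_le p).trans (by
      calc 2 ^ d ≤ 2 ^ 3 := Nat.pow_le_pow_right (by norm_num) hd
        _ = 8 := by norm_num)
    exact_mod_cast h3.le.trans h4
  have hX : 0 ≤ ∑ a ∈ S ∩ N, ‖gradient (χ a) x‖ ^ 2 := Finset.sum_nonneg fun a _ => by positivity
  have hY : 0 ≤ ∑ a ∈ N \ S, ‖gradient (χ a) x‖ ^ 2 := Finset.sum_nonneg fun a _ => by positivity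
  have hA : (0 : ℝ) ≤ (S ∩ N).card := Nat.cast_nonneg _
  have hB : (0 : ℝ) ≤ (N \ S).card := Nat.cast_nonneg _
  have hg : 0 ≤ ‖gradient (cutoff G χ i m) x‖ ^ 2 := by positivity
  generalize ∑ a ∈ S ∩ N, ‖gradient (χ a) x‖ ^ 2 = X at *
  generalize ∑ a ∈ N \ S, ‖gradient (χ a) x‖ ^ 2 = Y at *
  generalize ((S ∩ N).card : ℝ) = A at *
  generalize ((N \ S).card : ℝ) = B at *
  generalize ‖gradient (cutoff G χ i m) x‖ ^ 2 = g at *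
  refine le_trans ?_ (mul_le_mul_of_nonneg_left hκ zero_le_two)
  -- An empty group of vertices forces the gradient to be zero.
  rcases hA.eq_or_lt with h | h
  · rw [← h, zero_mul] at b1; linarith
  rcases hB.eq_or_lt with h' | h'
  · rw [← h', zero_mul] at b2; linarith
  have e1 : (A + B) * g ≤ A * B * (X + Y) := by nlinarith
  have e2 : A * B ≤ (A + B) * 2 := by nlinarith [sq_nonneg (A - B)]
  have e3 : (A + B) * g ≤ (A + B) * (2 * (X + Y)) := by nlinarith
  exact le_of_mul_le_mul_left e3 (by positivity)

/-! ### The spaces `V` and `V0` -/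

/-- The Dirichlet boundary of the oversampling domain is either outer boundary of `Ω^ε`, where
functions of `V` vanish, or lies inside `Ω^ε`, where the cutoff vanishes. This is the case
distinction required by `H1Zero_cutoff`. -/
theorem over_boundary_cases {i : Fin Nc} {m : ℕ} {x : EuclideanSpace ℝ (Fin d)}
    (hx : x ∈ frontier (G.over i m) \ (frontier (G.over i m) ∩ frontier P.B)) :
    x ∈ frontier P.dom ∩ frontier P.Omega ∨ (x ∈ P.dom ∧ x ∉ G.over i m) := by
  obtain ⟨h1, h2⟩ := hx
  have h3 : x ∉ frontier P.B := fun h => h2 ⟨h1, h⟩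
  rw [(G.isOpen_over i m).frontier_eq] at h1
  have hcl : x ∈ closure P.dom := closure_mono (G.over_subset_dom i m) h1.1
  by_cases hΩ : x ∈ P.Omega
  · refine Or.inr ⟨⟨hΩ, fun hB => ?_⟩, h1.2⟩
    -- Off its frontier, a point of `B` is interior to it and cannot be a limit of points of `Ω^ε`.
    have hint : x ∈ interior P.B := by
      by_contra h; exact h3 ⟨subset_closure hB, h⟩
    obtain ⟨y, hy, hy'⟩ := mem_closure_iff.1 hcl _ isOpen_interior hint
    exact hy'.2 (interior_subset hy)
  · refine Or.inl ⟨?_, ?_⟩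
    · rw [P.isOpen_dom.frontier_eq]
      exact ⟨hcl, fun h => hΩ h.1⟩
    · rw [P.isOpen_Omega.frontier_eq]
      exact ⟨closure_mono sdiff_subset hcl, hΩ⟩

theorem frontier_B_subset (P : PerforatedDomain d) : frontier P.B ⊆ P.B :=
  P.isCompact_B.isClosed.frontier_subset

/-- Extension by zero is allowed because the free part of the boundary lies on `∂B ⊆ B`, which meets
neither `Ω^ε` nor `∂Ω`. -/
theorem V0_subset_V {i : Fin Nc} {m : ℕ} (hu : u ∈ V0 G i m) : u ∈ V P := by
  have hind : (G.over i m).indicator u = u := by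
    ext x
    by_cases hx : x ∈ G.over i m
    · rw [indicator_of_mem hx]
    · rw [indicator_of_notMem hx, hu.2 x hx]
  have := H1Zero_extend_zero (Γ := frontier P.dom ∩ frontier P.Omega) P.isOpen_dom
    (G.isOpen_over i m) (G.over_subset_dom i m) ?_ ?_ hu.1
  · rwa [hind] at this
  · rintro x ⟨hx, hx'⟩
    exact ⟨hx', fun h => hx.2 (frontier_B_subset P h.2)⟩
  · rintro x ⟨⟨-, hx⟩, hx'⟩
    rw [P.isOpen_Omega.frontier_eq] at hx
    refine ⟨?_, fun h => hx.2 (P.B_subset (frontier_B_subset P h.2))⟩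
    rw [(G.isOpen_over i m).frontier_eq]
    exact ⟨hx', fun h => hx.2 (G.over_subset_dom i m h).1⟩

theorem V_subset_H1 (hu : u ∈ V P) : u ∈ H1 P.dom := hu.1

theorem V_add (hu : u ∈ V P) (hv : v ∈ V P) : u + v ∈ V P := H1Zero_add P.isOpen_dom hu hv

theorem V_smul (c : ℝ) (hu : u ∈ V P) : c • u ∈ V P := H1Zero_smul P.isOpen_dom c hu

theorem V0_add {i : Fin Nc} {m : ℕ} (hu : u ∈ V0 G i m) (hv : v ∈ V0 G i m) :
    u + v ∈ V0 G i m :=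
  ⟨H1Zero_add (G.isOpen_over i m) hu.1 hv.1, fun x hx => by simp [hu.2 x hx, hv.2 x hx]⟩

theorem V0_smul {i : Fin Nc} {m : ℕ} (c : ℝ) (hu : u ∈ V0 G i m) : c • u ∈ V0 G i m :=
  ⟨H1Zero_smul (G.isOpen_over i m) c hu.1, fun x hx => by simp [hu.2 x hx]⟩

theorem lipschitzOnWith_one_sub_cutoff (hχ : IsPartitionOfUnity G χ) (i : Fin Nc) (m : ℕ) :
    ∃ C, LipschitzOnWith C (fun x => 1 - cutoff G χ i m x) P.dom := by
  obtain ⟨C, hC⟩ := lipschitzOnWith_cutoff hχ i m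
  refine ⟨0 + C, ?_⟩
  exact (LipschitzWith.const (1 : ℝ)).lipschitzOnWith.sub hC

theorem abs_one_sub_cutoff_le (hχ : IsPartitionOfUnity G χ) (i : Fin Nc) (m : ℕ)
    {x : EuclideanSpace ℝ (Fin d)} (hx : x ∈ P.dom) : |1 - cutoff G χ i m x| ≤ 1 := by
  have h1 := cutoff_nonneg hχ i m hx
  have h2 := cutoff_le_one hχ i m hx
  rw [abs_le]; constructor <;> linarith

theorem V_one_sub_cutoff_mul (hχ : IsPartitionOfUnity G χ) (i : Fin Nc) (m : ℕ) (hu : u ∈ V P) :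
    (fun x => (1 - cutoff G χ i m x) * u x) ∈ V P := by
  obtain ⟨C, hC⟩ := lipschitzOnWith_one_sub_cutoff hχ i m
  exact H1Zero_mul P.isOpen_dom hu hC fun x hx => abs_one_sub_cutoff_le hχ i m hx

theorem V0_one_sub_cutoff_mul (hχ : IsPartitionOfUnity G χ) (i : Fin Nc) (m k : ℕ)
    (hu : u ∈ V0 G i k) : (fun x => (1 - cutoff G χ i m x) * u x) ∈ V0 G i k := by
  obtain ⟨C, hC⟩ := lipschitzOnWith_one_sub_cutoff hχ i m
  exact ⟨H1Zero_mul (G.isOpen_over i k) hu.1 (hC.mono (G.over_subset_dom i k)) fun x hx =>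
    abs_one_sub_cutoff_le hχ i m (G.over_subset_dom i k hx), fun x hx => by simp [hu.2 x hx]⟩

theorem V0_cutoff_mul (hχ : IsPartitionOfUnity G χ) (i : Fin Nc) (m : ℕ) (hu : u ∈ V P) :
    (G.over i (m + 1)).indicator (fun x => cutoff G χ i m x * u x) ∈ V0 G i (m + 1) := by
  obtain ⟨C, hC⟩ := lipschitzOnWith_cutoff hχ i m
  refine ⟨?_, fun x hx => indicator_of_notMem hx _⟩
  refine H1Zero_congr (G.isOpen_over i (m + 1)) (H1Zero_cutoff P.isOpen_dom
    (G.isOpen_over i (m + 1)) (G.over_subset_dom i (m + 1)) hu hC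
    (fun x hx => cutoff_nonneg hχ i m hx) (fun x hx => cutoff_le_one hχ i m hx)
    (fun x hx hx' => cutoff_eq_zero_of_notMem_over hχ hx hx')
    fun x hx => over_boundary_cases hx) ?_
  filter_upwards [ae_restrict_mem (G.isOpen_over i (m + 1)).measurableSet] with x hx
  rw [indicator_of_mem hx]

theorem indicator_cutoff_mul_eq (hχ : IsPartitionOfUnity G χ) (i : Fin Nc) (m : ℕ)
    (u : EuclideanSpace ℝ (Fin d) → ℝ) {x : EuclideanSpace ℝ (Fin d)} (hx : x ∈ P.dom) :
    (G.over i (m + 1)).indicator (fun x => cutoff G χ i m x * u x) x = cutoff G χ i m x * u x := by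
  by_cases h : x ∈ G.over i (m + 1)
  · rw [indicator_of_mem h]
  · rw [indicator_of_notMem h, cutoff_eq_zero_of_notMem_over hχ hx h, zero_mul]

/-! ### The smallest unused eigenvalue -/

/-- The set of relevant eigenvalues is finite and nonempty, so the infimum is attained and positive.
-/
theorem Lambda_pos_le {lam : Fin Nc → ℕ → ℝ} {l : Fin Nc → ℕ} (hl : ∀ i, 0 < lam i (l i))
    {S : Set (EuclideanSpace ℝ (Fin d))} {p : Fin Nc} (hp : (G.K p ∩ S).Nonempty) :
    0 < Lambda G lam l S ∧ Lambda G lam l S ≤ lam p (l p) := by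
  have hfin : {t | ∃ i, (G.K i ∩ S).Nonempty ∧ t = lam i (l i)}.Finite :=
    (finite_range fun i => lam i (l i)).subset (by rintro _ ⟨i, -, rfl⟩; exact ⟨i, rfl⟩)
  have hmem : lam p (l p) ∈ {t | ∃ i, (G.K i ∩ S).Nonempty ∧ t = lam i (l i)} := ⟨p, hp, rfl⟩
  refine ⟨?_, csInf_le hfin.bddBelow hmem⟩
  obtain ⟨q, -, hq⟩ := Set.Nonempty.csInf_mem ⟨_, hmem⟩ hfin
  unfold Lambda
  rw [hq]; exact hl q

end Grid

end CEM
end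

/-! ### Cutoff estimates on a single coarse element -/

open MeasureTheory Set
open scoped ContDiff
noncomputable section
namespace CEM

/-! ### Projections for a positive semidefinite form -/

section Projection

variable {X : Type*} [AddCommGroup X] [Module ℝ X] {s : LinearMap.BilinForm ℝ X} {φ : ℕ → X}

/-- The projection onto the span of the first `l` members of an orthonormal sequence. -/
def partialProj (s : LinearMap.BilinForm ℝ X) (φ : ℕ → X) (l : ℕ) (x : X) : X :=
  ∑ n ∈ Finset.range l, s x (φ n) • φ n

theorem IsPSD.partialProj_left (hs : IsPSD s) (l : ℕ) (x y : X) :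
    s (partialProj s φ l x) y = ∑ n ∈ Finset.range l, s x (φ n) * s y (φ n) := by
  simp only [partialProj, map_sum, LinearMap.sum_apply, map_smul, LinearMap.smul_apply,
    smul_eq_mul, hs.symm (φ _) y]

theorem IsPSD.partialProj_self (hs : IsPSD s)
    (hort : ∀ i j, s (φ i) (φ j) = if i = j then 1 else 0) (l : ℕ) (x : X) :
    s (partialProj s φ l x) (partialProj s φ l x) = ∑ n ∈ Finset.range l, s x (φ n) ^ 2 := by
  rw [hs.partialProj_left]
  refine Finset.sum_congr rfl fun n hn => ?_
  rw [hs.partialProj_left]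
  simp only [hort, mul_ite, mul_one, mul_zero, Finset.sum_ite_eq, hn, if_true, sq]

theorem IsPSD.sub_partialProj_self (hs : IsPSD s)
    (hort : ∀ i j, s (φ i) (φ j) = if i = j then 1 else 0) (l : ℕ) (x : X) :
    s (x - partialProj s φ l x) (x - partialProj s φ l x) =
      s x x - ∑ n ∈ Finset.range l, s x (φ n) ^ 2 := by
  rw [hs.sub_self, hs.partialProj_self hort, hs.symm x (partialProj s φ l x),
    hs.partialProj_left]
  simp only [← sq]
  ring

theorem IsPSD.bessel (hs : IsPSD s)
    (hort : ∀ i j, s (φ i) (φ j) = if i = j then 1 else 0) (l : ℕ) (x : X) :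
    ∑ n ∈ Finset.range l, s x (φ n) ^ 2 ≤ s x x := by
  have := hs.nonneg (x - partialProj s φ l x)
  rw [hs.sub_partialProj_self hort] at this
  linarith

end Projection

variable {d : ℕ}

theorem sqrt_add_le {a b : ℝ} (ha : 0 ≤ a) (hb : 0 ≤ b) : √(a + b) ≤ √a + √b :=
  Real.sqrt_le_iff.2 ⟨by positivity, by
    nlinarith [Real.sq_sqrt ha, Real.sq_sqrt hb, mul_nonneg (Real.sqrt_nonneg a)
      (Real.sqrt_nonneg b)]⟩

/-! ### The form of a coarse element -/

section Element

variable {K : Set (EuclideanSpace ℝ (Fin d))} {κ : EuclideanSpace ℝ (Fin d) → ℝ} {C : ℝ}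
  {lam : ℕ → ℝ} {φ : ℕ → EuclideanSpace ℝ (Fin d) → ℝ} {l : ℕ}
  {u v w u' v' t : EuclideanSpace ℝ (Fin d) → ℝ}

/-- The form `a(u, v) + s(πu, πv)` of a coarse element. -/
def elemForm (K : Set (EuclideanSpace ℝ (Fin d))) (κ : EuclideanSpace ℝ (Fin d) → ℝ)
    (φ : ℕ → EuclideanSpace ℝ (Fin d) → ℝ) (l : ℕ) (u v : EuclideanSpace ℝ (Fin d) → ℝ) : ℝ :=
  aForm K u v + ∑ n ∈ Finset.range l, sForm κ K u (φ n) * sForm κ K v (φ n)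

theorem elemForm_comm (u v : EuclideanSpace ℝ (Fin d) → ℝ) :
    elemForm K κ φ l u v = elemForm K κ φ l v u := by
  simp only [elemForm, aForm_comm K u v, mul_comm (sForm κ K u _)]

theorem elemForm_self_nonneg (u : EuclideanSpace ℝ (Fin d) → ℝ) :
    0 ≤ elemForm K κ φ l u u :=
  add_nonneg aForm_self_nonneg (Finset.sum_nonneg fun _ _ => mul_self_nonneg _)

theorem elemForm_add_left (h : IsWeight K κ C) (hφ : ∀ n, φ n ∈ H1 K) (hu : u ∈ H1 K)
    (hv : v ∈ H1 K) (hw : w ∈ H1 K) :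
    elemForm K κ φ l (u + v) w = elemForm K κ φ l u w + elemForm K κ φ l v w := by
  simp only [elemForm, aForm_add_left h.open_set hu hv hw, h.sForm_add_left hu.1 hv.1 (hφ _).1,
    add_mul, Finset.sum_add_distrib]
  ring

theorem elemForm_smul_left (hK : IsOpen K) (c : ℝ) (hu : u ∈ H1 K) (hv : v ∈ H1 K) :
    elemForm K κ φ l (c • u) v = c * elemForm K κ φ l u v := by
  simp only [elemForm, aForm_smul_left hK c hu hv, sForm_smul_left, mul_add, Finset.mul_sum,
    mul_assoc]

theorem elemForm_congr (hK : IsOpen K) (hu : u ∈ H1 K) (hv : v ∈ H1 K)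
    (huu : ∀ x ∈ K, u x = u' x) (hvv : ∀ x ∈ K, v x = v' x) :
    elemForm K κ φ l u v = elemForm K κ φ l u' v' := by
  have e1 : u =ᵐ[volume.restrict K] u' := by
    filter_upwards [ae_restrict_mem hK.measurableSet] with x hx using huu x hx
  have e2 : v =ᵐ[volume.restrict K] v' := by
    filter_upwards [ae_restrict_mem hK.measurableSet] with x hx using hvv x hx
  have g1 := isGrad_weakGrad hu
  have g2 := isGrad_weakGrad hv
  have e3 : aForm K u' v' = aForm K u v := (g1.congr e1 .rfl).aForm_eq hK (g2.congr e2 .rfl)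
  simp only [elemForm, e3, sForm_congr e1 .rfl, sForm_congr e2 .rfl]

theorem sForm_comb (h : IsWeight K κ C) (hφ : IsEigenSystem K κ lam φ) (l : ℕ) (α : ℕ → ℝ) :
    sForm κ K (fun x => ∑ n ∈ Finset.range l, α n * φ n x)
      (fun x => ∑ n ∈ Finset.range l, α n * φ n x) = ∑ n ∈ Finset.range l, α n ^ 2 := by
  let Φ : ℕ → H1Space K := fun n => ⟨φ n, (hφ.isEigen n).1⟩
  have hΦ : ∀ m n, sBil h (Φ m) (Φ n) = if m = n then 1 else 0 := hφ.orthonormal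
  have e : (fun x => ∑ n ∈ Finset.range l, α n * φ n x) =
      ((∑ n ∈ Finset.range l, α n • Φ n : H1Space K) : EuclideanSpace ℝ (Fin d) → ℝ) := by
    ext x; simp [Φ, Finset.sum_apply]
  rw [e, ← sBil_apply h]
  simp only [map_sum, LinearMap.sum_apply, map_smul, LinearMap.smul_apply, smul_eq_mul, hΦ,
    mul_ite, mul_one, mul_zero, Finset.sum_ite_eq', sq]
  refine Finset.sum_congr rfl fun n hn => ?_
  simp [hn]

theorem abs_mul_norm_gradient_le {x : EuclideanSpace ℝ (Fin d)}
    (hx : ‖gradient t x‖ ^ 2 ≤ 2 * κ x) : |u x| * ‖gradient t x‖ ≤ ‖√2 * (√(κ x) * u x)‖ := by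
  rw [norm_mul, norm_mul, Real.norm_of_nonneg (Real.sqrt_nonneg _),
    Real.norm_of_nonneg (Real.sqrt_nonneg _), ← mul_assoc, ← Real.sqrt_mul zero_le_two,
    mul_comm, Real.norm_eq_abs]
  exact mul_le_mul_of_nonneg_right (Real.le_sqrt_of_sq_le hx) (abs_nonneg _)

/-- In `-∇u · ∇(t u) = -t |∇u|² - u ∇u · ∇t` the first term has a good sign, and `|∇t| ≤ √2 √κ`
bounds the second. -/
theorem neg_aForm_mul_le (h : IsWeight K κ C) (hu : u ∈ H1 K) {L : NNReal}
    (ht : LipschitzOnWith L t K) (ht0 : ∀ x ∈ K, 0 ≤ t x) (ht1 : ∀ x ∈ K, t x ≤ 1)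
    (hg : ∀ᵐ x ∂(volume.restrict K), ‖gradient t x‖ ^ 2 ≤ 2 * κ x) :
    -aForm K u (fun x => t x * u x) ≤ √(aForm K u u) * (√2 * √(sForm κ K u u)) := by
  have hG := isGrad_weakGrad hu
  have hM : ∀ x ∈ K, |t x| ≤ 1 := fun x hx => abs_le.2 ⟨by linarith [ht0 x hx], ht1 x hx⟩
  rw [hG.aForm_eq h.open_set (hG.mul_lipschitz h.open_set ht hM), ← integral_neg, aForm_self,
    h.sForm_self]
  have hm : MemLp (fun x => √2 * (√(κ x) * u x)) 2 (volume.restrict K) :=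
    (h.memLp_sqrt_mul hu.1).const_mul _
  refine (integral_le_of_norm_mul_norm hG.memLp_grad hm ?_).trans (le_of_eq ?_)
  · filter_upwards [hg, ae_restrict_mem h.open_set.measurableSet] with x hx hxK
    rw [inner_add_right, inner_smul_right, inner_smul_right]
    have e1 : 0 ≤ t x * inner ℝ (weakGrad K u x) (weakGrad K u x) :=
      mul_nonneg (ht0 x hxK) real_inner_self_nonneg
    have e2 : -(u x * inner ℝ (weakGrad K u x) (gradient t x)) ≤
        ‖weakGrad K u x‖ * (|u x| * ‖gradient t x‖) := by
      refine (neg_le_abs _).trans ?_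
      rw [abs_mul]
      calc _ ≤ |u x| * (‖weakGrad K u x‖ * ‖gradient t x‖) :=
            mul_le_mul_of_nonneg_left (abs_real_inner_le_norm _ _) (abs_nonneg _)
        _ = _ := by ring
    have e3 := mul_le_mul_of_nonneg_left (abs_mul_norm_gradient_le (u := u) hx)
      (norm_nonneg (weakGrad K u x))
    linarith
  · have : nsq (volume.restrict K) (fun x => √2 * (√(κ x) * u x)) =
        √2 ^ 2 * nsq (volume.restrict K) (fun x => √(κ x) * u x) := nsq_smul √2 _
    rw [this, Real.sqrt_mul (by positivity), Real.sqrt_sq (Real.sqrt_nonneg _)]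

theorem aForm_mul_self_le (h : IsWeight K κ C) (hu : u ∈ H1 K) {L : NNReal}
    (ht : LipschitzOnWith L t K) (hM : ∀ x ∈ K, |t x| ≤ 1)
    (hg : ∀ᵐ x ∂(volume.restrict K), ‖gradient t x‖ ^ 2 ≤ 2 * κ x) :
    aForm K (fun x => t x * u x) (fun x => t x * u x) ≤
      2 * aForm K u u + 4 * sForm κ K u u := by
  have hG := isGrad_weakGrad hu
  have hG' := hG.mul_lipschitz h.open_set ht hM
  rw [aForm_self, nsq_congr (hG'.weakGrad_ae_eq h.open_set), aForm_self, h.sForm_self]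
  have m1 := memLp_smul_bdd h.open_set hG.memLp_grad ht hM
  have m2 := memLp_smul_gradient h.open_set hG.memLp ht
  have hm : MemLp (fun x => √2 * (√(κ x) * u x)) 2 (volume.restrict K) :=
    (h.memLp_sqrt_mul hu.1).const_mul _
  have e0 : nsq (volume.restrict K) (fun x => √2 * (√(κ x) * u x)) =
      √2 ^ 2 * nsq (volume.restrict K) (fun x => √(κ x) * u x) := nsq_smul √2 _
  rw [Real.sq_sqrt zero_le_two] at e0
  have e1 : nsq (volume.restrict K) (fun x => t x • weakGrad K u x) ≤
      nsq (volume.restrict K) (weakGrad K u) := by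
    refine nsq_le_of_norm_le hG.memLp_grad ?_
    filter_upwards [ae_restrict_mem h.open_set.measurableSet] with x hx
    rw [norm_smul]
    exact mul_le_of_le_one_left (norm_nonneg _) (hM x hx)
  have e2 : nsq (volume.restrict K) (fun x => u x • gradient t x) ≤
      nsq (volume.restrict K) (fun x => √2 * (√(κ x) * u x)) := by
    refine nsq_le_of_norm_le hm ?_
    filter_upwards [hg] with x hx
    rw [norm_smul]
    exact abs_mul_norm_gradient_le hx
  have e3 : nsq (volume.restrict K) (fun x => t x • weakGrad K u x + u x • gradient t x) ≤ _ :=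
    nsq_add_le m1 m2
  linarith

theorem sForm_mul_self_le (h : IsWeight K κ C) (hu : u ∈ H1 K) (hM : ∀ x ∈ K, |t x| ≤ 1) :
    sForm κ K (fun x => t x * u x) (fun x => t x * u x) ≤ sForm κ K u u := by
  rw [h.sForm_self, h.sForm_self]
  refine nsq_le_of_norm_le (h.memLp_sqrt_mul hu.1) ?_
  filter_upwards [ae_restrict_mem h.open_set.measurableSet] with x hx
  rw [norm_mul, norm_mul, norm_mul]
  gcongr
  exact mul_le_of_le_one_left (norm_nonneg _) (hM x hx)

/-- Applied with `v = πu` and `w = u - πu`. The term `-κ t v²` has a good sign, so only the mixed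
product survives, and `w` is small by the spectral inequality. -/
theorem neg_sForm_mul_le (h : IsWeight K κ C) (hv : v ∈ H1 K) (hw : w ∈ H1 K)
    (hvw : ∀ x, u x = v x + w x) (ht0 : ∀ x ∈ K, 0 ≤ t x) (ht1 : ∀ x ∈ K, t x ≤ 1) :
    -sForm κ K v (fun x => t x * u x) ≤ √(sForm κ K v v) * √(sForm κ K w w) := by
  rw [h.sForm_self, h.sForm_self, sForm, ← integral_neg]
  refine integral_le_of_norm_mul_norm (h.memLp_sqrt_mul hv.1) (h.memLp_sqrt_mul hw.1) ?_
  filter_upwards [ae_restrict_mem h.open_set.measurableSet] with x hx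
  have hκ := h.nonneg x
  have e1 : ‖√(κ x) * v x‖ * ‖√(κ x) * w x‖ = κ x * |v x * w x| := by
    rw [← norm_mul, Real.norm_eq_abs]
    calc |√(κ x) * v x * (√(κ x) * w x)| = |√(κ x) * √(κ x) * (v x * w x)| := by ring_nf
      _ = _ := by rw [Real.mul_self_sqrt hκ, abs_mul, abs_of_nonneg hκ]
  rw [e1, hvw]
  have e2 : 0 ≤ κ x * (t x * v x ^ 2) := mul_nonneg hκ (mul_nonneg (ht0 x hx) (sq_nonneg _))
  have e3 : -(t x * (v x * w x)) ≤ |v x * w x| := by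
    refine (neg_le_abs _).trans ?_
    rw [abs_mul, abs_of_nonneg (ht0 x hx)]
    exact mul_le_of_le_one_left (abs_nonneg _) (ht1 x hx)
  have e4 := mul_le_mul_of_nonneg_left e3 hκ
  calc _ = κ x * (-(t x * (v x * w x))) - κ x * (t x * v x ^ 2) := by ring
    _ ≤ _ := by linarith

/-- With `x² = a(u, u)`, `y² = s(πu, πu)` and `r = λ^(-1/2)`, the spectral inequality gives `√s(u,
u) ≤ y + r x` and `√s(u - πu, u - πu) ≤ r x`. The left side is therefore at most `√2 x (y + r x) + r
x y`. -/
theorem neg_elemForm_mul_le (h : IsWeight K κ C) (hc : SeqCompactH1 K)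
    (hφ : IsEigenSystem K κ lam φ) (hl : 0 < lam l) (hu : u ∈ H1 K) {L : NNReal}
    (ht : LipschitzOnWith L t K) (ht0 : ∀ x ∈ K, 0 ≤ t x) (ht1 : ∀ x ∈ K, t x ≤ 1)
    (hg : ∀ᵐ x ∂(volume.restrict K), ‖gradient t x‖ ^ 2 ≤ 2 * κ x) :
    -elemForm K κ φ l u (fun x => t x * u x) ≤
      2 * (1 + √((lam l)⁻¹)) * elemForm K κ φ l u u := by
  have hM : ∀ x ∈ K, |t x| ≤ 1 := fun x hx => abs_le.2 ⟨by linarith [ht0 x hx], ht1 x hx⟩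
  have htu : (fun x => t x * u x) ∈ H1 K :=
    ((isGrad_weakGrad hu).mul_lipschitz h.open_set ht hM).mem_H1
  let Φ : ℕ → H1Space K := fun n => ⟨φ n, (hφ.isEigen n).1⟩
  have hΦ : ∀ m n, sBil h (Φ m) (Φ n) = if m = n then 1 else 0 := hφ.orthonormal
  set π := partialProj (sBil h) Φ l ⟨u, hu⟩ with hπ
  have hs := isPSD_sBil h
  have h1 := neg_aForm_mul_le h hu ht ht0 ht1 hg
  have h2 := neg_sForm_mul_le (u := u) (v := π) (w := (⟨u, hu⟩ - π : H1Space K)) h π.2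
    (((⟨u, hu⟩ : H1Space K) - π).2 : _ ∈ H1 K) (fun x => by simp) ht0 ht1
  have h3 : sForm κ K π (fun x => t x * u x) = _ :=
    hs.partialProj_left (φ := Φ) l ⟨u, hu⟩ ⟨_, htu⟩
  have h4 : sForm κ K π π = _ := hs.partialProj_self hΦ l ⟨u, hu⟩
  have h5 : sForm κ K (⟨u, hu⟩ - π : H1Space K) (⟨u, hu⟩ - π : H1Space K) = _ :=
    hs.sub_partialProj_self hΦ l ⟨u, hu⟩
  have h6 := hφ.sForm_self_le h hc hl hu
  rw [h3, h4, h5] at h2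
  simp only [sBil_apply, Φ] at h2
  simp only [elemForm, ← sq]
  set A := aForm K u u
  set S := sForm κ K u u
  set Q := ∑ n ∈ Finset.range l, sForm κ K u (φ n) ^ 2
  have hA : 0 ≤ A := aForm_self_nonneg
  have hQ : 0 ≤ Q := Finset.sum_nonneg fun _ _ => sq_nonneg _
  have hlam : 0 ≤ (lam l)⁻¹ := (inv_pos.2 hl).le
  set r := √((lam l)⁻¹)
  have hr : 0 ≤ r := Real.sqrt_nonneg _
  have b1 : √(S - Q) ≤ r * √A := by
    rw [← Real.sqrt_mul hlam]
    exact Real.sqrt_le_sqrt (by linarith)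
  have b2 : √S ≤ √Q + r * √A := by
    refine (Real.sqrt_le_sqrt h6).trans ((sqrt_add_le hQ (by positivity)).trans ?_)
    rw [Real.sqrt_mul hlam]
  -- A rational bound good enough for the final constant `2 (1 + r)`.
  have b3 : √2 ≤ 3 / 2 := Real.sqrt_le_iff.2 ⟨by norm_num, by norm_num⟩
  have c1 := mul_le_mul_of_nonneg_left (mul_le_mul b3 b2 (Real.sqrt_nonneg _) (by norm_num))
    (Real.sqrt_nonneg A)
  have c2 := mul_le_mul_of_nonneg_left b1 (Real.sqrt_nonneg Q)
  have hx := Real.sq_sqrt hA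
  have hy := Real.sq_sqrt hQ
  have hx0 := Real.sqrt_nonneg A
  have hy0 := Real.sqrt_nonneg Q
  generalize √A = x at *
  generalize √Q = y at *
  rw [← hx, ← hy]
  have f1 : x * y ≤ (x ^ 2 + y ^ 2) / 2 := by nlinarith [sq_nonneg (x - y)]
  have f2 := mul_le_mul_of_nonneg_left f1 hr
  have f3 : 0 ≤ r * y ^ 2 := by positivity
  have f4 : 0 ≤ x ^ 2 := by positivity
  have f5 : 0 ≤ y ^ 2 := by positivity
  rw [neg_add]
  calc _ ≤ x * (3 / 2 * (y + r * x)) + y * (r * x) :=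
        add_le_add (h1.trans c1) (h2.trans c2)
    _ = 3 / 2 * (x * y) + 3 / 2 * (r * x ^ 2) + r * (x * y) := by ring
    _ ≤ 2 * (1 + r) * (x ^ 2 + y ^ 2) := by linarith

/-- Product rule and Bessel bound the left side by `2 a(u, u) + 5 s(u, u)`; the spectral inequality
absorbs the second term. -/
theorem elemForm_mul_self_le (h : IsWeight K κ C) (hc : SeqCompactH1 K)
    (hφ : IsEigenSystem K κ lam φ) (hl : 0 < lam l) (hu : u ∈ H1 K) {L : NNReal}
    (ht : LipschitzOnWith L t K) (hM : ∀ x ∈ K, |t x| ≤ 1)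
    (hg : ∀ᵐ x ∂(volume.restrict K), ‖gradient t x‖ ^ 2 ≤ 2 * κ x) :
    elemForm K κ φ l (fun x => t x * u x) (fun x => t x * u x) ≤
      5 * (1 + (lam l)⁻¹) * elemForm K κ φ l u u := by
  have htu : (fun x => t x * u x) ∈ H1 K :=
    ((isGrad_weakGrad hu).mul_lipschitz h.open_set ht hM).mem_H1
  have h1 := aForm_mul_self_le h hu ht hM hg
  have h2 := sForm_mul_self_le h hu hM
  have h3 : ∑ n ∈ Finset.range l, sForm κ K (fun x => t x * u x) (φ n) ^ 2 ≤
      sForm κ K (fun x => t x * u x) (fun x => t x * u x) :=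
    (isPSD_sBil h).bessel (φ := fun n => (⟨φ n, (hφ.isEigen n).1⟩ : H1Space K))
      hφ.orthonormal l ⟨_, htu⟩
  have h6 := hφ.sForm_self_le h hc hl hu
  simp only [elemForm, ← sq]
  have hA : 0 ≤ aForm K u u := aForm_self_nonneg
  have hQ : 0 ≤ ∑ n ∈ Finset.range l, sForm κ K u (φ n) ^ 2 :=
    Finset.sum_nonneg fun _ _ => sq_nonneg _
  have hlam : 0 ≤ (lam l)⁻¹ := (inv_pos.2 hl).le
  have := mul_nonneg hlam hQ
  nlinarith

end Element

end CEM
end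

/-! ### Euler equations, decay by layers, localization -/

open MeasureTheory Set
open scoped ContDiff
noncomputable section
namespace CEM

/-! ### The relaxed energy -/

section Global

variable {d Nc Nv : ℕ} {P : PerforatedDomain d} {G : CoarseGrid P Nc Nv}
  {χ : Fin Nv → EuclideanSpace ℝ (Fin d) → ℝ} {lam : Fin Nc → ℕ → ℝ}
  {φ : Fin Nc → ℕ → EuclideanSpace ℝ (Fin d) → ℝ} {l : Fin Nc → ℕ}
  {u v : EuclideanSpace ℝ (Fin d) → ℝ}

theorem isWeight_kappa_K (hχ : IsPartitionOfUnity G χ) (p : Fin Nc) :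
    ∃ C, IsWeight (G.K p) (kappa χ) C :=
  let ⟨C, hC⟩ := isWeight_kappa hχ
  ⟨C, hC.mono (G.isOpen_K p) (G.K_subset_dom p)⟩

theorem auxFun_eq_zero {p q : Fin Nc} (hpq : q ≠ p) (n : ℕ) {x : EuclideanSpace ℝ (Fin d)}
    (hx : x ∈ G.K p) : auxFun G φ q n x = 0 :=
  indicator_of_notMem (fun h => disjoint_left.1 (G.disjoint_K hpq) h hx) _

theorem auxFun_eq {p : Fin Nc} (n : ℕ) {x : EuclideanSpace ℝ (Fin d)} (hx : x ∈ G.K p) :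
    auxFun G φ p n x = φ p n x := indicator_of_mem hx _

theorem proj_eq (hφ : ∀ p, IsEigenSystem (G.K p) (kappa χ) (lam p) (φ p)) {p : Fin Nc}
    {x : EuclideanSpace ℝ (Fin d)} (hx : x ∈ G.K p) :
    proj G χ φ l u x =
      ∑ n ∈ Finset.range (l p), sForm (kappa χ) (G.K p) u (φ p n) * φ p n x := by
  unfold proj
  rw [Finset.sum_eq_single p (fun q _ hq => Finset.sum_eq_zero fun n _ => by
    rw [auxFun_eq_zero hq n hx, mul_zero]) (by simp)]
  refine Finset.sum_congr rfl fun n _ => ?_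
  rw [(hφ p).orthonormal, if_pos rfl, div_one, auxFun_eq n hx]

theorem sForm_proj_self (hχ : IsPartitionOfUnity G χ)
    (hφ : ∀ p, IsEigenSystem (G.K p) (kappa χ) (lam p) (φ p)) (p : Fin Nc) :
    sForm (kappa χ) (G.K p) (proj G χ φ l u) (proj G χ φ l u) =
      ∑ n ∈ Finset.range (l p), sForm (kappa χ) (G.K p) u (φ p n) ^ 2 := by
  obtain ⟨C, hC⟩ := isWeight_kappa_K hχ p
  rw [← sForm_comb hC (hφ p)]
  have : proj G χ φ l u =ᵐ[volume.restrict (G.K p)] fun x =>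
      ∑ n ∈ Finset.range (l p), sForm (kappa χ) (G.K p) u (φ p n) * φ p n x := by
    filter_upwards [ae_restrict_mem (G.isOpen_K p).measurableSet] with x hx using proj_eq hφ hx
  exact sForm_congr this this

/-- On `K_i` the coefficients of `πu - φ_j` are those of `πu` with the `j`-th shifted by `-1`; on
other elements `φ_j` is zero. -/
theorem sForm_proj_sub_auxFun (hχ : IsPartitionOfUnity G χ)
    (hφ : ∀ p, IsEigenSystem (G.K p) (kappa χ) (lam p) (φ p)) {i : Fin Nc} {j : ℕ}
    (hj : j < l i) (p : Fin Nc) :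
    sForm (kappa χ) (G.K p) (proj G χ φ l u - auxFun G φ i j) (proj G χ φ l u - auxFun G φ i j) =
      ∑ n ∈ Finset.range (l p), sForm (kappa χ) (G.K p) u (φ p n) ^ 2 +
        if p = i then 1 - 2 * sForm (kappa χ) (G.K i) u (φ i j) else 0 := by
  obtain ⟨C, hC⟩ := isWeight_kappa_K hχ p
  by_cases hp : p = i
  · subst hp
    have : proj G χ φ l u - auxFun G φ p j =ᵐ[volume.restrict (G.K p)] fun x =>
        ∑ n ∈ Finset.range (l p), (sForm (kappa χ) (G.K p) u (φ p n) - if n = j then 1 else 0) *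
          φ p n x := by
      filter_upwards [ae_restrict_mem (G.isOpen_K p).measurableSet] with x hx
      rw [Pi.sub_apply, proj_eq hφ hx, auxFun_eq j hx]
      simp [sub_mul, Finset.sum_sub_distrib, hj]
    rw [sForm_congr this this, sForm_comb hC (hφ p), if_pos rfl]
    simp only [sub_sq, Finset.sum_add_distrib, Finset.sum_sub_distrib, ite_pow, mul_ite]
    simp [hj]
    ring
  · rw [if_neg hp, add_zero, ← sForm_proj_self hχ hφ]
    have : proj G χ φ l u - auxFun G φ i j =ᵐ[volume.restrict (G.K p)] proj G χ φ l u := by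
      filter_upwards [ae_restrict_mem (G.isOpen_K p).measurableSet] with x hx
      rw [Pi.sub_apply, auxFun_eq_zero (Ne.symm hp) j hx, sub_zero]
    exact sForm_congr this this

theorem memLp_proj (hφ : ∀ p, IsEigenSystem (G.K p) (kappa χ) (lam p) (φ p))
    (u : EuclideanSpace ℝ (Fin d) → ℝ) : MemLp (proj G χ φ l u) 2 (volume.restrict P.dom) := by
  unfold proj
  refine memLp_finsetSum _ fun p _ => memLp_finsetSum _ fun n _ => MemLp.const_mul ?_ _
  exact memLp_indicator_ext (G.isOpen_K p).measurableSet ((hφ p).isEigen n).1.1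

variable (G χ φ l) in
/-- The form `a(u, v) + s(πu, πv)` restricted to a set of coarse elements. -/
def partForm (S : Finset (Fin Nc)) (u v : EuclideanSpace ℝ (Fin d) → ℝ) : ℝ :=
  ∑ p ∈ S, elemForm (G.K p) (kappa χ) (φ p) (l p) u v

theorem normASq_add_normSSq_proj (hχ : IsPartitionOfUnity G χ)
    (hφ : ∀ p, IsEigenSystem (G.K p) (kappa χ) (lam p) (φ p)) (hu : u ∈ H1 P.dom) :
    normASq P u + normSSq P χ (proj G χ φ l u) = partForm G χ φ l Finset.univ u u := by
  obtain ⟨C, hC⟩ := isWeight_kappa hχ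
  have e1 : normASq P u = aForm P.dom u u := by simp [normASq, aForm]
  have e2 : normSSq P χ (proj G χ φ l u) =
      ∑ p, sForm (kappa χ) (G.K p) (proj G χ φ l u) (proj G χ φ l u) := by
    have hm := memLp_proj (G := G) (l := l) hφ u
    unfold normSSq sForm
    rw [← G.setIntegral_dom (hC.integrable hm hm)]
    simp only [sq, mul_assoc]
  rw [e1, e2, G.aForm_dom hu hu, ← Finset.sum_add_distrib]
  refine Finset.sum_congr rfl fun p _ => ?_
  rw [sForm_proj_self hχ hφ]
  simp only [elemForm, sq]

/-- The functional is the quadratic form `b` plus an affine term supported on `K_i`, from which the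
Euler equation can be read off. -/
theorem relaxedEnergy_eq (hχ : IsPartitionOfUnity G χ)
    (hφ : ∀ p, IsEigenSystem (G.K p) (kappa χ) (lam p) (φ p)) {i : Fin Nc} {j : ℕ}
    (hj : j < l i) (hu : u ∈ H1 P.dom) :
    relaxedEnergy G χ φ l i j u = partForm G χ φ l Finset.univ u u +
      (1 - 2 * sForm (kappa χ) (G.K i) u (φ i j)) := by
  unfold relaxedEnergy sGlob
  simp only [sForm_proj_sub_auxFun hχ hφ hj, Finset.sum_add_distrib, Finset.sum_ite_eq',
    Finset.mem_univ, if_true]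
  rw [G.aForm_dom hu hu, ← add_assoc, ← Finset.sum_add_distrib]
  simp only [partForm, elemForm, sq]

/-! ### The bilinear form -/

theorem partForm_add_left (hχ : IsPartitionOfUnity G χ)
    (hφ : ∀ p, IsEigenSystem (G.K p) (kappa χ) (lam p) (φ p)) (S : Finset (Fin Nc))
    {w : EuclideanSpace ℝ (Fin d) → ℝ} (hu : u ∈ H1 P.dom) (hv : v ∈ H1 P.dom)
    (hw : w ∈ H1 P.dom) :
    partForm G χ φ l S (u + v) w = partForm G χ φ l S u w + partForm G χ φ l S v w := by
  simp only [partForm, ← Finset.sum_add_distrib]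
  refine Finset.sum_congr rfl fun p _ => ?_
  obtain ⟨C, hC⟩ := isWeight_kappa_K hχ p
  exact elemForm_add_left hC (fun n => ((hφ p).isEigen n).1) (mem_H1_mono hu (G.K_subset_dom p))
    (mem_H1_mono hv (G.K_subset_dom p)) (mem_H1_mono hw (G.K_subset_dom p))

theorem partForm_smul_left (S : Finset (Fin Nc)) (c : ℝ) (hu : u ∈ H1 P.dom)
    (hv : v ∈ H1 P.dom) : partForm G χ φ l S (c • u) v = c * partForm G χ φ l S u v := by
  simp only [partForm, Finset.mul_sum]
  exact Finset.sum_congr rfl fun p _ => elemForm_smul_left (G.isOpen_K p) c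
    (mem_H1_mono hu (G.K_subset_dom p)) (mem_H1_mono hv (G.K_subset_dom p))

theorem partForm_comm (S : Finset (Fin Nc)) (u v : EuclideanSpace ℝ (Fin d) → ℝ) :
    partForm G χ φ l S u v = partForm G χ φ l S v u :=
  Finset.sum_congr rfl fun _ _ => elemForm_comm u v

theorem partForm_add_right (hχ : IsPartitionOfUnity G χ)
    (hφ : ∀ p, IsEigenSystem (G.K p) (kappa χ) (lam p) (φ p)) (S : Finset (Fin Nc))
    {w : EuclideanSpace ℝ (Fin d) → ℝ} (hu : u ∈ H1 P.dom) (hv : v ∈ H1 P.dom)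
    (hw : w ∈ H1 P.dom) :
    partForm G χ φ l S w (u + v) = partForm G χ φ l S w u + partForm G χ φ l S w v := by
  rw [partForm_comm S w, partForm_comm S w, partForm_comm S w,
    partForm_add_left hχ hφ S hu hv hw]

theorem partForm_smul_right (S : Finset (Fin Nc)) (c : ℝ) (hu : u ∈ H1 P.dom)
    (hv : v ∈ H1 P.dom) : partForm G χ φ l S v (c • u) = c * partForm G χ φ l S v u := by
  rw [partForm_comm S v, partForm_comm S v, partForm_smul_left S c hu hv]

theorem partForm_self_nonneg (S : Finset (Fin Nc)) (u : EuclideanSpace ℝ (Fin d) → ℝ) :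
    0 ≤ partForm G χ φ l S u u :=
  Finset.sum_nonneg fun _ _ => elemForm_self_nonneg u

theorem partForm_mono {S T : Finset (Fin Nc)} (h : S ⊆ T) (u : EuclideanSpace ℝ (Fin d) → ℝ) :
    partForm G χ φ l S u u ≤ partForm G χ φ l T u u :=
  Finset.sum_le_sum_of_subset_of_nonneg h fun _ _ _ => elemForm_self_nonneg u

/-- The form `partForm` on the functions of `H1`. -/
def partBil (hχ : IsPartitionOfUnity G χ)
    (hφ : ∀ p, IsEigenSystem (G.K p) (kappa χ) (lam p) (φ p)) (l : Fin Nc → ℕ)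
    (S : Finset (Fin Nc)) : LinearMap.BilinForm ℝ (H1Space P.dom) :=
  LinearMap.mk₂ ℝ (fun u v => partForm G χ φ l S u v)
    (fun u v w => partForm_add_left hχ hφ S u.2 v.2 w.2)
    (fun c u v => partForm_smul_left S c u.2 v.2)
    (fun w u v => partForm_add_right hχ hφ S u.2 v.2 w.2)
    (fun c v u => partForm_smul_right S c u.2 v.2)

theorem partBil_apply (hχ : IsPartitionOfUnity G χ)
    (hφ : ∀ p, IsEigenSystem (G.K p) (kappa χ) (lam p) (φ p)) (S : Finset (Fin Nc))
    (u v : H1Space P.dom) : partBil hχ hφ l S u v = partForm G χ φ l S u v := rfl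

theorem isPSD_partBil (hχ : IsPartitionOfUnity G χ)
    (hφ : ∀ p, IsEigenSystem (G.K p) (kappa χ) (lam p) (φ p)) (S : Finset (Fin Nc)) :
    IsPSD (partBil hχ hφ l S) :=
  ⟨fun u v => by
    rw [partBil_apply, partBil_apply]
    exact partForm_comm (G := G) (χ := χ) (φ := φ) (l := l) S u v, fun u => by
    rw [partBil_apply]
    exact partForm_self_nonneg (G := G) (χ := χ) (φ := φ) (l := l) S u⟩

theorem sForm_add_left_K (hχ : IsPartitionOfUnity G χ)
    (hφ : ∀ p, IsEigenSystem (G.K p) (kappa χ) (lam p) (φ p)) (i : Fin Nc) (j : ℕ)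
    (hu : u ∈ H1 P.dom) (hv : v ∈ H1 P.dom) :
    sForm (kappa χ) (G.K i) (u + v) (φ i j) =
      sForm (kappa χ) (G.K i) u (φ i j) + sForm (kappa χ) (G.K i) v (φ i j) := by
  obtain ⟨C, hC⟩ := isWeight_kappa_K hχ i
  exact hC.sForm_add_left (mem_H1_mono hu (G.K_subset_dom i)).1
    (mem_H1_mono hv (G.K_subset_dom i)).1 ((hφ i).isEigen j).1.1

/-- The Euler equation of a minimizer of the relaxed energy over a space of functions. -/
theorem partForm_eq_of_isMinOn (hχ : IsPartitionOfUnity G χ)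
    (hφ : ∀ p, IsEigenSystem (G.K p) (kappa χ) (lam p) (φ p)) {i : Fin Nc} {j : ℕ}
    (hj : j < l i) {W : Set (EuclideanSpace ℝ (Fin d) → ℝ)} (hW : W ⊆ H1 P.dom)
    (hadd : ∀ u ∈ W, ∀ v ∈ W, u + v ∈ W) (hsmul : ∀ (c : ℝ), ∀ u ∈ W, c • u ∈ W)
    (hu : u ∈ W) (hmin : IsMinOn (relaxedEnergy G χ φ l i j) W u) (hv : v ∈ W) :
    partForm G χ φ l Finset.univ u v = sForm (kappa χ) (G.K i) v (φ i j) := by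
  rw [← sub_eq_zero]
  -- First variation along `u + t v`, which stays in `W`.
  refine eq_zero_of_quadratic_nonneg (r := partForm G χ φ l Finset.univ v v) fun t => ?_
  have h1 := hmin (hadd u hu _ (hsmul t v hv))
  have hs := isPSD_partBil (l := l) hχ hφ Finset.univ
  have h2 : partForm G χ φ l Finset.univ (u + t • v) (u + t • v) =
      partForm G χ φ l Finset.univ u u + 2 * (t * partForm G χ φ l Finset.univ u v) +
        t * (t * partForm G χ φ l Finset.univ v v) := by
    have h3 := hs.add_self ⟨u, hW hu⟩ (t • ⟨v, hW hv⟩)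
    simp only [map_smul, LinearMap.smul_apply, smul_eq_mul] at h3
    exact h3
  simp only [mem_ofPred_eq] at h1
  rw [relaxedEnergy_eq hχ hφ hj (hW hu),
    relaxedEnergy_eq hχ hφ hj (hW (hadd u hu _ (hsmul t v hv))), h2,
    sForm_add_left_K hχ hφ i j (hW hu) (hW (hsmul t v hv)), sForm_smul_left] at h1
  linarith

/-! ### Exponential decay -/

open Classical in
/-- The coarse elements outside the `m`-th layer. -/
def outside (G : CoarseGrid P Nc Nv) (i : Fin Nc) (m : ℕ) : Finset (Fin Nc) :=
  Finset.univ.filter fun p => p ∉ G.layer i m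

theorem mem_outside {i p : Fin Nc} {m : ℕ} : p ∈ outside G i m ↔ p ∉ G.layer i m := by
  simp [outside]

theorem outside_succ_subset (i : Fin Nc) (m : ℕ) : outside G i (m + 1) ⊆ outside G i m :=
  fun _ hp => mem_outside.2 fun h => mem_outside.1 hp (G.layer_subset_succ i m h)

theorem one_sub_cutoff_mul_mem_H1 (hχ : IsPartitionOfUnity G χ) (i : Fin Nc) (m : ℕ)
    (hu : u ∈ H1 P.dom) : (fun x => (1 - cutoff G χ i m x) * u x) ∈ H1 P.dom := by
  obtain ⟨C, hC⟩ := lipschitzOnWith_one_sub_cutoff hχ i m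
  exact ((isGrad_weakGrad hu).mul_lipschitz P.isOpen_dom hC fun x hx =>
    abs_one_sub_cutoff_le hχ i m hx).mem_H1

theorem one_sub_cutoff_mul_eq_zero (hχ : IsPartitionOfUnity G χ) {i p : Fin Nc} {m : ℕ}
    (hp : p ∈ G.layer i m) {x : EuclideanSpace ℝ (Fin d)} (hx : x ∈ G.K p) :
    (1 - cutoff G χ i m x) * u x = 0 := by
  rw [cutoff_eq_one hχ hp ⟨G.K_subset_cell p hx, G.K_subset_dom p hx⟩, sub_self, zero_mul]

theorem elemForm_eq_zero_of_vanish {p : Fin Nc} (hu : u ∈ H1 P.dom)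
    (hv : v ∈ H1 P.dom) (h0 : ∀ x ∈ G.K p, v x = 0) :
    elemForm (G.K p) (kappa χ) (φ p) (l p) u v = 0 := by
  have hu' := mem_H1_mono hu (G.K_subset_dom p)
  have hv' := mem_H1_mono hv (G.K_subset_dom p)
  rw [elemForm_congr (u' := u) (v' := (0 : ℝ) • v) (G.isOpen_K p) hu' hv' (fun _ _ => rfl)
    (fun x hx => by simp [h0 x hx]), elemForm_comm, elemForm_smul_left (G.isOpen_K p) 0 hv' hu',
    zero_mul]

theorem partForm_one_sub_cutoff_mul (hχ : IsPartitionOfUnity G χ) (i : Fin Nc) (m : ℕ)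
    (hu : u ∈ H1 P.dom) (hv : v ∈ H1 P.dom) :
    partForm G χ φ l Finset.univ v (fun x => (1 - cutoff G χ i m x) * u x) =
      partForm G χ φ l (outside G i m) v (fun x => (1 - cutoff G χ i m x) * u x) := by
  refine (Finset.sum_subset (Finset.subset_univ _) fun p _ hp => ?_).symm
  rw [mem_outside, not_not] at hp
  exact elemForm_eq_zero_of_vanish hv (one_sub_cutoff_mul_mem_H1 hχ i m hu) fun x hx =>
    one_sub_cutoff_mul_eq_zero hχ hp hx

theorem gradient_one_sub (σ : EuclideanSpace ℝ (Fin d) → ℝ) (x : EuclideanSpace ℝ (Fin d)) :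
    gradient (fun y => 1 - σ y) x = -gradient σ x := by
  simp [gradient, fderiv_const_sub]

theorem norm_gradient_one_sub_cutoff_sq_le (hd : d ≤ 3) (hχ : IsPartitionOfUnity G χ) (i : Fin Nc)
    (m : ℕ) (p : Fin Nc) : ∀ᵐ x ∂(volume.restrict (G.K p)),
      ‖gradient (fun x => 1 - cutoff G χ i m x) x‖ ^ 2 ≤ 2 * kappa χ x := by
  filter_upwards [norm_gradient_cutoff_sq_le hd hχ i m p] with x hx
  rwa [gradient_one_sub, norm_neg]

/-- One step of the decay estimate. -/
theorem partForm_outside_succ_le (hd : d ≤ 3) (hχ : IsPartitionOfUnity G χ)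
    (hφ : ∀ p, IsEigenSystem (G.K p) (kappa χ) (lam p) (φ p)) (hl : ∀ p, 0 < lam p (l p))
    (hu : u ∈ H1 P.dom) {i : Fin Nc} {m : ℕ} {Λ : ℝ} (hΛ : 0 < Λ)
    (hlam : ∀ p ∈ G.layer i (m + 1), Λ ≤ lam p (l p))
    (h0 : partForm G χ φ l Finset.univ u (fun x => (1 - cutoff G χ i m x) * u x) = 0) :
    partForm G χ φ l (outside G i (m + 1)) u u ≤ 2 * (1 + √(Λ⁻¹)) *
      (partForm G χ φ l (outside G i m) u u - partForm G χ φ l (outside G i (m + 1)) u u) := by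
  have htu := one_sub_cutoff_mul_mem_H1 hχ i m hu
  rw [partForm_one_sub_cutoff_mul hχ i m hu hu] at h0
  obtain ⟨L, hL⟩ := lipschitzOnWith_one_sub_cutoff hχ i m
  unfold partForm at *
  -- The elements outside layer `m` split into those outside layer `m + 1`, where the test function
  -- equals `u`, and the ring between, whose contribution must cancel the energy outside.
  rw [← Finset.sum_sdiff (outside_succ_subset i m)] at h0
  rw [← Finset.sum_sdiff (outside_succ_subset i m), add_sub_cancel_right, Finset.mul_sum]
  have h1 : ∑ p ∈ outside G i (m + 1), elemForm (G.K p) (kappa χ) (φ p) (l p) u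
      (fun x => (1 - cutoff G χ i m x) * u x) =
      ∑ p ∈ outside G i (m + 1), elemForm (G.K p) (kappa χ) (φ p) (l p) u u := by
    refine Finset.sum_congr rfl fun p hp => ?_
    refine elemForm_congr (G.isOpen_K p) (mem_H1_mono hu (G.K_subset_dom p))
      (mem_H1_mono htu (G.K_subset_dom p)) (fun _ _ => rfl) fun x hx => ?_
    rw [cutoff_eq_zero hχ (mem_outside.1 hp) ⟨G.K_subset_cell p hx, G.K_subset_dom p hx⟩,
      sub_zero, one_mul]
  rw [h1] at h0
  rw [eq_neg_of_add_eq_zero_right h0, ← Finset.sum_neg_distrib]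
  refine Finset.sum_le_sum fun p hp => ?_
  obtain ⟨C, hC⟩ := isWeight_kappa_K hχ p
  have hp' : p ∈ G.layer i (m + 1) := by
    by_contra h
    exact (Finset.mem_sdiff.1 hp).2 (mem_outside.2 h)
  refine (neg_elemForm_mul_le hC (G.seqCompactH1_K p) (hφ p) (hl p)
    (mem_H1_mono hu (G.K_subset_dom p)) (hL.mono (G.K_subset_dom p)) (fun x hx => ?_)
    (fun x hx => ?_) (norm_gradient_one_sub_cutoff_sq_le hd hχ i m p)).trans ?_
  · exact sub_nonneg.2 (cutoff_le_one hχ i m (G.K_subset_dom p hx))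
  · exact sub_le_self _ (cutoff_nonneg hχ i m (G.K_subset_dom p hx))
  · have := Real.sqrt_le_sqrt (inv_anti₀ hΛ (hlam p hp'))
    have h2 := elemForm_self_nonneg (K := G.K p) (κ := kappa χ) (φ := φ p) (l := l p) u
    gcongr

/-- Exponential decay away from the coarse element `i`. -/
theorem partForm_outside_le (hd : d ≤ 3) (hχ : IsPartitionOfUnity G χ)
    (hφ : ∀ p, IsEigenSystem (G.K p) (kappa χ) (lam p) (φ p)) (hl : ∀ p, 0 < lam p (l p))
    (hu : u ∈ H1 P.dom) {i : Fin Nc} {M : ℕ} {Λ : ℝ} (hΛ : 0 < Λ)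
    (hlam : ∀ p ∈ G.layer i M, Λ ≤ lam p (l p))
    (h0 : ∀ m, partForm G χ φ l Finset.univ u (fun x => (1 - cutoff G χ i m x) * u x) = 0)
    {m : ℕ} (hm : m ≤ M) :
    partForm G χ φ l (outside G i m) u u ≤
      ((1 + (2 * (1 + √(Λ⁻¹)))⁻¹)⁻¹) ^ m * partForm G χ φ l Finset.univ u u := by
  induction m with
  | zero => simpa using partForm_mono (Finset.subset_univ _) u
  | succ m ih =>
    have h1 := partForm_outside_succ_le hd hχ hφ hl hu (i := i) (m := m) hΛ
      (fun p hp => hlam p (G.layer_mono i hm hp)) (h0 m)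
    have h2 := ih (Nat.le_of_succ_le hm)
    have hc : 0 < 2 * (1 + √(Λ⁻¹)) := by positivity
    rw [pow_succ', mul_assoc]
    refine le_trans ?_ (mul_le_mul_of_nonneg_left h2 (by positivity))
    -- `E' ≤ c (E - E')` is equivalent to `E' ≤ (1 + c⁻¹)⁻¹ E`.
    rw [inv_mul_eq_div, le_div_iff₀ (by positivity), mul_add, mul_one, ← div_eq_mul_inv,
      ← le_sub_iff_add_le', div_le_iff₀ hc, mul_comm]
    exact h1

/-- Multiplication by a cutoff function outside a layer. -/
theorem partForm_one_sub_cutoff_self_le (hd : d ≤ 3) (hχ : IsPartitionOfUnity G χ)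
    (hφ : ∀ p, IsEigenSystem (G.K p) (kappa χ) (lam p) (φ p)) (hl : ∀ p, 0 < lam p (l p))
    (hu : u ∈ H1 P.dom) (i : Fin Nc) (m : ℕ) :
    partForm G χ φ l (outside G i m) (fun x => (1 - cutoff G χ i m x) * u x)
        (fun x => (1 - cutoff G χ i m x) * u x) ≤
      5 * (1 + (Lambda G lam l (P.dom \ G.over i m))⁻¹) *
        partForm G χ φ l (outside G i m) u u := by
  obtain ⟨L, hL⟩ := lipschitzOnWith_one_sub_cutoff hχ i m
  unfold partForm
  rw [Finset.mul_sum]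
  refine Finset.sum_le_sum fun p hp => ?_
  obtain ⟨C, hC⟩ := isWeight_kappa_K hχ p
  -- An element outside the layer does not meet the oversampling domain, so its eigenvalue enters
  -- the minimum. Without such elements the sum is empty, and the value `sInf ∅ = 0` does no harm.
  obtain ⟨x, hx⟩ := G.nonempty_K p
  obtain ⟨h1, h2⟩ := Lambda_pos_le (G := G) hl (S := P.dom \ G.over i m) (p := p)
    ⟨x, hx, G.K_subset_dom p hx, disjoint_left.1 (G.disjoint_K_over (mem_outside.1 hp)) hx⟩
  refine (elemForm_mul_self_le hC (G.seqCompactH1_K p) (hφ p) (hl p)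
    (mem_H1_mono hu (G.K_subset_dom p)) (hL.mono (G.K_subset_dom p)) (fun x hx =>
    abs_one_sub_cutoff_le hχ i m (G.K_subset_dom p hx))
    (norm_gradient_one_sub_cutoff_sq_le hd hχ i m p)).trans ?_
  have h3 := elemForm_self_nonneg (K := G.K p) (κ := kappa χ) (φ := φ p) (l := l p) u
  gcongr

theorem Lambda_nonneg (hl : ∀ p, 0 < lam p (l p)) (S : Set (EuclideanSpace ℝ (Fin d))) :
    0 ≤ Lambda G lam l S :=
  Real.sInf_nonneg (by rintro _ ⟨p, -, rfl⟩; exact (hl p).le)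

theorem sForm_one_sub_cutoff_mul (hχ : IsPartitionOfUnity G χ) (i : Fin Nc) (m : ℕ)
    (w : EuclideanSpace ℝ (Fin d) → ℝ) :
    sForm (kappa χ) (G.K i) (fun x => (1 - cutoff G χ i m x) * u x) w = 0 := by
  refine (setIntegral_congr_fun (G.isOpen_K i).measurableSet (g := fun _ => 0) fun x hx => ?_).trans
    (by simp)
  simp only [one_sub_cutoff_mul_eq_zero (u := u) hχ (G.self_mem_layer i m) hx, mul_zero, zero_mul]

/-- Localization of the solution of the Euler equation. -/
theorem partForm_sub_self_le (hd : d ≤ 3) (hχ : IsPartitionOfUnity G χ)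
    (hφ : ∀ p, IsEigenSystem (G.K p) (kappa χ) (lam p) (φ p)) (hl : ∀ p, 0 < lam p (l p))
    {i : Fin Nc} {j m : ℕ} (hu : u ∈ V P) (hv : v ∈ V0 G i (m + 1))
    (hu' : ∀ w ∈ V P, partForm G χ φ l Finset.univ u w = sForm (kappa χ) (G.K i) w (φ i j))
    (hv' : ∀ w ∈ V0 G i (m + 1),
      partForm G χ φ l Finset.univ v w = sForm (kappa χ) (G.K i) w (φ i j)) :
    partForm G χ φ l Finset.univ (u - v) (u - v) ≤
      3 * (1 + (Lambda G lam l (P.dom \ G.over i m))⁻¹) *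
        ((1 + (2 * (1 + √((Lambda G lam l (G.over i m))⁻¹)))⁻¹)⁻¹) ^ m *
          partForm G χ φ l Finset.univ u u := by
  have hvV := V0_subset_V hv
  have huH := V_subset_H1 hu
  have hvH := V_subset_H1 hvV
  have hs := isPSD_partBil (l := l) hχ hφ Finset.univ
  set b := partBil hχ hφ l Finset.univ with hb
  set T : EuclideanSpace ℝ (Fin d) → ℝ := fun x => (1 - cutoff G χ i m x) * u x with hT
  have hTV : T ∈ V P := V_one_sub_cutoff_mul hχ i m hu
  have hTH := V_subset_H1 hTV
  set w := (G.over i (m + 1)).indicator (fun x => cutoff G χ i m x * u x) with hw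
  have hwV : w ∈ V0 G i (m + 1) := V0_cutoff_mul hχ i m hu
  have hwH := V_subset_H1 (V0_subset_V hwV)
  let U : H1Space P.dom := ⟨u, huH⟩
  let U' : H1Space P.dom := ⟨v, hvH⟩
  let T' : H1Space P.dom := ⟨T, hTH⟩
  let W : H1Space P.dom := ⟨w, hwH⟩
  -- Galerkin orthogonality: both Euler equations have the same right-hand side on the smaller
  -- space.
  have orth : ∀ z : H1Space P.dom, (z : EuclideanSpace ℝ (Fin d) → ℝ) ∈ V0 G i (m + 1) →
      b (U - U') z = 0 := fun z hz => by
    rw [map_sub, LinearMap.sub_apply, sub_eq_zero]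
    exact (hu' z (V0_subset_V hz)).trans (hv' z hz).symm
  have o1 := orth U' hv
  have o2 := orth W hwV
  -- `W` is `χ u`, which on the elements is `u - (1 - χ) u`; it is admissible because it vanishes
  -- outside the next layer.
  have o3 : b (U - U') W = b (U - U') (U - T') := by
    change partForm G χ φ l Finset.univ _ _ = partForm G χ φ l Finset.univ _ _
    refine Finset.sum_congr rfl fun p _ => ?_
    refine elemForm_congr (G.isOpen_K p) (mem_H1_mono (U - U').2 (G.K_subset_dom p))
      (mem_H1_mono hwH (G.K_subset_dom p)) (fun _ _ => rfl) fun x hx => ?_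
    refine (indicator_cutoff_mul_eq hχ i m u (G.K_subset_dom p hx)).trans ?_
    change _ = u x - (1 - cutoff G χ i m x) * u x
    ring
  -- `T` vanishes on `K_i`, where the right-hand side of the Euler equation lives.
  have o4 : b U T' = 0 := (hu' T hTV).trans (sForm_one_sub_cutoff_mul hχ i m _)
  have e1 : b (U - U') (U - U') = -b U' T' := by
    rw [o3] at o2
    simp only [map_sub, LinearMap.sub_apply] at o1 o2 ⊢
    linarith
  have e2 : b U' T' = partBil hχ hφ l (outside G i m) U' T' :=
    partForm_one_sub_cutoff_mul hχ i m huH hvH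
  have e3 := (neg_le_abs _).trans ((isPSD_partBil (l := l) hχ hφ (outside G i m)).abs_le U' T')
  rw [← e2, ← e1] at e3
  -- By orthogonality `U'` is the `b`-projection of `U`, so its energy is no larger.
  have e4 : b U' U' ≤ b U U := by
    have h1 := hs.nonneg (U - U')
    rw [map_sub, LinearMap.sub_apply, sub_eq_zero] at o1
    rw [hs.sub_self, o1] at h1
    linarith
  have hΛp : ∀ p ∈ G.layer i m, 0 < Lambda G lam l (G.over i m) ∧
      Lambda G lam l (G.over i m) ≤ lam p (l p) := fun p hp =>
    let ⟨x, hx⟩ := G.nonempty_K p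
    Lambda_pos_le hl ⟨x, hx, G.K_subset_over hp hx⟩
  have hΛ := (hΛp i (G.self_mem_layer i m)).1
  have d1 := partForm_outside_le hd hχ hφ hl huH hΛ (fun p hp => (hΛp p hp).2) (fun n =>
    (hu' _ (V_one_sub_cutoff_mul hχ i n hu)).trans (sForm_one_sub_cutoff_mul hχ i n _)) le_rfl
  -- The local minimizer decays as well: `(1 - χ) v` is admissible in its own space. Together with
  -- `d1` this yields `√θ · √θ = θ`, a full power of the rate.
  have d2 := partForm_outside_le hd hχ hφ hl hvH hΛ (fun p hp => (hΛp p hp).2) (fun n =>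
    (hv' _ (V0_one_sub_cutoff_mul hχ i n (m + 1) hv)).trans
      (sForm_one_sub_cutoff_mul hχ i n _)) le_rfl
  have d3 := partForm_one_sub_cutoff_self_le hd hχ hφ hl huH i m
  set θ := ((1 + (2 * (1 + √((Lambda G lam l (G.over i m))⁻¹)))⁻¹)⁻¹) ^ m with hθ
  have hθ0 : 0 ≤ θ := by positivity
  set R := (Lambda G lam l (P.dom \ G.over i m))⁻¹
  have hR : 0 ≤ R := inv_nonneg.2 (Lambda_nonneg hl _)
  have hQ : 0 ≤ partForm G χ φ l Finset.univ u u := partForm_self_nonneg _ _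
  set Q := partForm G χ φ l Finset.univ u u
  have f1 : partBil hχ hφ l (outside G i m) U' U' ≤ θ * Q :=
    d2.trans (mul_le_mul_of_nonneg_left e4 hθ0)
  -- `5 (1 + R) ≤ (3 (1 + R))²`, whose square root is the factor `3 (1 + R)` of the claim.
  have f2 : partBil hχ hφ l (outside G i m) T' T' ≤ (3 * (1 + R)) ^ 2 * (θ * Q) := by
    refine d3.trans (mul_le_mul ?_ d1 (partForm_self_nonneg _ _) (by positivity))
    nlinarith
  have f3 := e3.trans (mul_le_mul (Real.sqrt_le_sqrt f1) (Real.sqrt_le_sqrt f2)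
    (Real.sqrt_nonneg _) (Real.sqrt_nonneg _))
  rw [Real.sqrt_mul (sq_nonneg _), Real.sqrt_sq (by positivity), mul_left_comm,
    Real.mul_self_sqrt (by positivity), ← mul_assoc] at f3
  exact f3

end Global

end CEM
end

theorem mainTheorem4 {d : ℕ} (hd : d = 2 ∨ d = 3) (P : CEM.PerforatedDomain d) {Nc Nv : ℕ}
    (G : CEM.CoarseGrid P Nc Nv)
    (χ : Fin Nv → EuclideanSpace ℝ (Fin d) → ℝ) (hχ : CEM.IsPartitionOfUnity G χ)
    (lam : Fin Nc → ℕ → ℝ) (φ : Fin Nc → ℕ → EuclideanSpace ℝ (Fin d) → ℝ)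
    (hφ : ∀ i, CEM.IsEigenSystem (G.K i) (CEM.kappa χ) (lam i) (φ i))
    (l : Fin Nc → ℕ) (hl : ∀ i, 0 < lam i (l i))
    (i : Fin Nc) (j : ℕ) (hj : j < l i) (k : ℕ) (hk : 2 ≤ k)
    (ψ ψms : EuclideanSpace ℝ (Fin d) → ℝ)
    (hψ : CEM.IsGlobalBasis G χ φ l i j ψ)
    (hψms : CEM.IsMultiscaleBasis G χ φ l i j k ψms) :
    CEM.normASq P (ψ - ψms) + CEM.normSSq P χ (CEM.proj G χ φ l (ψ - ψms)) ≤
      CEM.decayFactor G lam l i k *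
        (CEM.normASq P ψ + CEM.normSSq P χ (CEM.proj G χ φ l ψ)) := by
  -- The cutoff of layer `m = k - 1` is supported in layer `k`, which accounts for the exponent `1 -
  -- k = -m`.
  obtain ⟨m, rfl⟩ : ∃ m, k = m + 1 := ⟨k - 1, by omega⟩
  have hd3 : d ≤ 3 := by omega
  have hu := hψ.1
  have hv := hψms.1
  have huH := CEM.V_subset_H1 hu
  have hvH := CEM.V_subset_H1 (CEM.V0_subset_V hv)
  have hu' : ∀ w ∈ CEM.V P, CEM.partForm G χ φ l Finset.univ ψ w =
      CEM.sForm (CEM.kappa χ) (G.K i) w (φ i j) := fun w hw =>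
    CEM.partForm_eq_of_isMinOn hχ hφ hj (fun _ => CEM.V_subset_H1)
      (fun _ h _ h' => CEM.V_add h h') (fun c _ h => CEM.V_smul c h) hu hψ.2 hw
  have hv' : ∀ w ∈ CEM.V0 G i (m + 1), CEM.partForm G χ φ l Finset.univ ψms w =
      CEM.sForm (CEM.kappa χ) (G.K i) w (φ i j) := fun w hw =>
    CEM.partForm_eq_of_isMinOn hχ hφ hj (fun _ h => CEM.V_subset_H1 (CEM.V0_subset_V h))
      (fun _ h _ h' => CEM.V0_add h h') (fun c _ h => CEM.V0_smul c h) hv hψms.2 hw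
  rw [CEM.normASq_add_normSSq_proj hχ hφ huH,
    CEM.normASq_add_normSSq_proj hχ hφ (CEM.sub_mem_H1 huH hvH)]
  refine (CEM.partForm_sub_self_le hd3 hχ hφ hl hu hv hu' hv').trans_eq ?_
  have h0 := CEM.Lambda_nonneg (G := G) hl (G.over i m)
  have e1 : (1 : ℤ) - ((m + 1 : ℕ) : ℤ) = -(m : ℤ) := by push_cast; ring
  rw [CEM.decayFactor, Nat.add_sub_cancel, e1, zpow_neg, zpow_natCast, inv_pow,
    Real.rpow_neg h0, ← Real.sqrt_eq_rpow, Real.sqrt_inv]
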